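/- Let $0\le k<1$, $K=\frac{1+k}{1-k}$ and $\mathbb D=\{z\in\mathbb C:|z|<1\}$. Let $\mathcal C_H^0(K)$ be the class of harmonic maps $f=h+\overline g$ of $\mathbb D$, with $h,g$ analytic in $\mathbb D$, $h(0)=g(0)=g'(0)=0$, $h'(0)=1$, such that $f$ is injective on $\mathbb D$, sense-preserving ($|h'|^2-|g'|^2>0$ in $\mathbb D$), has convex range $f(\mathbb D)$, and satisfies $|g'(z)/h'(z)|\le k$ for all $z\in\mathbb D$. Put $$H_k(z)=\frac{z}{(1-k)(1-z)}+\frac{k}{(1-k)^2}\log\frac{1-z}{1-kz},\qquad G_k(z)=\frac{-kz}{(1-k)(1-z)}-\frac{k}{(1-k)^2}\log\frac{1-z}{1-kz},$$ $L_k=H_k+\overline{G_k}$ and, for $|\lambda|=1$, $L_k^\lambda(z)=\overline\lambda L_k(\lambda z)$ and $H_k^\lambda(z)=\overline\lambda H_k(\lambda z)$, where $\log$ is the principal branch. For $0\le r<1$ put $$A(k,r)=\frac{r}{(1-k)(1-r)}+\frac{k}{(1-k)^2}\log\frac{1-r}{1-kr},\qquad B(k,r)=\frac{r}{(1-k)(1+r)}+\frac{k}{(1-k)^2}\log\frac{1+kr}{1+r}.$$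 If $f=h+\overline g\in\mathcal C_H^0(K)$, then for every $z\in\mathbb D$ $$B(k,|z|)\le|h(z)|\le A(k,|z|)\qquad\text{and}\qquad \frac{1}{(1+|z|)^2(1+k|z|)}\le|h'(z)|\le\frac{1}{(1-|z|)^2(1-k|z|)}.$$ These estimates are sharp. For each $z\in\mathbb D\setminus\{0\}$, equality at $z$ in either one of the two upper bounds holds if and only if $h=H_k^{\lambda_1}$ on $\mathbb D$, where $\lambda_1=\overline z/|z|$, and equality at $z$ in either one of the two lower bounds holds if and only if $h=H_k^{\lambda_2}$ on $\mathbb D$, where $\lambda_2=-\overline z/|z|$. Moreover, for every $|\lambda|=1$ the map $L_k^\lambda$ belongs to $\mathcal C_H^0(K)$ and has analytic part $H_k^\lambda$, so all the bounds are attained. -/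

import Mathlib

noncomputable section

namespace ConvexHarmonic

open Complex

/-- The open unit disk. -/
def disk : Set ℂ := Metric.ball (0 : ℂ) 1

/-- `f` is a normalized harmonic map of the disk with canonical representation `f = h + conj g`:
`h(z) = z + a₂z² + ⋯` and `g(z) = b₁z + b₂z² + ⋯` are analytic in the disk. -/
structure ClassH (f h g : ℂ → ℂ) : Prop where
  analytic_h : DifferentiableOn ℂ h disk
  analytic_g : DifferentiableOn ℂ g disk
  rep : ∀ z ∈ disk, f z = h z + starRingEnd ℂ (g z)
  h_zero : h 0 = 0
  g_zero : g 0 = 0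
  deriv_h_zero : deriv h 0 = 1

/-- The Jacobian of `h + conj g`. -/
def jacobian (h g : ℂ → ℂ) (z : ℂ) : ℝ := ‖deriv h z‖ ^ 2 - ‖deriv g z‖ ^ 2

/-- The dilatation `g' / h'` of `h + conj g`. -/
def dilatation (h g : ℂ → ℂ) (z : ℂ) : ℂ := deriv g z / deriv h z

/-- Univalent sense-preserving normalized harmonic maps of the disk. -/
structure ClassSH (f h g : ℂ → ℂ) : Prop extends ClassH f h g where
  univalent : Set.InjOn f disk
  sense_preserving : ∀ z ∈ disk, 0 < jacobian h g z

/-- `K`-quasiconformal members of `ClassSH`: `|g'/h'| ≤ k` for the `k ∈ [0, 1)` with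
`K = (1 + k) / (1 - k)`. -/
structure ClassSHK (K : ℝ) (f h g : ℂ → ℂ) : Prop extends ClassSH f h g where
  quasiregular : ∃ k : ℝ, 0 ≤ k ∧ k < 1 ∧ K = (1 + k) / (1 - k) ∧
    ∀ z ∈ disk, ‖dilatation h g z‖ ≤ k

/-- Members of `ClassSH` with convex range and `g'(0) = 0`. -/
structure ClassCH0 (f h g : ℂ → ℂ) : Prop extends ClassSH f h g where
  convex_range : Convex ℝ (f '' disk)
  deriv_g_zero : deriv g 0 = 0

/-- The class `C_H^0(K)` of convex `K`-quasiconformal harmonic maps, with `g'(0) = 0`. -/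
def ClassCH0K (K : ℝ) (f h g : ℂ → ℂ) : Prop := ClassSHK K f h g ∧ ClassCH0 f h g

/-- Analytic part of the half-plane `K`-quasiconformal harmonic map. -/
def Hk (k : ℝ) (z : ℂ) : ℂ :=
  z / ((1 - k) * (1 - z)) + k / (1 - k) ^ 2 * Complex.log ((1 - z) / (1 - k * z))

/-- Co-analytic part of the half-plane `K`-quasiconformal harmonic map. -/
def Gk (k : ℝ) (z : ℂ) : ℂ :=
  -k * z / ((1 - k) * (1 - z)) - k / (1 - k) ^ 2 * Complex.log ((1 - z) / (1 - k * z))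

/-- The half-plane `K`-quasiconformal harmonic map. -/
def Lk (k : ℝ) (z : ℂ) : ℂ := Hk k z + starRingEnd ℂ (Gk k z)

/-- The rotation `z ↦ conj(lam) F(lam z)` of a function `F`, for `|lam| = 1`. -/
def rotation (lam : ℂ) (F : ℂ → ℂ) (z : ℂ) : ℂ := starRingEnd ℂ lam * F (lam * z)

/-- The upper growth bound. -/
def A (k r : ℝ) : ℝ :=
  r / ((1 - k) * (1 - r)) + k / (1 - k) ^ 2 * Real.log ((1 - r) / (1 - k * r))

/-- The lower growth bound. -/
def B (k r : ℝ) : ℝ :=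
  r / ((1 - k) * (1 + r)) + k / (1 - k) ^ 2 * Real.log ((1 + k * r) / (1 + r))

end ConvexHarmonic

end

noncomputable section

namespace ConvexHarmonic

open Complex Metric Set Filter Topology MeasureTheory
open scoped ComplexConjugate ENNReal

/-! The analytic core is a positivity property of convex harmonic maps: there are unimodular `μ` and
`p` such that `(μ h' - conj μ g') (p + conj p z²)` has nonnegative real part on the disk. The shear
`μ h - conj μ g` has the same imaginary part as `μ f`. When `f` extends continuously to the closed
disk, the height `Im (μ f)` rises along both arcs of the circle from a minimum `ζ₁` to a maximum
`ζ₂`, since an alternation would give two disjoint level regions joining interlaced boundary points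
(`not_alternating`). Hence the hyperbolic flow from `ζ₁` to `ζ₂` increases the height on the circle
and, by the Poisson formula, in the disk. Differentiating in the flow parameter gives the positivity
with a quadratic whose linear coefficient is a multiple of `Im (ζ₁ conj ζ₂)`. As `μ` turns to `-μ`
this sign flips, so connectedness of the circle yields one `μ` admitting both signs, and a
nonnegative combination removes the linear term. The general case follows by exhausting the convex
range from inside. The Riemann maps of the corresponding subdomains, normalized at `0`, tend to a
rotation, and the length-area principle supplies the continuous extensions.

For the distortion theorem at `z`, this is applied after a disk automorphism taking the hyperbolic
midpoint of `0` and `z` to `0`. The transported quadratic then has ratio `1 - |z|²` between its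
values at `z` and `0`, whatever `p` is. Its product `q` with the shear derivative has nonnegative
real part, so `|q(z)| / |q(0)|` lies between `(1 - |z|) / (1 + |z|)` and its inverse. The remaining
factor is `μ - conj μ ω`, where `ω` is the dilatation, and the Schwarz lemma gives `|ω(z)| ≤ k |z|`.
Equality makes both Schwarz inequalities rigid: `ω` is linear, `q` is a half-plane map, and the
lower distortion bound near one boundary point identifies the quadratic, hence `h'`.

The upper growth bound is the integral of the upper distortion bound along a radius. For the lower
one, `z` may be taken where `|h|` is minimal on its circle; then the segment from `0` to `h(z)`
lifts through `h`, and the lower distortion bound is integrated along the lift. This uses univalence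
of `h`, which comes from univalence of all shears. Equality in a growth bound forces equality in
distortion along the path. Finally `L_k` has real part `Re (z / (1 - z))`, and on each line where
this is fixed its imaginary part is an increasing bijection onto the reals; so it is univalent onto
a half-plane. -/

/-- The harmonic map `h + conj g`. -/
def hmap (h g : ℂ → ℂ) (z : ℂ) : ℂ := h z + conj (g z)

/-- Univalent sense-preserving harmonic maps of the disk with convex range, without any
normalization. -/
structure ConvexPair (h g : ℂ → ℂ) : Prop where
  diff_h : DifferentiableOn ℂ h (ball 0 1)
  diff_g : DifferentiableOn ℂ g (ball 0 1)
  injOn : InjOn (hmap h g) (ball 0 1)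
  deriv_lt : ∀ z ∈ ball (0 : ℂ) 1, ‖deriv g z‖ < ‖deriv h z‖
  convex : Convex ℝ (hmap h g '' ball 0 1)

/-! ### Shears and univalence of the analytic part -/

/-- The shear `μ h - conj μ g`, whose imaginary part is that of `μ (h + conj g)`. -/
def shear (h g : ℂ → ℂ) (μ : ℂ) (z : ℂ) : ℂ := μ * h z - conj μ * g z

theorem shear_im (h g : ℂ → ℂ) (μ z : ℂ) : (shear h g μ z).im = (μ * hmap h g z).im := by
  simp [shear, hmap]; ring

/-- This map is the real differential of `h + conj g`. A kernel vector would satisfy `‖a u‖ = ‖b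
u‖`, so strict inequality of the norms gives invertibility and lets the inverse function theorem
apply to the harmonic map. -/
theorem exists_equiv_of_norm_lt {a b : ℂ} (hab : ‖b‖ < ‖a‖) :
    ∃ L : ℂ ≃L[ℝ] ℂ, ∀ u, L u = a * u + conj (b * u) := by
  let l : ℂ →ₗ[ℝ] ℂ := (LinearMap.mulLeft ℝ a) + conjLIE.toLinearEquiv.toLinearMap ∘ₗ
    (LinearMap.mulLeft ℝ b)
  have hl : ∀ u, l u = a * u + conj (b * u) := fun u => by simp [l]
  have hinj : Function.Injective l := by
    rw [injective_iff_map_eq_zero]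
    intro u hu
    rw [hl] at hu
    by_contra hne
    have h1 : ‖a * u‖ = ‖b * u‖ := by
      rw [eq_neg_of_add_eq_zero_left hu, norm_neg, RCLike.norm_conj]
    rw [norm_mul, norm_mul] at h1
    have : 0 < ‖u‖ := norm_pos_iff.2 hne
    nlinarith
  exact ⟨(LinearEquiv.ofInjectiveEndo l hinj).toContinuousLinearEquiv, hl⟩

theorem hasStrictDerivAt_of_differentiableOn {f : ℂ → ℂ} {U : Set ℂ} (hU : IsOpen U)
    (hf : DifferentiableOn ℂ f U) {z : ℂ} (hz : z ∈ U) : HasStrictDerivAt f (deriv f z) z :=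
  (hf.analyticAt (hU.mem_nhds hz)).hasStrictDerivAt

theorem hasStrictFDerivAt_hmap {h g : ℂ → ℂ} {U : Set ℂ} (hU : IsOpen U)
    (hh : DifferentiableOn ℂ h U) (hg : DifferentiableOn ℂ g U) {z : ℂ} (hz : z ∈ U)
    {L : ℂ →L[ℝ] ℂ} (hL : ∀ u, L u = deriv h z * u + conj (deriv g z * u)) :
    HasStrictFDerivAt (hmap h g) L z := by
  have h1 := (hasStrictDerivAt_of_differentiableOn hU hh hz).hasStrictFDerivAt.restrictScalars ℝ
  have h2 := (hasStrictDerivAt_of_differentiableOn hU hg hz).hasStrictFDerivAt.restrictScalars ℝ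
  have h3 := h1.add ((conjCLE : ℂ →L[ℝ] ℂ).hasStrictFDerivAt.comp z h2)
  refine (h3.congr_fderiv ?_)
  ext u
  simp [hL]
  ring

namespace ConvexPair

variable {h g : ℂ → ℂ}

theorem deriv_h_ne_zero (P : ConvexPair h g) {z : ℂ} (hz : z ∈ ball (0 : ℂ) 1) :
    deriv h z ≠ 0 := by
  have := P.deriv_lt z hz
  exact norm_pos_iff.1 ((norm_nonneg _).trans_lt this)

theorem exists_strict (P : ConvexPair h g) {z : ℂ} (hz : z ∈ ball (0 : ℂ) 1) :
    ∃ L : ℂ ≃L[ℝ] ℂ, (∀ u, L u = deriv h z * u + conj (deriv g z * u)) ∧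
      HasStrictFDerivAt (hmap h g) (L : ℂ →L[ℝ] ℂ) z := by
  obtain ⟨L, hL⟩ := exists_equiv_of_norm_lt (P.deriv_lt z hz)
  exact ⟨L, hL, hasStrictFDerivAt_hmap isOpen_ball P.diff_h P.diff_g hz hL⟩

theorem continuousOn (P : ConvexPair h g) : ContinuousOn (hmap h g) (ball 0 1) :=
  P.diff_h.continuousOn.add (continuous_conj.comp_continuousOn P.diff_g.continuousOn)

theorem isOpen_image (P : ConvexPair h g) : IsOpen (hmap h g '' ball 0 1) := by
  rw [isOpen_iff_mem_nhds]
  rintro _ ⟨z, hz, rfl⟩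
  obtain ⟨L, -, hL⟩ := P.exists_strict hz
  rw [← hL.map_nhds_eq_of_equiv]
  exact image_mem_map (isOpen_ball.mem_nhds hz)

/-- The inverse of a univalent harmonic map of the disk. -/
def inv (h g : ℂ → ℂ) : ℂ → ℂ := Function.invFunOn (hmap h g) (ball 0 1)

theorem inv_hmap (P : ConvexPair h g) {z : ℂ} (hz : z ∈ ball (0 : ℂ) 1) :
    inv h g (hmap h g z) = z :=
  P.injOn.leftInvOn_invFunOn hz

theorem inv_mem {w : ℂ} (hw : w ∈ hmap h g '' ball 0 1) : inv h g w ∈ ball (0 : ℂ) 1 :=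
  Function.invFunOn_mem hw

theorem hmap_inv {w : ℂ} (hw : w ∈ hmap h g '' ball 0 1) : hmap h g (inv h g w) = w :=
  Function.invFunOn_eq hw

theorem hasFDerivAt_inv (P : ConvexPair h g) {w : ℂ} (hw : w ∈ hmap h g '' ball 0 1) :
    ∃ L : ℂ ≃L[ℝ] ℂ, (∀ u, L u = deriv h (inv h g w) * u + conj (deriv g (inv h g w) * u)) ∧
      HasFDerivAt (inv h g) (L.symm : ℂ →L[ℝ] ℂ) w := by
  obtain ⟨L, hL, hd⟩ := P.exists_strict (inv_mem hw)
  refine ⟨L, hL, ?_⟩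
  have := hd.to_local_left_inverse (g := inv h g) (by
    filter_upwards [isOpen_ball.mem_nhds (inv_mem hw)] with z hz using P.inv_hmap hz)
  rw [hmap_inv hw] at this
  exact this.hasFDerivAt

theorem continuousOn_inv (P : ConvexPair h g) :
    ContinuousOn (inv h g) (hmap h g '' ball 0 1) := fun w hw => by
  obtain ⟨L, -, hd⟩ := P.hasFDerivAt_inv hw
  exact hd.continuousAt.continuousWithinAt

theorem hasDerivAt_shear (P : ConvexPair h g) (μ : ℂ) {z : ℂ} (hz : z ∈ ball (0 : ℂ) 1) :
    HasDerivAt (shear h g μ) (μ * deriv h z - conj μ * deriv g z) z :=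
  ((hasStrictDerivAt_of_differentiableOn isOpen_ball P.diff_h hz).hasDerivAt.const_mul μ).sub
    ((hasStrictDerivAt_of_differentiableOn isOpen_ball P.diff_g hz).hasDerivAt.const_mul (conj μ))

theorem deriv_shear_ne_zero (P : ConvexPair h g) {μ : ℂ} (hμ : ‖μ‖ = 1) {z : ℂ}
    (hz : z ∈ ball (0 : ℂ) 1) : μ * deriv h z - conj μ * deriv g z ≠ 0 := by
  intro h0
  have := P.deriv_lt z hz
  have h1 : ‖μ * deriv h z‖ = ‖conj μ * deriv g z‖ := by rw [sub_eq_zero.1 h0]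
  rw [norm_mul, norm_mul, RCLike.norm_conj, hμ] at h1
  linarith

/-- Every shear of a convex harmonic map is univalent. -/
theorem injOn_shear (P : ConvexPair h g) {μ : ℂ} (hμ : ‖μ‖ = 1) :
    InjOn (shear h g μ) (ball 0 1) := by
  intro z₁ h₁ z₂ h₂ he
  by_contra hne
  set w₁ := hmap h g z₁ with hw₁
  set w₂ := hmap h g z₂ with hw₂
  have hw : w₂ - w₁ ≠ 0 := fun h0 => hne (P.injOn h₁ h₂ (sub_eq_zero.1 h0).symm)
  -- Equal shears have equal imaginary parts, so the chord between the two image points, which lies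
  -- in the convex range, is a level line of `Im (μ w)`. On its preimage `c` the shear is real up to
  -- a constant and has nonvanishing derivative, which contradicts Rolle's theorem.
  have him : (μ * (w₂ - w₁)).im = 0 := by
    have := congrArg im he
    rw [shear_im, shear_im] at this
    rw [mul_sub, sub_im]
    linarith
  have hseg : ∀ t ∈ Icc (0 : ℝ) 1, w₁ + t * (w₂ - w₁) ∈ hmap h g '' ball 0 1 := fun t ht => by
    have := P.convex.add_smul_sub_mem (mem_image_of_mem _ h₁) (mem_image_of_mem _ h₂) ht
    simpa using this
  let c : ℝ → ℂ := fun t => inv h g (w₁ + t * (w₂ - w₁))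
  have hc : ∀ t ∈ Icc (0 : ℝ) 1, ∃ d : ℂ, HasDerivAt c d t ∧ d ≠ 0 ∧
      deriv h (c t) * d + conj (deriv g (c t) * d) = w₂ - w₁ := fun t ht => by
    obtain ⟨L, hL, hd⟩ := P.hasFDerivAt_inv (hseg t ht)
    have h1 : HasDerivAt (fun t : ℝ => w₁ + t * (w₂ - w₁)) (w₂ - w₁) t := by
      have := ((hasDerivAt_id t).ofReal_comp.mul_const (w₂ - w₁)).const_add w₁
      simpa using this
    have h2 := hd.comp_hasDerivAt t h1
    refine ⟨L.symm (w₂ - w₁), h2, ?_, ?_⟩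
    · exact fun h0 => hw (L.symm.map_eq_zero_iff.1 h0)
    · rw [← hL]; simp
  have hmem : ∀ t ∈ Icc (0 : ℝ) 1, c t ∈ ball (0 : ℂ) 1 := fun t ht => inv_mem (hseg t ht)
  have hder : ∀ t ∈ Icc (0 : ℝ) 1, ∃ d : ℂ, d ≠ 0 ∧
      HasDerivAt (fun t => (shear h g μ (c t)).re) d.re t ∧ d.im = 0 := fun t ht => by
    obtain ⟨d, hd, hd0, hde⟩ := hc t ht
    refine ⟨(μ * deriv h (c t) - conj μ * deriv g (c t)) * d,
      mul_ne_zero (P.deriv_shear_ne_zero hμ (hmem t ht)) hd0, ?_, ?_⟩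
    · have h1 := (P.hasDerivAt_shear μ (hmem t ht)).comp t hd
      exact reCLM.hasFDerivAt.comp_hasDerivAt t h1
    · rw [← hde] at him
      rw [← him]
      simp
      ring
  have hc0 : c 0 = z₁ := by simp [c, hw₁, P.inv_hmap h₁]
  have hc1 : c 1 = z₂ := by simp [c, hw₂, P.inv_hmap h₂]
  choose! d hd0 hdd hdi using hder
  obtain ⟨t, ht, hz⟩ := exists_hasDerivAt_eq_zero (f := fun t => (shear h g μ (c t)).re)
    (f' := fun t => (d t).re) zero_lt_one
    (fun t ht => (hdd t ht).continuousAt.continuousWithinAt) (by simp only [hc0, hc1, he])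
    (fun t ht => hdd t (Ioo_subset_Icc_self ht))
  exact hd0 t (Ioo_subset_Icc_self ht) (Complex.ext hz (hdi t (Ioo_subset_Icc_self ht)))

/-- If the moduli agreed, a unimodular `μ` whose argument is half the difference of the two
arguments would make the shear in direction `μ` identify the two points. -/
theorem norm_sub_ne_norm_sub (P : ConvexPair h g) {z₁ z₂ : ℂ} (h₁ : z₁ ∈ ball (0 : ℂ) 1)
    (h₂ : z₂ ∈ ball (0 : ℂ) 1) (hne : z₁ ≠ z₂) : ‖h z₁ - h z₂‖ ≠ ‖g z₁ - g z₂‖ := by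
  intro he
  obtain ⟨μ, hμ, hμe⟩ : ∃ μ : ℂ, ‖μ‖ = 1 ∧ μ * (h z₁ - h z₂) = conj μ * (g z₁ - g z₂) := by
    set a := h z₁ - h z₂
    set b := g z₁ - g z₂
    refine ⟨exp (((arg b - arg a) / 2 : ℝ) * I), norm_exp_ofReal_mul_I _, ?_⟩
    have ha : a = ‖b‖ * exp (arg a * I) := by rw [← he, norm_mul_exp_arg_mul_I]
    have hb : b = ‖b‖ * exp (arg b * I) := by rw [norm_mul_exp_arg_mul_I]
    calc _ = exp (((arg b - arg a) / 2 : ℝ) * I) * (‖b‖ * exp (arg a * I)) := by rw [← ha]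
      _ = conj (exp (((arg b - arg a) / 2 : ℝ) * I)) * (‖b‖ * exp (arg b * I)) := by
        rw [← exp_conj, mul_left_comm, mul_left_comm _ (‖b‖ : ℂ), ← Complex.exp_add,
          ← Complex.exp_add, map_mul, conj_ofReal, conj_I]
        congr 2
        push_cast
        ring
      _ = _ := by rw [← hb]
  refine hne (P.injOn_shear hμ h₁ h₂ ?_)
  simp only [shear]
  linear_combination hμe

/-- The analytic part of a convex harmonic map is univalent. -/
theorem injOn_h (P : ConvexPair h g) : InjOn h (ball 0 1) := by
  intro z₁ h₁ z₂ h₂ he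
  by_contra hne
  let γ : ℝ → ℂ := fun s => z₂ + s * (z₁ - z₂)
  have hγ : ∀ s ∈ Icc (0 : ℝ) 1, γ s ∈ ball (0 : ℂ) 1 := fun s hs => by
    simpa using (convex_ball (0 : ℂ) 1).add_smul_sub_mem h₂ h₁ hs
  have hγc : Continuous γ := by fun_prop
  let u : ℝ → ℝ := fun s => ‖h (γ s) - h z₂‖ - ‖g (γ s) - g z₂‖
  have hu : ContinuousOn u (Icc 0 1) := by
    have a1 : ContinuousOn (fun s => h (γ s)) (Icc 0 1) :=
      P.diff_h.continuousOn.comp hγc.continuousOn hγ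
    have a2 : ContinuousOn (fun s => g (γ s)) (Icc 0 1) :=
      P.diff_g.continuousOn.comp hγc.continuousOn hγ
    exact (a1.sub continuousOn_const).norm.sub (a2.sub continuousOn_const).norm
  have hdir : z₁ - z₂ ≠ 0 := sub_ne_zero.2 hne
  have hγd : HasDerivAt γ (z₁ - z₂) 0 := by
    have := ((hasDerivAt_id (0 : ℝ)).ofReal_comp.mul_const (z₁ - z₂)).const_add z₂
    rwa [ofReal_one, one_mul] at this
  have hγ0 : γ 0 = z₂ := by simp [γ]
  have slope_lim : ∀ k : ℂ → ℂ, DifferentiableOn ℂ k (ball 0 1) →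
      Tendsto (fun s : ℝ => ‖k (γ s) - k z₂‖ / s) (𝓝[>] 0) (𝓝 (‖deriv k z₂‖ * ‖z₁ - z₂‖)) :=
    fun k hk => by
      have h1 := (hasStrictDerivAt_of_differentiableOn isOpen_ball hk h₂).hasDerivAt
      rw [← hγ0] at h1
      have h2 := (h1.comp (0 : ℝ) hγd).hasDerivWithinAt (s := Ioi 0)
      rw [hasDerivWithinAt_iff_tendsto_slope] at h2
      have h3 := h2.norm
      rw [norm_mul] at h3
      simp only [mem_Ioi, lt_self_iff_false, not_false_eq_true, sdiff_singleton_eq_self] at h3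
      rw [hγ0] at h3
      refine h3.congr' ?_
      filter_upwards [self_mem_nhdsWithin] with s hs
      rw [slope_def_module, norm_smul, norm_inv, sub_zero, Real.norm_of_nonneg (le_of_lt hs)]
      simp [hγ0, div_eq_inv_mul]
  have hlt : ‖deriv g z₂‖ * ‖z₁ - z₂‖ < ‖deriv h z₂‖ * ‖z₁ - z₂‖ :=
    mul_lt_mul_of_pos_right (P.deriv_lt z₂ h₂) (norm_pos_iff.2 hdir)
  -- Near `z₂` the increment of `h` dominates that of `g`, because the derivatives do. At `z₁` the
  -- increment of `h` would vanish, so somewhere in between the two moduli would coincide.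
  obtain ⟨s, hs, hs0, hs1⟩ := (((slope_lim g P.diff_g).eventually_lt (slope_lim h P.diff_h) hlt).and
    (Ioo_mem_nhdsGT (zero_lt_one (α := ℝ)))).exists
  have hus : 0 < u s := by
    rw [div_lt_div_iff_of_pos_right hs0] at hs
    exact sub_pos.2 hs
  have hu1 : u 1 ≤ 0 := by
    have : γ 1 = z₁ := by simp [γ]
    simp only [u, this, he, sub_self, norm_zero, zero_sub]
    exact neg_nonpos.2 (norm_nonneg _)
  obtain ⟨t, ht, ht0⟩ := intermediate_value_Icc' hs1.le
    (hu.mono (Icc_subset_Icc hs0.le le_rfl)) ⟨hu1, hus.le⟩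
  have ht' : 0 < t := hs0.trans_le ht.1
  refine P.norm_sub_ne_norm_sub (hγ t ⟨ht'.le, ht.2⟩) h₂ ?_ (sub_eq_zero.1 ht0)
  intro h0
  have : (t : ℂ) * (z₁ - z₂) = 0 := by simpa [γ] using h0
  rcases mul_eq_zero.1 this with h' | h'
  · exact ht'.ne' (by exact_mod_cast h')
  · exact hdir h'

end ConvexPair

/-! ### Disk automorphisms -/

/-- The automorphism of the unit disk that maps `a` to `0`. -/
def mob (a z : ℂ) : ℂ := (z - a) / (1 - conj a * z)

theorem one_sub_conj_mul_ne_zero {a z : ℂ} (ha : ‖a‖ < 1) (hz : ‖z‖ ≤ 1) :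
    1 - conj a * z ≠ 0 := by
  intro h0
  have : ‖conj a * z‖ = 1 := by rw [← sub_eq_zero.1 h0, norm_one]
  rw [norm_mul, RCLike.norm_conj] at this
  nlinarith [norm_nonneg a, norm_nonneg z]

theorem normSq_one_sub_sub_normSq (a z : ℂ) :
    ‖1 - conj a * z‖ ^ 2 - ‖z - a‖ ^ 2 = (1 - ‖a‖ ^ 2) * (1 - ‖z‖ ^ 2) := by
  simp only [← normSq_eq_norm_sq, normSq_apply]
  simp
  ring

theorem norm_mob_lt {a z : ℂ} (ha : ‖a‖ < 1) (hz : ‖z‖ < 1) : ‖mob a z‖ < 1 := by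
  have h0 := one_sub_conj_mul_ne_zero ha hz.le
  rw [mob, norm_div, div_lt_one (norm_pos_iff.2 h0)]
  have h1 := normSq_one_sub_sub_normSq a z
  have h2 : 0 < (1 - ‖a‖ ^ 2) * (1 - ‖z‖ ^ 2) :=
    mul_pos (by nlinarith [norm_nonneg a]) (by nlinarith [norm_nonneg z])
  exact lt_of_pow_lt_pow_left₀ 2 (norm_nonneg _) (by linarith)

theorem mob_neg_mob {a z : ℂ} (ha : ‖a‖ < 1) (hz : ‖z‖ < 1) : mob (-a) (mob a z) = z := by
  have h0 := one_sub_conj_mul_ne_zero ha hz.le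
  have h1 := one_sub_conj_mul_ne_zero ha ha.le
  have h2 : (1 - conj (-a) * mob a z) = (1 - conj a * a) / (1 - conj a * z) := by
    simp only [mob, map_neg]
    field_simp
    ring
  rw [mob, h2, div_eq_iff (div_ne_zero h1 h0), mob, sub_neg_eq_add, ← mul_div_assoc,
    div_add' _ _ _ h0]
  congr 1
  ring

theorem mob_self (a : ℂ) : mob a a = 0 := by simp [mob]

theorem mob_zero (a : ℂ) : mob a 0 = -a := by simp [mob]

theorem injOn_mob {a : ℂ} (ha : ‖a‖ < 1) : InjOn (mob a) (ball 0 1) := fun z hz w hw h => by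
  rw [← mob_neg_mob ha (mem_ball_zero_iff.1 hz), h, mob_neg_mob ha (mem_ball_zero_iff.1 hw)]

theorem mapsTo_mob {a : ℂ} (ha : ‖a‖ < 1) : MapsTo (mob a) (ball 0 1) (ball 0 1) :=
  fun _ hz => mem_ball_zero_iff.2 (norm_mob_lt ha (mem_ball_zero_iff.1 hz))

theorem hasDerivAt_mob {a z : ℂ} (ha : ‖a‖ < 1) (hz : ‖z‖ < 1) :
    HasDerivAt (mob a) ((1 - ‖a‖ ^ 2) / (1 - conj a * z) ^ 2) z := by
  have h0 := one_sub_conj_mul_ne_zero ha hz.le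
  have h1 := ((hasDerivAt_id z).sub_const a).div
    (((hasDerivAt_id z).const_mul (conj a)).const_sub 1) h0
  refine h1.congr_deriv ?_
  rw [← ofReal_pow, ← normSq_eq_norm_sq, ← mul_conj]
  simp
  ring

theorem image_mob {a : ℂ} (ha : ‖a‖ < 1) : mob a '' ball 0 1 = ball 0 1 := by
  refine Subset.antisymm (mapsTo_mob ha).image_subset fun z hz => ?_
  have ha' : ‖-a‖ < 1 := by rwa [norm_neg]
  refine ⟨mob (-a) z, mapsTo_mob ha' hz, ?_⟩
  simpa using mob_neg_mob ha' (mem_ball_zero_iff.1 hz)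

/-! ### Normal families and Hurwitz' theorem -/

theorem mapsTo_closedBall_norm_sub_le {F : ℂ → ℂ} {x z : ℂ} {ρ : ℝ}
    (hd : DifferentiableOn ℂ F (ball x ρ)) (hF : MapsTo F (ball x ρ) (closedBall 0 1))
    (hz : z ∈ ball x ρ) : ‖F z - F x‖ ≤ 2 / ρ * ‖z - x‖ := by
  have hρ : 0 < ρ := pos_of_mem_ball hz
  have := dist_le_div_mul_dist_of_mapsTo_ball (R₂ := 2) hd (fun w hw => ?_) hz
  · simpa [dist_eq_norm] using this
  · have h1 := mem_closedBall_zero_iff.1 (hF hw)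
    have h2 := mem_closedBall_zero_iff.1 (hF (mem_ball_self hρ))
    rw [mem_closedBall, dist_eq_norm]
    linarith [norm_sub_le (F w) (F x)]

/-- Along an ultrafilter, a family of holomorphic maps into the unit disk converges locally
uniformly. -/
theorem exists_tendstoLocallyUniformlyOn {ι : Type*} (l : Ultrafilter ι) {F : ι → ℂ → ℂ}
    {U : Set ℂ} (hU : IsOpen U) (hd : ∀ i, DifferentiableOn ℂ (F i) U)
    (hF : ∀ i, MapsTo (F i) U (closedBall 0 1)) :
    ∃ f : ℂ → ℂ, TendstoLocallyUniformlyOn F f l U ∧ MapsTo f U (closedBall 0 1) := by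
  -- An ultrafilter on a compact set converges, so pointwise limits exist without a diagonal
  -- argument. The common local Lipschitz constant `2 / ρ` then makes the convergence locally
  -- uniform.
  have hlim : ∀ z ∈ U, ∃ y ∈ closedBall (0 : ℂ) 1, Tendsto (fun i => F i z) l (𝓝 y) := by
    intro z hz
    have := (isCompact_closedBall (0 : ℂ) 1).ultrafilter_le_nhds' (l.map fun i => F i z)
      (Ultrafilter.mem_map.2 (Filter.univ_mem' fun i => hF i hz))
    exact this
  choose! f hf1 hf2 using hlim
  refine ⟨f, ?_, hf1⟩
  rw [Metric.tendstoLocallyUniformlyOn_iff]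
  intro ε hε x hx
  obtain ⟨ρ, hρ, hρU⟩ := Metric.isOpen_iff.1 hU x hx
  have hlip : ∀ i, ∀ z ∈ ball x ρ, ‖F i z - F i x‖ ≤ 2 / ρ * ‖z - x‖ := fun i z hz =>
    mapsTo_closedBall_norm_sub_le ((hd i).mono hρU) ((hF i).mono_left hρU) hz
  have hlipf : ∀ z ∈ ball x ρ, ‖f z - f x‖ ≤ 2 / ρ * ‖z - x‖ := fun z hz =>
    le_of_tendsto ((hf2 z (hρU hz)).sub (hf2 x hx)).norm (Eventually.of_forall fun i => hlip i z hz)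
  refine ⟨ball x (min ρ (ε * ρ / 8)), mem_nhdsWithin_of_mem_nhds (ball_mem_nhds _ (by positivity)),
    ?_⟩
  have hev : ∀ᶠ i in (l : Filter ι), ‖F i x - f x‖ < ε / 4 := by
    have := Metric.tendsto_nhds.1 (hf2 x hx) (ε / 4) (by positivity)
    simpa [dist_eq_norm] using this
  filter_upwards [hev] with i hi z hz
  have hzρ : z ∈ ball x ρ := ball_subset_ball (min_le_left _ _) hz
  have hzε : ‖z - x‖ < ε * ρ / 8 := by
    rw [← dist_eq_norm]; exact (mem_ball.1 hz).trans_le (min_le_right _ _)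
  have hb : 2 / ρ * ‖z - x‖ ≤ ε / 4 := by
    calc 2 / ρ * ‖z - x‖ ≤ 2 / ρ * (ε * ρ / 8) := by gcongr
      _ = ε / 4 := by field_simp; norm_num
  have h1 := hlip i z hzρ
  have h2 := hlipf z hzρ
  rw [dist_eq_norm]
  have : f z - F i z = (f z - f x) - (F i x - f x) - (F i z - F i x) := by ring
  rw [this]
  linarith [norm_sub_le ((f z - f x) - (F i x - f x)) (F i z - F i x),
    norm_sub_le (f z - f x) (F i x - f x)]

/-- Hurwitz' theorem on a disk. -/
theorem ne_zero_of_tendstoUniformlyOn {ι : Type*} {l : Filter ι} [l.NeBot] {G : ι → ℂ → ℂ}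
    {g : ℂ → ℂ} {b : ℂ} {ρ : ℝ} (hρ : 0 < ρ)
    (hd : ∀ i, DifferentiableOn ℂ (G i) (closedBall b ρ))
    (hG : TendstoUniformlyOn G g l (closedBall b ρ)) (h0 : ∀ i, ∀ z ∈ closedBall b ρ, G i z ≠ 0)
    (hg : ∀ z ∈ sphere b ρ, g z ≠ 0) : g b ≠ 0 := by
  intro hb
  have hgc : ContinuousOn g (closedBall b ρ) :=
    hG.continuousOn (Eventually.of_forall fun i => (hd i).continuousOn).frequently
  obtain ⟨z₀, hz₀, hmin⟩ := (isCompact_sphere b ρ).exists_isMinOn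
    (NormedSpace.sphere_nonempty.2 hρ.le) (hgc.mono sphere_subset_closedBall).norm
  set δ := ‖g z₀‖
  have hδ : 0 < δ := norm_pos_iff.2 (hg z₀ hz₀)
  obtain ⟨i, hi⟩ := (Metric.tendstoUniformlyOn_iff.1 hG (δ / 2) (by positivity)).exists
  have hb' : ‖G i b‖ < δ / 2 := by
    have := hi b (mem_closedBall_self hρ.le)
    rwa [hb, dist_zero_left] at this
  have hs : ∀ z ∈ sphere b ρ, δ / 2 ≤ ‖G i z‖ := fun z hz => by
    have h1 := hi z (sphere_subset_closedBall hz)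
    have h2 : δ ≤ ‖g z‖ := hmin hz
    rw [dist_eq_norm] at h1
    linarith [norm_sub_norm_le (g z) (G i z)]
  -- The maximum principle for `1 / G i`: this reciprocal is at most `2 / δ` on the circle but would
  -- exceed `2 / δ` at the center.
  have hk : DiffContOnCl ℂ (fun z => (G i z)⁻¹) (ball b ρ) := by
    refine DifferentiableOn.diffContOnCl ?_
    rw [closure_ball b hρ.ne']
    exact (hd i).inv (h0 i)
  have := norm_le_of_forall_mem_frontier_norm_le isBounded_ball hk (C := (δ / 2)⁻¹) (fun z hz => by
    rw [frontier_ball b hρ.ne'] at hz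
    rw [norm_inv]
    exact inv_anti₀ (by positivity) (hs z hz)) (subset_closure (mem_ball_self hρ))
  rw [norm_inv] at this
  have h3 := norm_pos_iff.2 (h0 i b (mem_closedBall_self hρ.le))
  have h4 := (inv_le_inv₀ h3 (by positivity)).1 this
  linarith

/-- Zeros of a nontrivial analytic function are isolated; this provides the zero-free circle needed
for Hurwitz' theorem. -/
theorem exists_closedBall_ne_zero {g : ℂ → ℂ} {U V : Set ℂ} (hU : IsOpen U) (hUc : IsPreconnected U)
    (hg : DifferentiableOn ℂ g U) (hne : ∃ z ∈ U, g z ≠ 0) {b : ℂ} (hb : b ∈ U) (hV : V ∈ 𝓝 b) :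
    ∃ ρ > 0, closedBall b ρ ⊆ U ∩ V ∧ ∀ z ∈ sphere b ρ, g z ≠ 0 := by
  have han : AnalyticOnNhd ℂ g U := hg.analyticOnNhd hU
  rcases (han b hb).eventually_eq_zero_or_eventually_ne_zero with h0 | h0
  · obtain ⟨z, hz, hgz⟩ := hne
    exact absurd (han.eqOn_zero_of_preconnected_of_eventuallyEq_zero hUc hb h0 hz) hgz
  · rw [eventually_nhdsWithin_iff] at h0
    obtain ⟨ρ, hρ, hsub⟩ := nhds_basis_closedBall.mem_iff.1
      (inter_mem (inter_mem (hU.mem_nhds hb) hV) h0)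
    refine ⟨ρ, hρ, fun z hz => (hsub hz).1, fun z hz => (hsub (sphere_subset_closedBall hz)).2 ?_⟩
    exact ne_of_mem_sphere hz hρ.ne'

/-- A limit of univalent functions with a nonvanishing derivative has the same property, unless it
is constant. -/
theorem injOn_and_deriv_ne_zero_of_tendsto {ι : Type*} {l : Filter ι} [l.NeBot] {F : ι → ℂ → ℂ}
    {f : ℂ → ℂ} {U : Set ℂ} (hU : IsOpen U) (hUc : IsPreconnected U)
    (hd : ∀ i, DifferentiableOn ℂ (F i) U) (hF : TendstoLocallyUniformlyOn F f l U)
    (hinj : ∀ i, InjOn (F i) U) (hder : ∀ i, ∀ z ∈ U, deriv (F i) z ≠ 0)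
    (hne : ∃ z ∈ U, deriv f z ≠ 0) : InjOn f U ∧ ∀ z ∈ U, deriv f z ≠ 0 := by
  have hfd : DifferentiableOn ℂ f U := hF.differentiableOn (Eventually.of_forall hd) hU
  constructor
  · intro a ha b hb hab
    by_contra hne'
    have hne2 : ∃ z ∈ U, f z - f a ≠ 0 := by
      by_contra! hcon
      obtain ⟨z, hz, hdz⟩ := hne
      refine hdz ?_
      have : f =ᶠ[𝓝 z] fun _ => f a := by
        filter_upwards [hU.mem_nhds hz] with w hw using sub_eq_zero.1 (hcon w hw)
      rw [this.deriv_eq, deriv_const]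
    obtain ⟨ρ, hρ, hsub, hs⟩ := exists_closedBall_ne_zero hU hUc (hfd.sub_const (f a)) hne2 hb
      (isOpen_compl_singleton.mem_nhds (Ne.symm hne' : b ∈ ({a} : Set ℂ)ᶜ))
    have hK : TendstoUniformlyOn F f l (closedBall b ρ) :=
      (tendstoLocallyUniformlyOn_iff_forall_isCompact hU).1 hF _ (fun z hz => (hsub hz).1)
        (isCompact_closedBall _ _)
    have hG : TendstoUniformlyOn (fun i z => F i z - F i a) (fun z => f z - f a) l
        (closedBall b ρ) :=
      hK.fun_sub ((hF.tendsto_at ha).tendstoUniformlyOn_const _)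
    refine ne_zero_of_tendstoUniformlyOn hρ (fun i => ((hd i).mono fun z hz =>
      (hsub hz).1).sub_const _) hG (fun i z hz => ?_) hs (sub_eq_zero.2 hab.symm)
    refine sub_ne_zero.2 fun he => (hsub hz).2 ?_
    exact hinj i (hsub hz).1 ha he
  · intro b hb
    have hdF := hF.deriv (Eventually.of_forall hd) hU
    obtain ⟨ρ, hρ, hsub, hs⟩ := exists_closedBall_ne_zero hU hUc (hfd.deriv hU) hne hb univ_mem
    have hsub' : closedBall b ρ ⊆ U := fun z hz => (hsub hz).1
    exact ne_zero_of_tendstoUniformlyOn hρ (fun i => ((hd i).deriv hU).mono hsub')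
      ((tendstoLocallyUniformlyOn_iff_forall_isCompact hU).1 hdF _ hsub' (isCompact_closedBall _ _))
      (fun i z hz => hder i z (hsub' hz)) hs

/-! ### The Riemann mapping theorem by Koebe's extremal argument -/

/-- Since `k x - k z = (s x - s z) (s x + s z)`, the slope of `s` is that of `k` divided by `s x + s
z`. It makes the continuous square root in Koebe's construction holomorphic. -/
theorem hasDerivAt_of_sq_eq {s k : ℂ → ℂ} {z k' : ℂ} (hs : ContinuousAt s z)
    (hsk : ∀ x, s x ^ 2 = k x) (hz : s z ≠ 0) (hk : HasDerivAt k k' z) :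
    HasDerivAt s (k' / (2 * s z)) z := by
  rw [hasDerivAt_iff_tendsto_slope] at hk ⊢
  have h1 : Tendsto (fun x => s x + s z) (𝓝[≠] z) (𝓝 (2 * s z)) := by
    rw [two_mul]
    exact (hs.tendsto.mono_left nhdsWithin_le_nhds).add_const _
  have h2 : 2 * s z ≠ 0 := mul_ne_zero two_ne_zero hz
  refine (hk.div h1 h2).congr' ?_
  filter_upwards [h1.eventually_ne h2] with x hx
  rw [Pi.div_apply, div_eq_iff hx, slope_def_field, slope_def_field, ← hsk, ← hsk]
  ring

/-- Univalent maps of a domain into the unit disk that fix the origin. -/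
structure DiskEmbedding (U : Set ℂ) (ψ : ℂ → ℂ) : Prop where
  diff : DifferentiableOn ℂ ψ U
  injOn : InjOn ψ U
  deriv_ne : ∀ z ∈ U, deriv ψ z ≠ 0
  mapsTo : MapsTo ψ U (ball 0 1)
  map_zero : ψ 0 = 0

/-- A disk embedding that is not onto can be improved. -/
theorem DiskEmbedding.exists_deriv_lt {U : Set ℂ} {ψ : ℂ → ℂ} (h : DiskEmbedding U ψ)
    (hU : IsOpen U) (hUc : IsSimplyConnected U) (h0 : 0 ∈ U) {w : ℂ} (hw : ‖w‖ < 1)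
    (hwU : w ∉ ψ '' U) : ∃ χ, DiskEmbedding U χ ∧ ‖deriv ψ 0‖ < ‖deriv χ 0‖ := by
  have hψ1 : ∀ z ∈ U, ‖ψ z‖ < 1 := fun z hz => mem_ball_zero_iff.1 (h.mapsTo hz)
  have hk : ∀ z ∈ U, HasDerivAt (fun z => mob w (ψ z))
      ((1 - ‖w‖ ^ 2) / (1 - conj w * ψ z) ^ 2 * deriv ψ z) z := fun z hz =>
    (hasDerivAt_mob hw (hψ1 z hz)).comp z
      (hasStrictDerivAt_of_differentiableOn hU h.diff hz).hasDerivAt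
  have hk0 : ∀ z ∈ U, mob w (ψ z) ≠ 0 := fun z hz he => by
    rw [mob, div_eq_zero_iff, sub_eq_zero] at he
    rcases he with he | he
    · exact hwU ⟨z, hz, he⟩
    · exact one_sub_conj_mul_ne_zero hw (hψ1 z hz).le he
  -- The omitted value `w` is moved to `0`, so simple connectivity gives a square root. A second
  -- automorphism then restores the value `0` at the origin.
  obtain ⟨s, hsc, hs⟩ := exists_continuousOn_pow_eq hUc hU (g := fun z => mob w (ψ z))
    (fun z hz => (hk z hz).continuousAt.continuousWithinAt)
    (by rintro ⟨z, hz, he⟩; exact hk0 z hz he) two_ne_zero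
  have hs0 : ∀ z ∈ U, s z ≠ 0 := fun z hz he => hk0 z hz (by rw [← hs z, he]; simp)
  have hs1 : ∀ z ∈ U, ‖s z‖ < 1 := fun z hz => by
    have := norm_mob_lt hw (hψ1 z hz)
    rw [← hs z, norm_pow] at this
    exact (pow_lt_one_iff_of_nonneg (norm_nonneg _) two_ne_zero).1 this
  have hsd : ∀ z ∈ U, HasDerivAt s ((1 - ‖w‖ ^ 2) / (1 - conj w * ψ z) ^ 2 * deriv ψ z /
      (2 * s z)) z := fun z hz =>
    hasDerivAt_of_sq_eq (hsc.continuousAt (hU.mem_nhds hz)) hs (hs0 z hz) (hk z hz)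
  have hχd : ∀ z ∈ U, HasDerivAt (fun z => mob (s 0) (s z))
      ((1 - ‖s 0‖ ^ 2) / (1 - conj (s 0) * s z) ^ 2 * ((1 - ‖w‖ ^ 2) / (1 - conj w * ψ z) ^ 2 *
        deriv ψ z / (2 * s z))) z := fun z hz =>
    (hasDerivAt_mob (hs1 0 h0) (hs1 z hz)).comp z (hsd z hz)
  have hpos : ∀ {a : ℂ}, ‖a‖ < 1 → (1 - (‖a‖ : ℂ) ^ 2) ≠ 0 := fun {a} ha => by
    have h1 : 0 < 1 - ‖a‖ ^ 2 := by nlinarith [norm_nonneg a]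
    exact_mod_cast h1.ne'
  refine ⟨fun z => mob (s 0) (s z), ⟨fun z hz => (hχd z hz).differentiableAt.differentiableWithinAt,
    ?_, ?_, ?_, mob_self _⟩, ?_⟩
  · intro x hx y hy hxy
    have h1 : s x = s y := injOn_mob (hs1 0 h0) (mem_ball_zero_iff.2 (hs1 x hx))
      (mem_ball_zero_iff.2 (hs1 y hy)) hxy
    have h2 : mob w (ψ x) = mob w (ψ y) := by rw [← hs x, ← hs y, h1]
    exact h.injOn hx hy (injOn_mob hw (h.mapsTo hx) (h.mapsTo hy) h2)
  · intro z hz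
    rw [(hχd z hz).deriv]
    exact mul_ne_zero (div_ne_zero (hpos (hs1 0 h0))
      (pow_ne_zero _ (one_sub_conj_mul_ne_zero (hs1 0 h0) (hs1 z hz).le)))
      (div_ne_zero (mul_ne_zero (div_ne_zero (hpos hw)
        (pow_ne_zero _ (one_sub_conj_mul_ne_zero hw (hψ1 z hz).le))) (h.deriv_ne z hz))
        (mul_ne_zero two_ne_zero (hs0 z hz)))
  · exact fun z hz => mem_ball_zero_iff.2 (norm_mob_lt (hs1 0 h0) (hs1 z hz))
  · rw [(hχd 0 h0).deriv, h.map_zero]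
    set t := ‖s 0‖ with ht
    have ht0 : 0 < t := norm_pos_iff.2 (hs0 0 h0)
    have ht1 : t < 1 := hs1 0 h0
    have hwt : ‖w‖ = t ^ 2 := by
      rw [ht, ← norm_pow, hs 0, h.map_zero, mob_zero, norm_neg]
    have e1 : (1 - conj (s 0) * s 0) = ((1 - t ^ 2 : ℝ) : ℂ) := by
      rw [mul_comm, mul_conj, normSq_eq_norm_sq]; push_cast; rfl
    have e2 : (1 - (t : ℂ) ^ 2) = ((1 - t ^ 2 : ℝ) : ℂ) := by push_cast; rfl
    have e3 : (1 - (‖w‖ : ℂ) ^ 2) = ((1 - t ^ 4 : ℝ) : ℂ) := by rw [hwt]; push_cast; ring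
    have hp : 0 < 1 - t ^ 2 := by nlinarith
    have hp4 : 0 < 1 - t ^ 4 := by nlinarith [mul_pos hp (by positivity : 0 < 1 + t ^ 2)]
    rw [e1, e2, e3]
    simp only [mul_zero, sub_zero, one_pow, div_one, norm_mul, norm_div, norm_pow, norm_real,
      Real.norm_of_nonneg hp.le, Real.norm_of_nonneg hp4.le, norm_ofNat, ← ht]
    have hψ0 : 0 < ‖deriv ψ 0‖ := norm_pos_iff.2 (h.deriv_ne 0 h0)
    -- With `t = ‖s 0‖`, so that `‖w‖ = t²`, the derivative at `0` is multiplied by `(1 + t²) / (2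
    -- t)`, which exceeds `1` because `t < 1`.
    have : (1 - t ^ 2) / (1 - t ^ 2) ^ 2 * ((1 - t ^ 4) * ‖deriv ψ 0‖ / (2 * t)) =
        (1 + t ^ 2) / (2 * t) * ‖deriv ψ 0‖ := by
      field_simp
      ring
    rw [this]
    refine lt_mul_of_one_lt_left hψ0 ?_
    rw [one_lt_div (by positivity)]
    nlinarith [sq_nonneg (1 - t), mul_pos (sub_pos.2 ht1) (sub_pos.2 ht1)]

/-- The Riemann mapping theorem for subdomains of the unit disk. -/
theorem exists_riemann_map {U : Set ℂ} (hU : IsOpen U) (hUc : IsSimplyConnected U)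
    (hU1 : U ⊆ ball 0 1) (h0 : 0 ∈ U) :
    ∃ φ ψ : ℂ → ℂ, DifferentiableOn ℂ φ (ball 0 1) ∧ DifferentiableOn ℂ ψ U ∧
      MapsTo φ (ball 0 1) U ∧ MapsTo ψ U (ball 0 1) ∧ (∀ z ∈ ball (0 : ℂ) 1, ψ (φ z) = z) ∧
      (∀ w ∈ U, φ (ψ w) = w) ∧ φ 0 = 0 := by
  let S : Set ℝ := (fun ψ : ℂ → ℂ => ‖deriv ψ 0‖) '' {ψ | DiskEmbedding U ψ}
  have hid : DiskEmbedding U id :=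
    ⟨differentiableOn_id, injOn_id _, fun z _ => by simp, hU1, rfl⟩
  have hSne : S.Nonempty := ⟨_, id, hid, rfl⟩
  obtain ⟨ρ, hρ, hρU⟩ := Metric.isOpen_iff.1 hU 0 h0
  have hSb : BddAbove S := by
    refine ⟨1 / ρ, ?_⟩
    rintro _ ⟨ψ, hψ, rfl⟩
    refine norm_deriv_le_div_of_mapsTo_ball (hψ.diff.mono hρU) (fun z hz => ?_) hρ
    rw [hψ.map_zero]
    exact ball_subset_closedBall (hψ.mapsTo (hρU hz))
  obtain ⟨x, -, hx, hxS⟩ := exists_seq_tendsto_sSup hSne hSb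
  choose F hF hFx using hxS
  obtain ⟨ψ, hψF, hψm⟩ := exists_tendstoLocallyUniformlyOn (hyperfilter ℕ) hU
    (fun n => (hF n).diff) (fun n => (hF n).mapsTo.mono_right ball_subset_closedBall)
  have hdF := (hψF.deriv (Eventually.of_forall fun n => (hF n).diff) hU).tendsto_at h0
  have hder : ‖deriv ψ 0‖ = sSup S := by
    refine tendsto_nhds_unique hdF.norm ?_
    have h1 : Tendsto x (hyperfilter ℕ : Filter ℕ) (𝓝 (sSup S)) :=
      hx.mono_left (Nat.hyperfilter_le_atTop)
    exact h1.congr fun n => (hFx n).symm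
  have hmax : ∀ χ, DiskEmbedding U χ → ‖deriv χ 0‖ ≤ ‖deriv ψ 0‖ := fun χ hχ => by
    rw [hder]; exact le_csSup hSb ⟨χ, hχ, rfl⟩
  have hψ0 : deriv ψ 0 ≠ 0 := by
    have := hmax id hid
    simp only [deriv_id, norm_one] at this
    exact norm_pos_iff.1 (zero_lt_one.trans_le this)
  obtain ⟨hinj, hdne⟩ := injOn_and_deriv_ne_zero_of_tendsto hU
    hUc.isPathConnected.isConnected.isPreconnected (fun n => (hF n).diff) hψF
    (fun n => (hF n).injOn) (fun n => (hF n).deriv_ne) ⟨0, h0, hψ0⟩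
  have hψd : DifferentiableOn ℂ ψ U :=
    hψF.differentiableOn (Eventually.of_forall fun n => (hF n).diff) hU
  have hopen : IsOpen (ψ '' U) := by
    rw [isOpen_iff_mem_nhds]
    rintro _ ⟨z, hz, rfl⟩
    rw [← (hasStrictDerivAt_of_differentiableOn hU hψd hz).map_nhds_eq (hdne z hz)]
    exact image_mem_map (hU.mem_nhds hz)
  have hE : DiskEmbedding U ψ := by
    refine ⟨hψd, hinj, hdne, ?_, ?_⟩
    · intro z hz
      -- The limit a priori takes values in the closed disk; its image is open, hence lies in the
      -- interior.
      have := interior_maximal hψm.image_subset hopen (mem_image_of_mem ψ hz)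
      rwa [interior_closedBall _ one_ne_zero] at this
    · refine tendsto_nhds_unique (hψF.tendsto_at h0) ?_
      simp only [fun n => (hF n).map_zero]
      exact tendsto_const_nhds
  have hsurj : ψ '' U = ball 0 1 := by
    refine Subset.antisymm hE.mapsTo.image_subset fun w hw => ?_
    by_contra hcon
    obtain ⟨χ, hχ, hlt⟩ := hE.exists_deriv_lt hU hUc h0 (mem_ball_zero_iff.1 hw) hcon
    exact absurd (hmax χ hχ) (not_le.2 hlt)
  let φ := Function.invFunOn ψ U
  have hφψ : ∀ w ∈ U, φ (ψ w) = w := fun w hw => hinj.leftInvOn_invFunOn hw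
  have hφm : MapsTo φ (ball 0 1) U := fun z hz => Function.invFunOn_mem (hsurj.symm ▸ hz : z ∈ ψ '' U)
  have hψφ : ∀ z ∈ ball (0 : ℂ) 1, ψ (φ z) = z := fun z hz =>
    Function.invFunOn_eq (hsurj.symm ▸ hz : z ∈ ψ '' U)
  refine ⟨φ, ψ, fun z hz => ?_, hψd, hφm, hE.mapsTo, hψφ, hφψ, ?_⟩
  · have h1 := (hasStrictDerivAt_of_differentiableOn hU hψd (hφm hz)).to_local_left_inverse
      (hdne _ (hφm hz)) (g := φ)
      (by filter_upwards [hU.mem_nhds (hφm hz)] with w hw using hφψ w hw)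
    rw [hψφ z hz] at h1
    exact h1.hasDerivAt.differentiableAt.differentiableWithinAt
  · have := hφψ 0 h0
    rwa [hE.map_zero] at this

/-! ### The length-area principle -/

theorem lintegral_norm_deriv_sq {φ : ℂ → ℂ} (hd : DifferentiableOn ℂ φ (ball 0 1))
    (hinj : InjOn φ (ball 0 1)) (hm : MapsTo φ (ball 0 1) (ball 0 1)) :
    ∫⁻ z in ball (0 : ℂ) 1, ENNReal.ofReal (‖deriv φ z‖ ^ 2) < ∞ := by
  have h1 := lintegral_abs_det_fderiv_eq_addHaar_image volume
    (f := φ) (f' := fun z => ((ContinuousLinearMap.toSpanSingleton ℂ (deriv φ z)).restrictScalars ℝ))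
    (measurableSet_ball (x := (0 : ℂ)) (ε := 1))
    (fun z hz => ((hasStrictDerivAt_of_differentiableOn isOpen_ball hd
      hz).hasDerivAt.hasFDerivAt.restrictScalars ℝ).hasFDerivWithinAt) hinj
  have hdet : ∀ z, ((ContinuousLinearMap.toSpanSingleton ℂ (deriv φ z)).restrictScalars ℝ).det =
      ‖deriv φ z‖ ^ 2 := fun z => by
    rw [ContinuousLinearMap.det, ← normSq_eq_norm_sq, ← Algebra.norm_complex_apply,
      Algebra.norm_apply]
    congr 1
    ext x
    simp [mul_comm]
  simp only [hdet, abs_pow, abs_norm] at h1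
  rw [h1]
  exact (measure_mono hm.image_subset).trans_lt measure_ball_lt_top

/-- Otherwise the area integral in polar coordinates would dominate `∫ c / r` near `0`, which
diverges. -/
theorem exists_radius_lintegral_lt {k : ℂ → ℝ≥0∞} (hk : Measurable k) (hfin : ∫⁻ z, k z < ∞)
    {c δ : ℝ} (hc : 0 < c) (hδ : 0 < δ) :
    ∃ r ∈ Ioo 0 δ, ∫⁻ θ in Ioo (-Real.pi) Real.pi, ENNReal.ofReal r *
      k (Complex.polarCoord.symm (r, θ)) < ENNReal.ofReal (c / r) := by
  by_contra! hcon
  rw [← Complex.lintegral_comp_polarCoord_symm, polarCoord_target,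
    Measure.volume_eq_prod, ← Measure.prod_restrict, lintegral_prod] at hfin
  swap
  · have : Continuous fun p : ℝ × ℝ => Complex.polarCoord.symm p := by
      simp only [Complex.polarCoord_symm_apply]
      fun_prop
    exact ((measurable_fst.ennreal_ofReal).smul (hk.comp this.measurable)).aemeasurable
  have h1 : ∫⁻ r in Ioo 0 δ, ENNReal.ofReal (c / r) < ∞ := by
    refine lt_of_le_of_lt ?_ hfin
    refine (setLIntegral_mono' measurableSet_Ioo hcon).trans ?_
    simp only [smul_eq_mul]
    exact lintegral_mono_set Ioo_subset_Ioi_self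
  have h2 : IntegrableOn (fun r => c / r) (Ioo 0 δ) := by
    refine ⟨(measurable_const.div measurable_id).aestronglyMeasurable, ?_⟩
    rw [hasFiniteIntegral_iff_ofReal]
    · exact h1
    · exact (ae_restrict_iff' measurableSet_Ioo).2 (Eventually.of_forall fun r hr =>
        div_nonneg hc.le hr.1.le)
  have h3 : IntervalIntegrable (fun r : ℝ => r⁻¹) volume 0 δ := by
    rw [intervalIntegrable_iff_integrableOn_Ioo_of_le hδ.le]
    refine (h2.const_mul c⁻¹).congr (Eventually.of_forall fun r => ?_)
    simp only [div_eq_mul_inv, inv_mul_cancel_left₀ hc.ne']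
  rw [intervalIntegrable_inv_iff] at h3
  rcases h3 with h3 | h3
  · exact hδ.ne h3
  · exact h3 left_mem_uIcc

theorem cos_mem_of_mem_arc {r θ : ℝ} (hr : 0 < r) :
    -1 + Complex.polarCoord.symm (r, θ) ∈ ball (0 : ℂ) 1 ↔ r < 2 * Real.cos θ := by
  have h1 : -1 + Complex.polarCoord.symm (r, θ) =
      ((-1 + r * Real.cos θ : ℝ) : ℂ) + ((r * Real.sin θ : ℝ) : ℂ) * I := by
    rw [Complex.polarCoord_symm_apply]
    push_cast
    ring
  rw [mem_ball_zero_iff, ← pow_lt_one_iff_of_nonneg (norm_nonneg _) two_ne_zero,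
    ← normSq_eq_norm_sq, h1, normSq_add_mul_I]
  have h2 := Real.sin_sq_add_cos_sq θ
  have h3 : (-1 + r * Real.cos θ) ^ 2 + (r * Real.sin θ) ^ 2 = 1 + r * (r - 2 * Real.cos θ) := by
    linear_combination r ^ 2 * h2
  rw [h3]
  constructor
  · intro h
    nlinarith
  · intro h
    nlinarith

/-- The distance is at most the length of the image of the arc, which the Cauchy–Schwarz inequality
controls by the squared-derivative integral. The arc is centered at `-1`, and concavity of cosine
keeps the points between its two ends in the disk. -/
theorem arc_diam_le {φ : ℂ → ℂ} (hd : DifferentiableOn ℂ φ (ball 0 1)) {r ε α β : ℝ} (hr : 0 < r)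
    (hε : 0 < ε) (hα : α ∈ Icc (-(Real.pi / 2)) (Real.pi / 2))
    (hβ : β ∈ Icc (-(Real.pi / 2)) (Real.pi / 2)) (hαβ : α ≤ β)
    (hαD : -1 + Complex.polarCoord.symm (r, α) ∈ ball (0 : ℂ) 1)
    (hβD : -1 + Complex.polarCoord.symm (r, β) ∈ ball (0 : ℂ) 1)
    (hI : ∫⁻ θ in Ioo (-Real.pi) Real.pi, ENNReal.ofReal r *
      (((fun w => -1 + w) ⁻¹' ball (0 : ℂ) 1).indicator
        (fun w => ENNReal.ofReal (‖deriv φ (-1 + w)‖ ^ 2))) (Complex.polarCoord.symm (r, θ)) <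
        ENNReal.ofReal (ε ^ 2 / Real.pi / r)) :
    ‖φ (-1 + Complex.polarCoord.symm (r, β)) - φ (-1 + Complex.polarCoord.symm (r, α))‖ ≤ ε := by
  have hπ := Real.pi_pos
  let c : ℝ → ℂ := fun θ => -1 + Complex.polarCoord.symm (r, θ)
  have hcD : ∀ θ ∈ Icc α β, c θ ∈ ball (0 : ℂ) 1 := fun θ hθ => by
    have h1 := strictConcaveOn_cos_Icc.concaveOn.min_le_of_mem_Icc hα hβ hθ
    rw [cos_mem_of_mem_arc hr] at hαD hβD ⊢
    rcases min_le_iff.1 h1 with h | h <;> linarith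
  have hcd : ∀ θ, HasDerivAt c (r * (-Real.sin θ + Real.cos θ * I)) θ := fun θ => by
    have h1 := (((Real.hasDerivAt_cos θ).ofReal_comp.add
      ((Real.hasDerivAt_sin θ).ofReal_comp.mul_const I)).const_mul (r : ℂ)).const_add (-1)
    refine HasDerivAt.congr_deriv (f := c) (h1.congr_of_eventuallyEq (Eventually.of_forall
      fun x => ?_)) ?_
    · simp [c, Complex.polarCoord_symm_apply]
    · push_cast; ring
  have hcn : ∀ θ : ℝ, ‖(r * (-Real.sin θ + Real.cos θ * I) : ℂ)‖ = r := fun θ => by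
    rw [norm_mul, norm_real, Real.norm_of_nonneg hr.le]
    have : ‖(-Real.sin θ + Real.cos θ * I : ℂ)‖ = 1 := by
      rw [← ofReal_neg, norm_add_mul_I, neg_sq, Real.sin_sq_add_cos_sq, Real.sqrt_one]
    rw [this, mul_one]
  have hcc : Continuous c := continuous_iff_continuousAt.2 fun θ => (hcd θ).continuousAt
  have hdc : ContinuousOn (fun θ => deriv φ (c θ)) (Icc α β) :=
    (hd.deriv isOpen_ball).continuousOn.comp hcc.continuousOn hcD
  have hderiv : ∀ θ ∈ uIcc α β, HasDerivAt (fun θ => φ (c θ))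
      (deriv φ (c θ) * (r * (-Real.sin θ + Real.cos θ * I))) θ := fun θ hθ => by
    rw [uIcc_of_le hαβ] at hθ
    exact (hasStrictDerivAt_of_differentiableOn isOpen_ball hd (hcD θ hθ)).hasDerivAt.comp θ (hcd θ)
  have hint : ContinuousOn (fun θ : ℝ => deriv φ (c θ) * (r * (-Real.sin θ + Real.cos θ * I)))
      (uIcc α β) := by
    rw [uIcc_of_le hαβ]
    exact hdc.mul (by fun_prop)
  have hsq : ContinuousOn (fun θ : ℝ => r * ‖deriv φ (c θ)‖ ^ 2) (uIcc α β) := by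
    rw [uIcc_of_le hαβ]
    exact continuousOn_const.mul (hdc.norm.pow 2)
  have hJ : ∫ θ in α..β, r * ‖deriv φ (c θ)‖ ^ 2 ≤ ε ^ 2 / Real.pi / r := by
    rw [← ENNReal.ofReal_le_ofReal_iff (by positivity), intervalIntegral.integral_of_le hαβ,
      ofReal_integral_eq_lintegral_ofReal (hsq.intervalIntegrable.1)
        (Eventually.of_forall fun θ => by positivity)]
    refine le_trans ?_ hI.le
    calc ∫⁻ θ in Ioc α β, ENNReal.ofReal (r * ‖deriv φ (c θ)‖ ^ 2)
        = ∫⁻ θ in Ioc α β, ENNReal.ofReal r *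
      (((fun w => -1 + w) ⁻¹' ball (0 : ℂ) 1).indicator
        (fun w => ENNReal.ofReal (‖deriv φ (-1 + w)‖ ^ 2))) (Complex.polarCoord.symm (r, θ)) := by
          refine setLIntegral_congr_fun measurableSet_Ioc fun θ hθ => ?_
          have hmem : Complex.polarCoord.symm (r, θ) ∈ (fun w => -1 + w) ⁻¹' ball (0 : ℂ) 1 :=
            hcD θ (Ioc_subset_Icc_self hθ)
          rw [indicator_of_mem hmem, ENNReal.ofReal_mul hr.le]
      _ ≤ _ := lintegral_mono_set fun θ (hθ : θ ∈ Ioc α β) =>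
          (⟨by linarith [hα.1, hθ.1], by linarith [hβ.2, hθ.2]⟩ : θ ∈ Ioo _ _)
  rw [← intervalIntegral.integral_eq_sub_of_hasDerivAt hderiv hint.intervalIntegrable]
  calc ‖∫ θ in α..β, deriv φ (c θ) * (r * (-Real.sin θ + Real.cos θ * I))‖
      ≤ ∫ θ in α..β, ‖deriv φ (c θ) * (r * (-Real.sin θ + Real.cos θ * I))‖ :=
        intervalIntegral.norm_integral_le_integral_norm hαβ
    -- Cauchy–Schwarz in the form of the arithmetic-geometric mean inequality, weighted so that the
    -- arc of angle at most `π` and the bound `ε² / (π r)` contribute `ε / 2` each.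
    _ ≤ ∫ θ in α..β, (ε / Real.pi / 2 + Real.pi / ε * r / 2 * (r * ‖deriv φ (c θ)‖ ^ 2)) := by
        refine intervalIntegral.integral_mono_on hαβ hint.norm.intervalIntegrable
          (continuousOn_const.add (continuousOn_const.mul hsq)).intervalIntegrable fun θ _ => ?_
        rw [norm_mul, hcn]
        have h1 : 0 ≤ (ε / Real.pi - ‖deriv φ (c θ)‖ * r) ^ 2 * (Real.pi / ε / 2) := by positivity
        have h2 : (ε / Real.pi - ‖deriv φ (c θ)‖ * r) ^ 2 * (Real.pi / ε / 2) =
          (ε / Real.pi / 2 + Real.pi / ε * r / 2 * (r * ‖deriv φ (c θ)‖ ^ 2)) -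
            ‖deriv φ (c θ)‖ * r := by
          field_simp
          ring
        linarith
    _ = (β - α) * (ε / Real.pi / 2) +
        Real.pi / ε * r / 2 * ∫ θ in α..β, (r * ‖deriv φ (c θ)‖ ^ 2) := by
        rw [intervalIntegral.integral_add intervalIntegrable_const
          (hsq.intervalIntegrable.const_mul _), intervalIntegral.integral_const,
          intervalIntegral.integral_const_mul, smul_eq_mul]
    _ ≤ Real.pi * (ε / Real.pi / 2) + Real.pi / ε * r / 2 * (ε ^ 2 / Real.pi / r) := by
        gcongr
        linarith [hα.1, hβ.2]
    _ = ε := by field_simp; ring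

/-- The length-area principle: a bounded univalent function maps arbitrarily small circular
crosscuts to sets of small diameter. -/
theorem exists_small_crosscut {φ : ℂ → ℂ} (hd : DifferentiableOn ℂ φ (ball 0 1))
    (hinj : InjOn φ (ball 0 1)) (hm : MapsTo φ (ball 0 1) (ball 0 1)) {ζ : ℂ} (hζ : ‖ζ‖ = 1)
    {ε δ : ℝ} (hε : 0 < ε) (hδ : 0 < δ) :
    ∃ r ∈ Ioo 0 δ, ∀ z ∈ ball (0 : ℂ) 1, ∀ w ∈ ball (0 : ℂ) 1, ‖z - ζ‖ = r → ‖w - ζ‖ = r →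
      ‖φ z - φ w‖ ≤ ε := by
  wlog hζ1 : ζ = -1 generalizing φ ζ
  · have hζ0 : ζ ≠ 0 := norm_pos_iff.1 (by rw [hζ]; exact one_pos)
    have hrot : MapsTo (fun z => -ζ * z) (ball (0 : ℂ) 1) (ball 0 1) := fun z hz => by
      simpa [hζ] using hz
    obtain ⟨r, hr, hr'⟩ := this (φ := fun z => φ (-ζ * z)) (ζ := -1)
      (hd.comp (by fun_prop) hrot)
      (hinj.comp (fun a _ b _ h => mul_left_cancel₀ (neg_ne_zero.2 hζ0) h) hrot)
      (hm.comp hrot) (by simp) rfl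
    have hnorm : ∀ z : ℂ, ‖-z / ζ - -1‖ = ‖z - ζ‖ := fun z => by
      have : -z / ζ - -1 = -(z - ζ) / ζ := by field_simp; ring
      rw [this, norm_div, norm_neg, hζ, div_one]
    have hmem : ∀ z ∈ ball (0 : ℂ) 1, -z / ζ ∈ ball (0 : ℂ) 1 := fun z hz => by
      simpa [hζ] using hz
    have hcan : ∀ z : ℂ, -ζ * (-z / ζ) = z := fun z => by field_simp
    refine ⟨r, hr, fun z hz w hw hzr hwr => ?_⟩
    have := hr' _ (hmem z hz) _ (hmem w hw) (by rw [hnorm, hzr]) (by rw [hnorm, hwr])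
    simpa only [hcan] using this
  subst hζ1
  set k : ℂ → ℝ≥0∞ := ((fun w => -1 + w) ⁻¹' ball (0 : ℂ) 1).indicator
        (fun w => ENNReal.ofReal (‖deriv φ (-1 + w)‖ ^ 2)) with hk
  have hkm : Measurable k := by
    refine Measurable.indicator ?_ (measurable_const_add (-1) measurableSet_ball)
    exact (((measurable_deriv φ).comp (measurable_const_add (-1))).norm.pow_const 2).ennreal_ofReal
  have hkfin : ∫⁻ w, k w < ∞ := by
    have h1 := lintegral_norm_deriv_sq hd hinj hm
    rw [← lintegral_indicator measurableSet_ball, ← lintegral_add_left_eq_self _ (-1)] at h1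
    exact h1
  have hπ := Real.pi_pos
  obtain ⟨r, hr, hI⟩ := exists_radius_lintegral_lt hkm hkfin (c := ε ^ 2 / Real.pi)
    (by positivity) hδ
  have hpolar : ∀ z ∈ ball (0 : ℂ) 1, ‖z - -1‖ = r → ∃ θ ∈ Icc (-(Real.pi / 2)) (Real.pi / 2),
      z = -1 + Complex.polarCoord.symm (r, θ) := fun z hz hzr => by
    refine ⟨arg (z - -1), ?_, ?_⟩
    · rw [mem_Icc, ← abs_le, abs_arg_le_pi_div_two_iff]
      have := (abs_le.1 (abs_re_le_norm z)).1
      have := mem_ball_zero_iff.1 hz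
      simp
      linarith
    · rw [Complex.polarCoord_symm_apply, ← hzr]
      simp only [ofReal_cos, ofReal_sin]
      rw [norm_mul_cos_add_sin_mul_I]
      ring
  refine ⟨r, hr, fun z hz w hw hzr hwr => ?_⟩
  obtain ⟨α, hα, rfl⟩ := hpolar z hz hzr
  obtain ⟨β, hβ, rfl⟩ := hpolar w hw hwr
  rcases le_total α β with h | h
  · rw [norm_sub_rev]
    exact arc_diam_le hd hr.1 hε hα hβ h hz hw hI
  · exact arc_diam_le hd hr.1 hε hβ hα h hw hz hI

/-! ### Boundary limits of homeomorphisms onto convex domains -/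

theorem one_lt_rank_complex : 1 < Module.rank ℝ ℂ := by
  rw [rank_real_complex]
  norm_num

/-- A homeomorphism of the disk onto a bounded convex domain that maps small circular crosscuts at
a boundary point to sets of small diameter has a limit at this point. -/
theorem exists_tendsto_of_small_crosscut {f k : ℂ → ℂ} {Ω : Set ℂ} (hΩ : Convex ℝ Ω)
    (hΩo : IsOpen Ω) (hΩb : Bornology.IsBounded Ω)
    (hk : ContinuousOn k Ω) (hfm : MapsTo f (ball 0 1) Ω) (hkm : MapsTo k Ω (ball 0 1))
    (hkf : ∀ z ∈ ball (0 : ℂ) 1, k (f z) = z) (hfk : ∀ w ∈ Ω, f (k w) = w) {ζ : ℂ} (hζ : ‖ζ‖ = 1)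
    (hcut : ∀ ε > 0, ∃ r ∈ Ioo (0 : ℝ) 1, ∀ z ∈ ball (0 : ℂ) 1, ∀ w ∈ ball (0 : ℂ) 1,
      ‖z - ζ‖ = r → ‖w - ζ‖ = r → ‖f z - f w‖ ≤ ε) :
    ∃ y, Tendsto f (𝓝[ball 0 1] ζ) (𝓝 y) := by
  have h0 : (0 : ℂ) ∈ ball (0 : ℂ) 1 := mem_ball_self one_pos
  obtain ⟨ρ, hρ, hρΩ⟩ := Metric.isOpen_iff.1 hΩo (f 0) (hfm h0)
  obtain ⟨Δ, hΔ⟩ := Metric.isBounded_iff.1 hΩb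
  have hΔ0 : 0 ≤ Δ := dist_nonneg.trans (hΔ (hfm h0) (hfm h0))
  have hcompl : (Ωᶜ).Nonempty := by
    rw [nonempty_compl]
    rintro rfl
    exact NormedSpace.unbounded_univ ℝ ℂ hΩb
  have key : ∀ ε > 0, ∃ r > 0, ∃ p : ℂ, ∀ z ∈ ball (0 : ℂ) 1, ‖z - ζ‖ < r →
      ‖f z - p‖ ≤ ε * (2 + 2 * Δ / ρ) := by
    intro ε hε
    obtain ⟨r, hr, hcut⟩ := hcut ε hε
    -- The image of the crosscut must approach the boundary of `Ω`. Otherwise it would stay in a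
    -- compact `K`, and the circle about `ζ` would be disconnected by the disk and the complement of
    -- the compact set `k '' K`.
    obtain ⟨z₁, hz₁, hz₁r, hz₁d⟩ : ∃ z ∈ ball (0 : ℂ) 1, ‖z - ζ‖ = r ∧ infDist (f z) Ωᶜ < ε := by
      by_contra! hcon
      set K : Set ℂ := {w | ε ≤ infDist w Ωᶜ}
      have hKΩ : K ⊆ Ω := fun w hw => by
        by_contra hw'
        have := infDist_zero_of_mem (mem_compl hw')
        have hw1 : ε ≤ infDist w Ωᶜ := hw
        linarith
      have hKc : IsCompact K := Metric.isCompact_of_isClosed_isBounded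
        (isClosed_le continuous_const (continuous_infDist_pt _)) (hΩb.subset hKΩ)
      have hkK : IsClosed (k '' K) := (hKc.image_of_continuousOn (hk.mono hKΩ)).isClosed
      have hpre := isPreconnected_sphere one_lt_rank_complex ζ r
      obtain ⟨z, hz, hzD, hzK⟩ := hpre _ _ isOpen_ball hkK.isOpen_compl (fun z hz => by
          by_cases hzD : z ∈ ball (0 : ℂ) 1
          · exact Or.inl hzD
          · right
            rintro ⟨w, hw, rfl⟩
            exact hzD (hkm (hKΩ hw)))
        (⟨ζ - r * ζ, by simp [hζ, abs_of_pos hr.1], by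
          have : ζ - r * ζ = ((1 - r : ℝ) : ℂ) * ζ := by push_cast; ring
          rw [mem_ball_zero_iff, this, norm_mul, hζ, norm_real, Real.norm_eq_abs, mul_one,
            abs_of_pos (by linarith [hr.2])]
          linarith [hr.1]⟩)
        (⟨ζ + r * ζ, by simp [hζ, abs_of_pos hr.1], by
          rintro ⟨w, hw, he⟩
          have h1 := mem_ball_zero_iff.1 (hkm (hKΩ hw))
          have : ζ + r * ζ = ((1 + r : ℝ) : ℂ) * ζ := by push_cast; ring
          rw [he, this, norm_mul, hζ, norm_real, Real.norm_eq_abs, mul_one,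
            abs_of_pos (by linarith [hr.1])] at h1
          linarith [hr.1]⟩)
      exact hzK ⟨f z, hcon z hzD (by simpa [dist_eq_norm] using hz), hkf z hzD⟩
    obtain ⟨p, hp, hpd⟩ := (infDist_lt_iff hcompl).1 hz₁d
    refine ⟨r, hr.1, p, fun z hz hzr => ?_⟩
    have hseg : ∀ t ∈ Icc (0 : ℝ) 1, f z + t * (f 0 - f z) ∈ Ω := fun t ht => by
      simpa using hΩ.add_smul_sub_mem (hfm hz) (hfm h0) ht
    have hcont : ContinuousOn (fun t : ℝ => ‖k (f z + t * (f 0 - f z)) - ζ‖) (Icc 0 1) :=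
      ((hk.comp (by fun_prop) hseg).sub continuousOn_const).norm
    -- The segment from `f z` to `f 0` has a preimage that starts inside the crosscut and ends
    -- outside, so it meets the crosscut at a point whose image `q` is close to the exterior point
    -- `p`.
    obtain ⟨t, ht, htr⟩ := intermediate_value_Icc zero_le_one hcont
      (show r ∈ Icc _ _ by
        simp only [ofReal_zero, zero_mul, add_zero, hkf z hz, ofReal_one, one_mul,
          add_sub_cancel, hkf 0 h0, zero_sub, norm_neg, hζ]
        exact ⟨hzr.le, hr.2.le⟩)
    simp only at htr
    set q := f z + t * (f 0 - f z) with hq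
    have hqΩ : q ∈ Ω := hseg t ht
    have hqp : ‖q - p‖ ≤ 2 * ε := by
      have h1 := hcut (k q) (hkm hqΩ) z₁ hz₁ htr hz₁r
      rw [hfk q hqΩ] at h1
      rw [dist_eq_norm] at hpd
      calc ‖q - p‖ = ‖(q - f z₁) + (f z₁ - p)‖ := by ring_nf
        _ ≤ _ := (norm_add_le _ _).trans (by linarith)
    -- The homothety with center `f z` and ratio `t` takes the ball of radius `ρ` at `f 0` to a ball
    -- of radius `t ρ` at `q`, contained in `Ω` by convexity; so `p` cannot be closer to `q` than `t
    -- ρ`.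
    have htρ : t * ρ ≤ 2 * ε := by
      refine le_trans ?_ hqp
      by_contra! hlt
      have ht0 : 0 < t := by
        by_contra! h
        have : t = 0 := le_antisymm h ht.1
        rw [this, zero_mul] at hlt
        linarith [norm_nonneg (q - p)]
      have hv : f 0 + (p - q) / t ∈ Ω := hρΩ (by
        rw [mem_ball, dist_eq_norm, add_sub_cancel_left, norm_div, norm_real,
          Real.norm_of_nonneg ht.1, div_lt_iff₀ ht0, norm_sub_rev]
        linarith)
      have := hΩ.add_smul_sub_mem (hfm hz) hv ht
      refine hp ?_
      convert this using 1
      have htc : (t : ℂ) ≠ 0 := by exact_mod_cast ht0.ne'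
      rw [real_smul, hq]
      field_simp
      ring
    have hqz : ‖f z - q‖ ≤ 2 * ε / ρ * Δ := by
      have : f z - q = -(t * (f 0 - f z)) := by rw [hq]; ring
      rw [this, norm_neg, norm_mul, norm_real, Real.norm_of_nonneg ht.1]
      have h2 : ‖f 0 - f z‖ ≤ Δ := by rw [← dist_eq_norm]; exact hΔ (hfm h0) (hfm hz)
      have h3 : t ≤ 2 * ε / ρ := by rw [le_div_iff₀ hρ]; exact htρ
      gcongr
    calc ‖f z - p‖ = ‖(f z - q) + (q - p)‖ := by ring_nf
      _ ≤ 2 * ε / ρ * Δ + 2 * ε := (norm_add_le _ _).trans (add_le_add hqz hqp)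
      _ = ε * (2 + 2 * Δ / ρ) := by ring
  have hne : (𝓝[ball (0 : ℂ) 1] ζ).NeBot := by
    rw [← mem_closure_iff_nhdsWithin_neBot, closure_ball _ one_ne_zero]
    simp [hζ]
  rw [← cauchy_map_iff_exists_tendsto, Metric.cauchy_iff]
  refine ⟨hne.map f, fun η hη => ?_⟩
  have hM : 0 < 2 + 2 * Δ / ρ := by positivity
  obtain ⟨r, hr, p, hp⟩ := key (η / (3 * (2 + 2 * Δ / ρ))) (by positivity)
  have he : η / (3 * (2 + 2 * Δ / ρ)) * (2 + 2 * Δ / ρ) = η / 3 := by field_simp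
  rw [he] at hp
  refine ⟨f '' (ball 0 1 ∩ ball ζ r), image_mem_map (inter_mem self_mem_nhdsWithin
    (mem_nhdsWithin_of_mem_nhds (ball_mem_nhds _ hr))), ?_⟩
  rintro _ ⟨z, ⟨hz, hzr⟩, rfl⟩ _ ⟨w, ⟨hw, hwr⟩, rfl⟩
  have h1 := hp z hz (by rwa [← dist_eq_norm])
  have h2 := hp w hw (by rwa [← dist_eq_norm])
  rw [dist_eq_norm]
  calc ‖f z - f w‖ = ‖(f z - p) - (f w - p)‖ := by ring_nf
    _ ≤ η / 3 + η / 3 := (norm_sub_le _ _).trans (add_le_add h1 h2)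
    _ < η := by linarith

/-! ### Crossing of paths in the closed disk -/

theorem re_one_sub_mul_conj_pos {x ζ : ℂ} (hx : ‖x‖ ≤ 1) (hζ : ‖ζ‖ = 1) (hne : x ≠ ζ) :
    0 < (1 - x * conj ζ).re := by
  have hn : ‖x * conj ζ‖ ≤ 1 := by rw [norm_mul, RCLike.norm_conj, hζ, mul_one]; exact hx
  have h1 : (x * conj ζ).re ≤ 1 := (re_le_norm _).trans hn
  rw [sub_re, one_re, sub_pos]
  refine lt_of_le_of_ne h1 fun he => hne ?_
  have h2 : normSq (x * conj ζ) ≤ 1 := by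
    rw [normSq_eq_norm_sq]
    exact pow_le_one₀ (norm_nonneg _) hn
  rw [normSq_apply, he] at h2
  have h3 : (x * conj ζ).im = 0 := by nlinarith [mul_self_nonneg (x * conj ζ).im]
  have h4 : x * conj ζ = 1 := Complex.ext he h3
  have h5 : conj ζ * ζ = 1 := by
    rw [mul_comm, mul_conj, normSq_eq_norm_sq, hζ]; simp
  calc x = x * (conj ζ * ζ) := by rw [h5, mul_one]
    _ = ζ := by rw [← mul_assoc, h4, one_mul]

theorem log_one_sub_exp_im {α : ℝ} (h0 : 0 < α) (h1 : α < 2 * Real.pi) :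
    (log (1 - exp (α * I))).im = (α - Real.pi) / 2 := by
  have hs : 0 < 2 * Real.sin (α / 2) := by
    have := Real.sin_pos_of_pos_of_lt_pi (x := α / 2) (by linarith) (by linarith)
    linarith
  have he : 1 - exp (α * I) = (2 * Real.sin (α / 2) : ℝ) *
      (cos ((α - Real.pi) / 2 : ℝ) + sin ((α - Real.pi) / 2 : ℝ) * I) := by
    have e1 : (α - Real.pi) / 2 = α / 2 - Real.pi / 2 := by ring
    rw [← ofReal_cos, ← ofReal_sin, e1, Real.cos_sub_pi_div_two, Real.sin_sub_pi_div_two,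
      exp_mul_I, ← ofReal_cos, ← ofReal_sin]
    have e2 : α = 2 * (α / 2) := by ring
    rw [e2, Real.cos_two_mul, Real.sin_two_mul, ← e2]
    have e3 := Real.sin_sq_add_cos_sq (α / 2)
    refine Complex.ext ?_ ?_
    · simp only [sub_re, one_re, add_re, ofReal_re, mul_re, I_re, mul_zero, I_im, mul_one,
        ofReal_im, sub_zero, add_zero, add_im, mul_im]
      linear_combination -2 * e3
    · simp only [sub_im, one_im, add_re, ofReal_re, mul_re, I_re, mul_zero, I_im, mul_one,
        ofReal_im, sub_zero, add_zero, add_im, mul_im]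
      ring
  rw [log_im, he, arg_mul_cos_add_sin_mul_I hs ⟨by linarith, by linarith⟩]

theorem log_one_sub_exp_im_of_neg {α : ℝ} (h0 : α < 0) (h1 : -(2 * Real.pi) < α) :
    (log (1 - exp (α * I))).im = (α + Real.pi) / 2 := by
  have : exp (α * I) = exp ((α + 2 * Real.pi : ℝ) * I) := by
    rw [exp_eq_exp_iff_exists_int]
    exact ⟨-1, by push_cast; ring⟩
  rw [this, log_one_sub_exp_im (by linarith) (by linarith)]
  ring

/-- On the right half-plane the principal logarithm is continuous, so `L - log u` is continuous. Its
imaginary part, reduced by the initial value, lies in `2πℤ` and cannot pass `π`, hence stays `0`. -/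
theorem log_lift_sub {L u : ℝ → ℂ} {a : ℂ} (hL : ContinuousOn L (Icc 0 1))
    (hu : ContinuousOn u (Icc 0 1)) (hu0 : ∀ s ∈ Icc (0 : ℝ) 1, 0 < (u s).re) (ha : a ≠ 0)
    (he : ∀ s ∈ Icc (0 : ℝ) 1, exp (L s) = a * u s) :
    (L 1).im - (L 0).im = (log (u 1)).im - (log (u 0)).im := by
  have m0 : (0 : ℝ) ∈ Icc (0 : ℝ) 1 := by simp
  have m1 : (1 : ℝ) ∈ Icc (0 : ℝ) 1 := by simp
  have hune : ∀ s ∈ Icc (0 : ℝ) 1, u s ≠ 0 := fun s hs h => by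
    have := hu0 s hs
    rw [h] at this
    simp at this
  let m : ℝ → ℂ := fun s => L s - log (u s) - (L 0 - log (u 0))
  have hm : ContinuousOn m (Icc 0 1) :=
    (hL.sub (hu.clog fun s hs => Or.inl (hu0 s hs))).sub continuousOn_const
  have hexp : ∀ s ∈ Icc (0 : ℝ) 1, ∃ n : ℤ, (m s).im = 2 * Real.pi * n := fun s hs => by
    have h1 : exp (m s) = 1 := by
      simp only [m]
      rw [Complex.exp_sub, Complex.exp_sub, Complex.exp_sub, exp_log (hune s hs),
        exp_log (hune 0 m0), he s hs, he 0 m0, mul_div_cancel_right₀ _ (hune s hs),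
        mul_div_cancel_right₀ _ (hune 0 m0), div_self ha]
    obtain ⟨n, hn⟩ := exp_eq_one_iff.1 h1
    refine ⟨n, ?_⟩
    rw [hn]
    simp
    ring
  have hπ := Real.pi_pos
  have hzero : (m 1).im = 0 := by
    by_contra hne
    obtain ⟨n, hn⟩ := hexp 1 m1
    have hn0 : (1 : ℝ) ≤ |(n : ℝ)| := by
      have : n ≠ 0 := by rintro rfl; simp at hn; exact hne hn
      exact_mod_cast Int.one_le_abs this
    have hbig : 2 * Real.pi ≤ |(m 1).im| := by
      rw [hn, abs_mul, abs_of_pos (by positivity : 0 < 2 * Real.pi)]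
      nlinarith
    have hcont : ContinuousOn (fun s => |(m s).im|) (Icc 0 1) :=
      (continuous_im.comp_continuousOn hm).abs
    obtain ⟨s, hs, hse⟩ := intermediate_value_Icc zero_le_one hcont
      (show Real.pi ∈ Icc _ _ from ⟨by simp [m, hπ.le], by linarith⟩)
    obtain ⟨j, hj⟩ := hexp s hs
    simp only [hj, abs_mul, abs_of_pos (by positivity : 0 < 2 * Real.pi)] at hse
    have h3 : 2 * |(j : ℝ)| = 1 := by
      have : Real.pi * (2 * |(j : ℝ)|) = Real.pi * 1 := by linarith
      exact mul_left_cancel₀ hπ.ne' this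
    have h4 : 2 * |j| = 1 := by exact_mod_cast h3
    omega
  simp only [m, sub_im] at hzero
  linarith

/-- Two paths in the closed disk that join alternating points of the circle intersect. -/
theorem exists_path_eq {θ₁ θ₂ θ₃ θ₄ : ℝ} (h12 : θ₁ < θ₂) (h23 : θ₂ < θ₃) (h34 : θ₃ < θ₄)
    (h41 : θ₄ < θ₁ + 2 * Real.pi) (γ : Path (exp (θ₁ * I)) (exp (θ₃ * I)))
    (δ : Path (exp (θ₂ * I)) (exp (θ₄ * I))) (hγ : ∀ s, ‖γ s‖ ≤ 1) (hδ : ∀ s, ‖δ s‖ ≤ 1) :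
    ∃ s t, γ s = δ t := by
  by_contra! hne
  have hγe : ∀ s, ‖γ.extend s‖ ≤ 1 := fun s => hγ _
  have hδe : ∀ s, ‖δ.extend s‖ ≤ 1 := fun s => hδ _
  have hne' : ∀ s t, γ.extend s ≠ δ.extend t := fun s t => hne _ _
  -- If the paths were disjoint, `γ s - δ t` would have a continuous logarithm on the plane, with
  -- total change zero around the unit square.
  have hsc : IsSimplyConnected (univ : Set (ℝ × ℝ)) :=
    (Homeomorph.Set.univ (ℝ × ℝ)).toHomotopyEquiv.simplyConnectedSpace
  obtain ⟨L, hLc, hL⟩ := exists_continuousOn_eqOn_exp_comp hsc isOpen_univ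
    (g := fun p : ℝ × ℝ => γ.extend p.1 - δ.extend p.2)
    (by fun_prop)
    (by rintro ⟨p, -, hp⟩; exact hne' _ _ (sub_eq_zero.1 hp))
  have hLc' : Continuous L := continuousOn_univ.1 hLc
  have hLe : ∀ s t, exp (L (s, t)) = γ.extend s - δ.extend t := fun s t => hL (mem_univ (s, t))
  have hn : ∀ θ : ℝ, ‖exp (θ * I)‖ = 1 := norm_exp_ofReal_mul_I
  have hcc : ∀ θ : ℝ, conj (exp (θ * I)) * exp (θ * I) = 1 := fun θ => by
    rw [mul_comm, mul_conj, normSq_eq_norm_sq, hn]; simp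
  have hquot : ∀ α β : ℝ, exp (α * I) * conj (exp (β * I)) = exp ((α - β : ℝ) * I) := fun α β => by
    rw [← exp_conj, ← Complex.exp_add]
    congr 1
    simp
    ring
  have hγ0 : γ.extend 0 = exp (θ₁ * I) := γ.extend_zero
  have hγ1 : γ.extend 1 = exp (θ₃ * I) := γ.extend_one
  have hδ0 : δ.extend 0 = exp (θ₂ * I) := δ.extend_zero
  have hδ1 : δ.extend 1 = exp (θ₄ * I) := δ.extend_one
  have edgeγ : ∀ t θ : ℝ, δ.extend t = exp (θ * I) → (L (1, t)).im - (L (0, t)).im =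
      (log (1 - exp ((θ₃ - θ : ℝ) * I))).im - (log (1 - exp ((θ₁ - θ : ℝ) * I))).im :=
    fun t θ ht => by
      have := log_lift_sub (L := fun s => L (s, t)) (u := fun s => 1 - γ.extend s * conj (exp (θ * I)))
        (a := -exp (θ * I)) (by fun_prop) (by fun_prop)
        (fun s _ => re_one_sub_mul_conj_pos (hγe s) (hn θ) (ht ▸ hne' s t))
        (neg_ne_zero.2 (exp_ne_zero _))
        (fun s _ => by rw [hLe, ht]; linear_combination -(γ.extend s) * hcc θ)
      simpa only [hγ0, hγ1, hquot] using this
  have edgeδ : ∀ s θ : ℝ, γ.extend s = exp (θ * I) → (L (s, 1)).im - (L (s, 0)).im =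
      (log (1 - exp ((θ₄ - θ : ℝ) * I))).im - (log (1 - exp ((θ₂ - θ : ℝ) * I))).im :=
    fun s θ hs => by
      have := log_lift_sub (L := fun t => L (s, t)) (u := fun t => 1 - δ.extend t * conj (exp (θ * I)))
        (a := exp (θ * I)) (by fun_prop) (by fun_prop)
        (fun t _ => re_one_sub_mul_conj_pos (hδe t) (hn θ) (hs ▸ (hne' s t).symm))
        (exp_ne_zero _)
        (fun t _ => by rw [hLe, hs]; linear_combination (δ.extend t) * hcc θ)
      simpa only [hδ0, hδ1, hquot] using this
  have hπ := Real.pi_pos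
  -- On each edge one point is fixed on the circle, so the change of argument is explicit. Going
  -- around the square the four changes fail to cancel by `2π`, because of the interlacing of the
  -- endpoints.
  have e1 := edgeγ 0 θ₂ hδ0
  have e2 := edgeγ 1 θ₄ hδ1
  have e3 := edgeδ 0 θ₁ hγ0
  have e4 := edgeδ 1 θ₃ hγ1
  rw [log_one_sub_exp_im (α := θ₃ - θ₂) (by linarith) (by linarith),
    log_one_sub_exp_im_of_neg (α := θ₁ - θ₂) (by linarith) (by linarith)] at e1
  rw [log_one_sub_exp_im (α := θ₄ - θ₃) (by linarith) (by linarith),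
    log_one_sub_exp_im_of_neg (α := θ₂ - θ₃) (by linarith) (by linarith)] at e4
  rw [log_one_sub_exp_im_of_neg (α := θ₃ - θ₄) (by linarith) (by linarith),
    log_one_sub_exp_im_of_neg (α := θ₁ - θ₄) (by linarith) (by linarith)] at e2
  rw [log_one_sub_exp_im (α := θ₄ - θ₁) (by linarith) (by linarith),
    log_one_sub_exp_im (α := θ₂ - θ₁) (by linarith) (by linarith)] at e3
  linarith

/-! ### Linear functionals of a convex map on the circle -/

theorem harmonic_nonneg_of_sphere {u : ℂ → ℝ}
    (hu : InnerProductSpace.HarmonicContOnCl u (ball 0 1))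
    (h0 : ∀ z ∈ sphere (0 : ℂ) 1, 0 ≤ u z) {w : ℂ} (hw : w ∈ ball (0 : ℂ) 1) : 0 ≤ u w := by
  rw [← InnerProductSpace.HarmonicContOnCl.circleAverage_poissonKernel_smul hu hw]
  refine Real.circleAverage_nonneg_of_nonneg fun z hz => ?_
  rw [abs_one] at hz
  refine mul_nonneg ?_ (h0 z hz)
  rw [poissonKernel_def]
  have h1 := mem_ball_zero_iff.1 hw
  have h2 := mem_sphere_zero_iff_norm.1 hz
  refine div_nonneg ?_ (by positivity)
  simp only [sub_zero, h2]
  nlinarith [norm_nonneg w]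

/-- A convex harmonic map together with a continuous extension to the closed disk. -/
structure ClosedPair (h g E : ℂ → ℂ) : Prop extends ConvexPair h g where
  continuousOn_ext : ContinuousOn E (closedBall 0 1)
  eqOn_ext : EqOn E (hmap h g) (ball 0 1)

namespace ClosedPair

variable {h g E : ℂ → ℂ}

theorem continuousOn_im (P : ClosedPair h g E) (μ : ℂ) :
    ContinuousOn (fun z => (μ * E z).im) (closedBall 0 1) :=
  continuous_im.comp_continuousOn (continuousOn_const.mul P.continuousOn_ext)

theorem exists_joinedIn_ball (P : ClosedPair h g E) {μ ζ : ℂ} {c : ℝ} (hζ : ‖ζ‖ = 1)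
    (hc : c < (μ * E ζ).im) : ∃ z ∈ ball (0 : ℂ) 1, c < (μ * E z).im ∧
      JoinedIn {z ∈ closedBall (0 : ℂ) 1 | c < (μ * E z).im} ζ z := by
  have hζm : ζ ∈ closedBall (0 : ℂ) 1 := by simp [hζ]
  have h1 := (P.continuousOn_im μ ζ hζm).eventually (lt_mem_nhds hc)
  obtain ⟨δ, hδ, hsub⟩ := Metric.mem_nhdsWithin_iff.1 h1
  have hpc : IsPathConnected (ball ζ δ ∩ closedBall (0 : ℂ) 1) :=
    ((convex_ball ζ δ).inter (convex_closedBall 0 1)).isPathConnected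
      ⟨ζ, mem_ball_self hδ, hζm⟩
  have hcl : ζ ∈ closure (ball (0 : ℂ) 1) := by rwa [closure_ball _ one_ne_zero]
  obtain ⟨z, hz, hzδ⟩ := Metric.mem_closure_iff.1 hcl δ hδ
  have hzm : z ∈ ball ζ δ ∩ closedBall (0 : ℂ) 1 :=
    ⟨mem_ball'.2 hzδ, ball_subset_closedBall hz⟩
  exact ⟨z, hz, hsub hzm, (hpc.joinedIn ζ ⟨mem_ball_self hδ, hζm⟩ z hzm).mono
    fun w hw => ⟨hw.2, hsub hw⟩⟩

/-- After moving slightly inside, both points map into the intersection of the convex range with a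
half-plane. A path in this convex set lifts by the continuous inverse. -/
theorem joinedIn_superlevel (P : ClosedPair h g E) {μ ζ ξ : ℂ} {c : ℝ} (hζ : ‖ζ‖ = 1)
    (hξ : ‖ξ‖ = 1) (hc : c < (μ * E ζ).im) (hc' : c < (μ * E ξ).im) :
    JoinedIn {z ∈ closedBall (0 : ℂ) 1 | c < (μ * E z).im} ζ ξ := by
  obtain ⟨z, hz, hzc, hzj⟩ := P.exists_joinedIn_ball hζ hc
  obtain ⟨w, hw, hwc, hwj⟩ := P.exists_joinedIn_ball hξ hc'
  refine hzj.trans (JoinedIn.trans ?_ hwj.symm)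
  set Ω := hmap h g '' ball 0 1
  have hhp : Convex ℝ {w : ℂ | c < (μ * w).im} := by
    have : {w : ℂ | c < (μ * w).im} =
      (imLm ∘ₗ LinearMap.mulLeft ℝ μ) ⁻¹' Ioi c := by ext; simp
    rw [this]
    exact (convex_Ioi c).linear_preimage _
  have hconv := P.convex.inter hhp
  rw [P.eqOn_ext hz] at hzc
  rw [P.eqOn_ext hw] at hwc
  have hz' : hmap h g z ∈ Ω ∩ {w : ℂ | c < (μ * w).im} := ⟨mem_image_of_mem _ hz, hzc⟩
  have hw' : hmap h g w ∈ Ω ∩ {w : ℂ | c < (μ * w).im} := ⟨mem_image_of_mem _ hw, hwc⟩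
  have hj := ((hconv.isPathConnected ⟨_, hz'⟩).joinedIn _ hz' _ hw').map_continuousOn
    (P.continuousOn_inv.mono inter_subset_left)
  rw [P.inv_hmap hz, P.inv_hmap hw] at hj
  refine hj.mono ?_
  rintro _ ⟨y, ⟨hy, hyc⟩, rfl⟩
  refine ⟨ball_subset_closedBall (ConvexPair.inv_mem hy), ?_⟩
  rw [P.eqOn_ext (ConvexPair.inv_mem hy), ConvexPair.hmap_inv hy]
  exact hyc

/-- A linear functional of a convex harmonic map does not alternate on the circle. -/
theorem not_alternating (P : ClosedPair h g E) {μ : ℂ} {c θ₁ θ₂ θ₃ θ₄ : ℝ} (h12 : θ₁ < θ₂)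
    (h23 : θ₂ < θ₃) (h34 : θ₃ < θ₄) (h41 : θ₄ < θ₁ + 2 * Real.pi)
    (h1 : c < (μ * E (exp (θ₁ * I))).im) (h2 : (μ * E (exp (θ₂ * I))).im < c)
    (h3 : c < (μ * E (exp (θ₃ * I))).im) (h4 : (μ * E (exp (θ₄ * I))).im < c) : False := by
  have hn : ∀ θ : ℝ, ‖exp (θ * I)‖ = 1 := norm_exp_ofReal_mul_I
  have j1 := P.joinedIn_superlevel (hn θ₁) (hn θ₃) h1 h3
  have j2 := P.joinedIn_superlevel (μ := -μ) (c := -c) (hn θ₂) (hn θ₄) (by simpa using h2)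
    (by simpa using h4)
  obtain ⟨s, t, hst⟩ := exists_path_eq h12 h23 h34 h41 j1.somePath j2.somePath
    (fun s => mem_closedBall_zero_iff.1 (j1.somePath_mem s).1)
    (fun s => mem_closedBall_zero_iff.1 (j2.somePath_mem s).1)
  have m1 := (j1.somePath_mem s).2
  have m2 : -c < (-μ * E (j2.somePath t)).im := (j2.somePath_mem t).2
  rw [neg_mul, neg_im] at m2
  rw [hst] at m1
  linarith

end ClosedPair

/-! ### The hyperbolic flow between two boundary points -/

/-- The hyperbolic automorphism of the disk with the fixed points `ζ₁`, `ζ₂` and multiplier `l`. -/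
def flow (ζ₁ ζ₂ : ℂ) (l : ℝ) (z : ℂ) : ℂ :=
  ((ζ₁ - l * ζ₂) * z + (l - 1) * ζ₁ * ζ₂) / ((1 - l) * z + (l * ζ₁ - ζ₂))

section flow

variable {ζ₁ ζ₂ : ℂ} {l : ℝ}

/-- The denominator dominates the numerator exactly as `‖z‖ ≤ 1`; this gives both the absence of
poles on the closed disk and the invariance of the disk. -/
theorem flow_normSq (h₁ : ‖ζ₁‖ = 1) (h₂ : ‖ζ₂‖ = 1) (z : ℂ) :
    ‖(1 - l) * z + (l * ζ₁ - ζ₂)‖ ^ 2 - ‖(ζ₁ - l * ζ₂) * z + (l - 1) * ζ₁ * ζ₂‖ ^ 2 =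
      l * ‖ζ₁ - ζ₂‖ ^ 2 * (1 - ‖z‖ ^ 2) := by
  have e1 : ζ₁.re * ζ₁.re + ζ₁.im * ζ₁.im = 1 := by
    rw [← normSq_apply, normSq_eq_norm_sq, h₁, one_pow]
  have e2 : ζ₂.re * ζ₂.re + ζ₂.im * ζ₂.im = 1 := by
    rw [← normSq_apply, normSq_eq_norm_sq, h₂, one_pow]
  have e3 : ‖(ζ₁ - l * ζ₂) * z + (l - 1) * ζ₁ * ζ₂‖ =
      ‖(conj ζ₂ - l * conj ζ₁) * z + (l - 1)‖ := by
    have c1 : ζ₁ * conj ζ₁ = 1 := by rw [mul_conj, normSq_apply, e1, ofReal_one]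
    have c2 : ζ₂ * conj ζ₂ = 1 := by rw [mul_conj, normSq_apply, e2, ofReal_one]
    have : (ζ₁ - l * ζ₂) * z + (l - 1) * ζ₁ * ζ₂ =
        ζ₁ * ζ₂ * ((conj ζ₂ - l * conj ζ₁) * z + (l - 1)) := by
      linear_combination -ζ₁ * z * c2 + l * ζ₂ * z * c1
    rw [this, norm_mul, norm_mul, h₁, h₂, one_mul, one_mul]
  rw [e3]
  simp only [← normSq_eq_norm_sq, normSq_apply]
  simp
  generalize ζ₁.re = a at *
  generalize ζ₁.im = b at *
  generalize ζ₂.re = c at *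
  generalize ζ₂.im = d at *
  generalize z.re = x
  generalize z.im = y
  linear_combination (l ^ 2 - l - (x * x + y * y) * (l ^ 2 - l)) * e1 +
    (1 - l - (x * x + y * y) * (1 - l)) * e2

theorem flow_den_ne_zero (h₁ : ‖ζ₁‖ = 1) (h₂ : ‖ζ₂‖ = 1) (hne : ζ₁ ≠ ζ₂) (hl : 0 < l) {z : ℂ}
    (hz : ‖z‖ ≤ 1) : (1 - l) * z + (l * ζ₁ - ζ₂) ≠ 0 := by
  intro h0
  have h := flow_normSq (l := l) h₁ h₂ z
  rw [h0, norm_zero] at h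
  have h3 : 0 ≤ l * ‖ζ₁ - ζ₂‖ ^ 2 * (1 - ‖z‖ ^ 2) :=
    mul_nonneg (by positivity) (by nlinarith [norm_nonneg z])
  have h4 : (ζ₁ - l * ζ₂) * z + (l - 1) * ζ₁ * ζ₂ = 0 := by
    rw [← norm_eq_zero]
    nlinarith [norm_nonneg ((ζ₁ - l * ζ₂) * z + (l - 1) * ζ₁ * ζ₂)]
  have h5 : (l : ℂ) * (ζ₁ - ζ₂) ^ 2 = 0 := by
    linear_combination (ζ₁ - l * ζ₂) * h0 - (1 - l) * h4
  rcases mul_eq_zero.1 h5 with h6 | h6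
  · exact hl.ne' (by exact_mod_cast h6)
  · exact hne (sub_eq_zero.1 (pow_eq_zero_iff two_ne_zero |>.1 h6))

theorem flow_mapsTo_closedBall (h₁ : ‖ζ₁‖ = 1) (h₂ : ‖ζ₂‖ = 1) (hne : ζ₁ ≠ ζ₂) (hl : 0 < l) :
    MapsTo (flow ζ₁ ζ₂ l) (closedBall 0 1) (closedBall 0 1) := fun z hz => by
  rw [mem_closedBall_zero_iff] at hz ⊢
  rw [flow, norm_div, div_le_one (norm_pos_iff.2 (flow_den_ne_zero h₁ h₂ hne hl hz))]
  have h := flow_normSq (l := l) h₁ h₂ z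
  have h3 : 0 ≤ l * ‖ζ₁ - ζ₂‖ ^ 2 * (1 - ‖z‖ ^ 2) :=
    mul_nonneg (by positivity) (by nlinarith [norm_nonneg z])
  exact le_of_sq_le_sq (by linarith) (norm_nonneg _)

theorem flow_mapsTo_ball (h₁ : ‖ζ₁‖ = 1) (h₂ : ‖ζ₂‖ = 1) (hne : ζ₁ ≠ ζ₂) (hl : 0 < l) :
    MapsTo (flow ζ₁ ζ₂ l) (ball 0 1) (ball 0 1) := fun z hz => by
  rw [mem_ball_zero_iff] at hz ⊢
  rw [flow, norm_div, div_lt_one (norm_pos_iff.2 (flow_den_ne_zero h₁ h₂ hne hl hz.le))]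
  have h := flow_normSq (l := l) h₁ h₂ z
  have h3 : 0 < l * ‖ζ₁ - ζ₂‖ ^ 2 * (1 - ‖z‖ ^ 2) := by
    have : 0 < ‖ζ₁ - ζ₂‖ := norm_pos_iff.2 (sub_ne_zero.2 hne)
    exact mul_pos (by positivity) (by nlinarith [norm_nonneg z])
  exact lt_of_pow_lt_pow_left₀ 2 (norm_nonneg _) (by linarith)

theorem differentiableOn_flow (h₁ : ‖ζ₁‖ = 1) (h₂ : ‖ζ₂‖ = 1) (hne : ζ₁ ≠ ζ₂) (hl : 0 < l) :
    DifferentiableOn ℂ (flow ζ₁ ζ₂ l) (closedBall 0 1) :=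
  DifferentiableOn.div (by fun_prop) (by fun_prop) fun z hz =>
    flow_den_ne_zero h₁ h₂ hne hl (mem_closedBall_zero_iff.1 hz)

/-- The flow multiplies the coordinate `(z - ζ₁) / (z - ζ₂)` by `l`; this is that relation with
denominators cleared. For `l > 1` points move from `ζ₁` towards `ζ₂`. -/
theorem flow_eq (h₁ : ‖ζ₁‖ = 1) (h₂ : ‖ζ₂‖ = 1) (hne : ζ₁ ≠ ζ₂) (hl : 0 < l) {z w : ℂ}
    (hz : ‖z‖ ≤ 1) (h : (w - ζ₁) * (z - ζ₂) = l * (z - ζ₁) * (w - ζ₂)) :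
    flow ζ₁ ζ₂ l z = w := by
  rw [flow, div_eq_iff (flow_den_ne_zero h₁ h₂ hne hl hz)]
  linear_combination -h

theorem flow_one (hne : ζ₁ ≠ ζ₂) (z : ℂ) : flow ζ₁ ζ₂ 1 z = z := by
  have : ζ₁ - ζ₂ ≠ 0 := sub_ne_zero.2 hne
  simp [flow]
  field_simp

theorem hasDerivAt_flow (hne : ζ₁ ≠ ζ₂) (z : ℂ) :
    HasDerivAt (fun l : ℝ => flow ζ₁ ζ₂ l z) ((z - ζ₁) * (z - ζ₂) / (ζ₁ - ζ₂)) 1 := by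
  have h0 : ζ₁ - ζ₂ ≠ 0 := sub_ne_zero.2 hne
  have hl : HasDerivAt (fun l : ℝ => (l : ℂ)) 1 1 := (hasDerivAt_id (1 : ℝ)).ofReal_comp
  have hnum : HasDerivAt (fun l : ℝ => (ζ₁ - l * ζ₂) * z + (l - 1) * ζ₁ * ζ₂)
      (-(1 * ζ₂) * z + 1 * ζ₁ * ζ₂) 1 :=
    (((hl.mul_const ζ₂).const_sub ζ₁).mul_const z).add (((hl.sub_const 1).mul_const ζ₁).mul_const ζ₂)
  have hden : HasDerivAt (fun l : ℝ => (1 - l) * z + (l * ζ₁ - ζ₂))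
      (-1 * z + 1 * ζ₁) 1 :=
    ((hl.const_sub 1).mul_const z).add ((hl.mul_const ζ₁).sub_const ζ₂)
  refine (hnum.div hden (by simpa using h0)).congr_deriv ?_
  simp
  field_simp
  ring

theorem exp_sub_exp_mul_I (α β : ℝ) : exp (α * I) - exp (β * I) =
    2 * I * Real.sin ((α - β) / 2) * exp (((α + β) / 2 : ℝ) * I) := by
  have e1 : (α * I : ℂ) = ((α - β) / 2 : ℝ) * I + ((α + β) / 2 : ℝ) * I := by push_cast; ring
  have e2 : (β * I : ℂ) = -(((α - β) / 2 : ℝ) * I) + ((α + β) / 2 : ℝ) * I := by push_cast; ring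
  rw [e1, e2, Complex.exp_add, Complex.exp_add, ofReal_sin, Complex.sin, neg_mul]
  linear_combination (exp (((α - β) / 2 : ℝ) * I) - exp (-(((α - β) / 2 : ℝ) * I))) *
    exp (((α + β) / 2 : ℝ) * I) * I_sq

/-- Differences of points of the circle are half-angle sines times phases, and the phases cancel in
the cross ratio; the action on the circle becomes a real equation for the angle. -/
theorem flow_exp {a b θ θ' : ℝ} (hne : exp (a * I) ≠ exp (b * I)) (hl : 0 < l)
    (h : Real.sin ((θ' - a) / 2) * Real.sin ((b - θ) / 2) =
      l * Real.sin ((θ - a) / 2) * Real.sin ((b - θ') / 2)) :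
    flow (exp (a * I)) (exp (b * I)) l (exp (θ * I)) = exp (θ' * I) := by
  refine flow_eq (norm_exp_ofReal_mul_I _) (norm_exp_ofReal_mul_I _) hne hl
    (norm_exp_ofReal_mul_I _).le ?_
  have s1 : Real.sin ((θ - b) / 2) = -Real.sin ((b - θ) / 2) := by
    rw [← Real.sin_neg]; congr 1; ring
  have s2 : Real.sin ((θ' - b) / 2) = -Real.sin ((b - θ') / 2) := by
    rw [← Real.sin_neg]; congr 1; ring
  have hc : (Real.sin ((θ' - a) / 2) * Real.sin ((b - θ) / 2) : ℂ) =
      l * Real.sin ((θ - a) / 2) * Real.sin ((b - θ') / 2) := by exact_mod_cast h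
  have he : exp (((θ' + a) / 2 : ℝ) * I) * exp (((θ + b) / 2 : ℝ) * I) =
      exp (((θ + a) / 2 : ℝ) * I) * exp (((θ' + b) / 2 : ℝ) * I) := by
    rw [← Complex.exp_add, ← Complex.exp_add]; congr 1; push_cast; ring
  rw [exp_sub_exp_mul_I, exp_sub_exp_mul_I, exp_sub_exp_mul_I, exp_sub_exp_mul_I, s1, s2]
  rw [ofReal_neg, ofReal_neg]
  linear_combination -(2 * I) ^ 2 * exp (((θ' + a) / 2 : ℝ) * I) * exp (((θ + b) / 2 : ℝ) * I) * hc
    - (2 * I) ^ 2 * l * Real.sin ((θ - a) / 2) * Real.sin ((b - θ') / 2) * he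

end flow

/-! ### Monotonicity along the flow and positivity of the shear -/

theorem exists_exp_eq {ζ : ℂ} (hζ : ‖ζ‖ = 1) (a : ℝ) :
    ∃ θ ∈ Ico a (a + 2 * Real.pi), exp (θ * I) = ζ := by
  refine ⟨toIcoMod Real.two_pi_pos a (arg ζ), toIcoMod_mem_Ico _ _ _, ?_⟩
  rw [toIcoMod, ofReal_sub, sub_mul, Complex.exp_sub]
  have : exp (((toIcoDiv Real.two_pi_pos a (arg ζ) • (2 * Real.pi) : ℝ) : ℂ) * I) = 1 := by
    rw [Complex.exp_eq_one_iff]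
    exact ⟨_, by push_cast [zsmul_eq_mul]; ring⟩
  rw [this, div_one]
  simpa [hζ] using norm_mul_exp_arg_mul_I ζ

theorem exp_add_two_pi_mul_I (a : ℝ) : exp ((a + 2 * Real.pi : ℝ) * I) = exp (a * I) := by
  push_cast
  rw [add_mul, Complex.exp_add, Complex.exp_two_pi_mul_I, mul_one]

theorem deriv_nonneg_of_le {u : ℝ → ℝ} {u' x : ℝ} (hu : HasDerivAt u u' x)
    (h : ∀ y, x < y → u x ≤ u y) : 0 ≤ u' := by
  have h1 := (hasDerivWithinAt_iff_tendsto_slope' (s := Ioi x) (by simp)).1 hu.hasDerivWithinAt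
  refine ge_of_tendsto h1 (eventually_nhdsWithin_of_forall fun y hy => ?_)
  rw [slope_def_field]
  exact div_nonneg (sub_nonneg.2 (h y hy)) (sub_nonneg.2 (le_of_lt hy))

namespace ClosedPair

variable {h g E : ℂ → ℂ}

/-- The flow moves a point of either open arc towards the maximum without leaving the arc. If the
height dropped, the old and new positions together with the maximum and the minimum would alternate
around the circle. -/
theorem le_flow_of_lt (P : ClosedPair h g E) {μ : ℂ} {a b l θ : ℝ} (hab : a < b)
    (hba : b < a + 2 * Real.pi)
    (hmin : ∀ θ : ℝ, (μ * E (exp (a * I))).im ≤ (μ * E (exp (θ * I))).im)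
    (hmax : ∀ θ : ℝ, (μ * E (exp (θ * I))).im ≤ (μ * E (exp (b * I))).im) (hl : 1 < l)
    (hne : exp (a * I) ≠ exp (b * I)) (hθ : θ ∈ Ico a (a + 2 * Real.pi)) :
    (μ * E (exp (θ * I))).im ≤
      (μ * E (flow (exp (a * I)) (exp (b * I)) l (exp (θ * I)))).im := by
  have hl0 : 0 < l := by linarith
  -- The zeros of `Ψ` are angles of the flowed point; the intermediate value theorem locates one
  -- between `θ` and the angle `b` of the maximum.
  set Ψ : ℝ → ℝ := fun θ' => Real.sin ((θ' - a) / 2) * Real.sin ((b - θ) / 2) -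
      l * Real.sin ((θ - a) / 2) * Real.sin ((b - θ') / 2) with hΨ
  have hΨc : Continuous Ψ := by fun_prop
  have hflow : ∀ θ', Ψ θ' = 0 →
      flow (exp (a * I)) (exp (b * I)) l (exp (θ * I)) = exp (θ' * I) :=
    fun θ' h0 => flow_exp hne hl0 (sub_eq_zero.1 h0)
  have hper : (μ * E (exp ((a + 2 * Real.pi : ℝ) * I))).im = (μ * E (exp (a * I))).im := by
    rw [exp_add_two_pi_mul_I]
  have hsθ : 0 ≤ Real.sin ((θ - a) / 2) :=
    Real.sin_nonneg_of_nonneg_of_le_pi (by linarith [hθ.1]) (by linarith [hθ.2])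
  have hsb : 0 ≤ Real.sin ((b - a) / 2) :=
    Real.sin_nonneg_of_nonneg_of_le_pi (by linarith) (by linarith)
  have hΨθ : Ψ θ = (1 - l) * Real.sin ((θ - a) / 2) * Real.sin ((b - θ) / 2) := by
    simp only [hΨ]; ring
  have hΨb : Ψ b = Real.sin ((b - a) / 2) * Real.sin ((b - θ) / 2) := by
    simp [hΨ]
  rcases hθ.1.eq_or_lt with rfl | haθ
  · obtain ⟨θ', -, e⟩ := exists_exp_eq (ζ := flow (exp (a * I)) (exp (b * I)) l (exp (a * I)))
      (by rw [hflow a (by simp [hΨ])]; exact norm_exp_ofReal_mul_I a) 0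
    rw [← e]
    exact hmin θ'
  rcases le_or_gt θ b with hθb | hθb
  · have hs : 0 ≤ Real.sin ((b - θ) / 2) :=
      Real.sin_nonneg_of_nonneg_of_le_pi (by linarith) (by linarith)
    obtain ⟨θ', hθ', h0⟩ := intermediate_value_Icc hθb hΨc.continuousOn
      (show (0 : ℝ) ∈ Icc (Ψ θ) (Ψ b) from
        ⟨by rw [hΨθ, mul_assoc]; exact mul_nonpos_of_nonpos_of_nonneg (by linarith) (mul_nonneg hsθ hs),
          by rw [hΨb]; exact mul_nonneg hsb hs⟩)
    rw [hflow θ' h0]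
    by_contra! hlt
    obtain ⟨c, hc1, hc2⟩ := exists_between hlt
    have h1 : θ < θ' := hθ'.1.lt_of_ne (by rintro rfl; exact lt_irrefl _ hlt)
    have h2 : θ' < b := hθ'.2.lt_of_ne (by rintro rfl; exact absurd (hmax θ) (not_le.2 hlt))
    exact P.not_alternating h1 h2 hba (by linarith) hc2 hc1 (hc2.trans_le (hmax θ))
      (by rw [hper]; exact (hmin θ').trans_lt hc1)
  · have hs : Real.sin ((b - θ) / 2) ≤ 0 :=
      Real.sin_nonpos_of_nonpos_of_neg_pi_le (by linarith) (by linarith [hθ.2])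
    obtain ⟨θ', hθ', h0⟩ := intermediate_value_Icc hθb.le hΨc.continuousOn
      (show (0 : ℝ) ∈ Icc (Ψ b) (Ψ θ) from
        ⟨by rw [hΨb]; exact mul_nonpos_of_nonneg_of_nonpos hsb hs,
          by rw [hΨθ]; exact mul_nonneg_of_nonpos_of_nonpos
              (mul_nonpos_of_nonpos_of_nonneg (by linarith) hsθ) hs⟩)
    rw [hflow θ' h0]
    by_contra! hlt
    obtain ⟨c, hc1, hc2⟩ := exists_between hlt
    have h1 : θ' < θ := hθ'.2.lt_of_ne (by rintro rfl; exact lt_irrefl _ hlt)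
    have h2 : b < θ' := hθ'.1.lt_of_ne (by rintro rfl; exact absurd (hmax θ) (not_le.2 hlt))
    exact P.not_alternating h2 h1 hθ.2 (by linarith) (hc2.trans_le (hmax θ)) hc1 hc2
      (by rw [hper]; exact (hmin θ').trans_lt hc1)

theorem le_flow (P : ClosedPair h g E) {μ ζ₁ ζ₂ z : ℂ} {l : ℝ} (h₁ : ‖ζ₁‖ = 1) (h₂ : ‖ζ₂‖ = 1)
    (hne : ζ₁ ≠ ζ₂) (hmin : ∀ ζ : ℂ, ‖ζ‖ = 1 → (μ * E ζ₁).im ≤ (μ * E ζ).im)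
    (hmax : ∀ ζ : ℂ, ‖ζ‖ = 1 → (μ * E ζ).im ≤ (μ * E ζ₂).im) (hl : 1 < l) (hz : ‖z‖ = 1) :
    (μ * E z).im ≤ (μ * E (flow ζ₁ ζ₂ l z)).im := by
  obtain ⟨a, -, rfl⟩ := exists_exp_eq h₁ 0
  obtain ⟨b, hb, rfl⟩ := exists_exp_eq h₂ a
  obtain ⟨θ, hθ, rfl⟩ := exists_exp_eq hz a
  have hab : a < b := hb.1.lt_of_ne (by rintro rfl; exact hne rfl)
  exact P.le_flow_of_lt hab hb.2 (fun _ => hmin _ (norm_exp_ofReal_mul_I _))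
    (fun _ => hmax _ (norm_exp_ofReal_mul_I _)) hl hne hθ

theorem im_eq_shear (P : ClosedPair h g E) (μ : ℂ) {z : ℂ} (hz : z ∈ ball (0 : ℂ) 1) :
    (μ * E z).im = (shear h g μ z).im := by
  rw [P.eqOn_ext hz, shear_im]

theorem harmonicOn_im (P : ClosedPair h g E) (μ : ℂ) {σ : ℂ → ℂ}
    (hσ : DifferentiableOn ℂ σ (ball 0 1)) (hm : MapsTo σ (ball 0 1) (ball 0 1)) :
    InnerProductSpace.HarmonicOnNhd (fun z => (μ * E (σ z)).im) (ball 0 1) := by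
  intro z hz
  have hd : DifferentiableOn ℂ (fun z => shear h g μ (σ z)) (ball 0 1) := fun w hw =>
    (((P.toConvexPair.hasDerivAt_shear μ (hm hw)).differentiableAt).comp_differentiableWithinAt w
      (hσ w hw))
  have := (hd.analyticAt (isOpen_ball.mem_nhds hz)).harmonicAt_im
  refine (InnerProductSpace.harmonicAt_congr_nhds ?_).2 this
  filter_upwards [isOpen_ball.mem_nhds hz] with w hw
  exact P.im_eq_shear μ (hm hw)

theorem le_flow_ball (P : ClosedPair h g E) {μ ζ₁ ζ₂ z : ℂ} {l : ℝ} (h₁ : ‖ζ₁‖ = 1)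
    (h₂ : ‖ζ₂‖ = 1) (hne : ζ₁ ≠ ζ₂) (hmin : ∀ ζ : ℂ, ‖ζ‖ = 1 → (μ * E ζ₁).im ≤ (μ * E ζ).im)
    (hmax : ∀ ζ : ℂ, ‖ζ‖ = 1 → (μ * E ζ).im ≤ (μ * E ζ₂).im) (hl : 1 < l)
    (hz : z ∈ ball (0 : ℂ) 1) : (μ * E z).im ≤ (μ * E (flow ζ₁ ζ₂ l z)).im := by
  have hl0 : 0 < l := by linarith
  have hu : InnerProductSpace.HarmonicContOnCl
      (fun z => (μ * E (flow ζ₁ ζ₂ l z)).im - (μ * E z).im) (ball 0 1) := by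
    refine InnerProductSpace.HarmonicContOnCl.mk_ball ?_ ?_
    · exact (P.harmonicOn_im μ ((differentiableOn_flow h₁ h₂ hne hl0).mono ball_subset_closedBall)
        (flow_mapsTo_ball h₁ h₂ hne hl0)).sub (P.harmonicOn_im μ differentiableOn_id (mapsTo_id _))
    · exact ((P.continuousOn_im μ).comp (differentiableOn_flow h₁ h₂ hne hl0).continuousOn
        (flow_mapsTo_closedBall h₁ h₂ hne hl0)).sub (P.continuousOn_im μ)
  have := harmonic_nonneg_of_sphere hu (fun w hw => sub_nonneg.2
    (P.le_flow h₁ h₂ hne hmin hmax hl (mem_sphere_zero_iff_norm.1 hw))) hz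
  linarith

/-- Convexity in one direction, as a positivity property of the shear. -/
theorem re_deriv_shear_nonneg (P : ClosedPair h g E) {μ ζ₁ ζ₂ z : ℂ} (h₁ : ‖ζ₁‖ = 1)
    (h₂ : ‖ζ₂‖ = 1) (hne : ζ₁ ≠ ζ₂) (hmin : ∀ ζ : ℂ, ‖ζ‖ = 1 → (μ * E ζ₁).im ≤ (μ * E ζ).im)
    (hmax : ∀ ζ : ℂ, ‖ζ‖ = 1 → (μ * E ζ).im ≤ (μ * E ζ₂).im) (hz : z ∈ ball (0 : ℂ) 1) :
    0 ≤ ((μ * deriv h z - conj μ * deriv g z) * (I * (ζ₁ - ζ₂) +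
      ((2 * (ζ₁ * conj ζ₂).im : ℝ) : ℂ) * z + conj (I * (ζ₁ - ζ₂)) * z ^ 2)).re := by
  have hF := P.toConvexPair.hasDerivAt_shear μ hz
  set F' := μ * deriv h z - conj μ * deriv g z
  have hF1 : HasDerivAt (shear h g μ) F' (flow ζ₁ ζ₂ (1 : ℝ) z) := by rwa [flow_one hne]
  have hd := (hF1.comp (1 : ℝ) (hasDerivAt_flow hne z))
  have hd' := imCLM.hasFDerivAt.comp_hasDerivAt (1 : ℝ) hd
  -- The height is nondecreasing in `l` for `l > 1`, so its derivative at the identity parameter `l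
  -- = 1` is nonnegative.
  have hn : 0 ≤ (F' * ((z - ζ₁) * (z - ζ₂) / (ζ₁ - ζ₂))).im := by
    refine deriv_nonneg_of_le hd' fun l hl => ?_
    have := P.le_flow_ball h₁ h₂ hne hmin hmax hl hz
    rw [P.im_eq_shear μ hz, P.im_eq_shear μ
      (flow_mapsTo_ball h₁ h₂ hne (by linarith) hz)] at this
    simpa [flow_one hne] using this
  have c1 : ζ₁ * conj ζ₁ = 1 := by rw [mul_conj, normSq_eq_norm_sq, h₁]; simp
  have c2 : ζ₂ * conj ζ₂ = 1 := by rw [mul_conj, normSq_eq_norm_sq, h₂]; simp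
  have h0 : ζ₁ - ζ₂ ≠ 0 := sub_ne_zero.2 hne
  have hC : ((2 * (ζ₁ * conj ζ₂).im : ℝ) : ℂ) = -I * (ζ₁ * conj ζ₂ - conj ζ₁ * ζ₂) := by
    have : ζ₁ * conj ζ₂ - conj ζ₁ * ζ₂ = 2 * (ζ₁ * conj ζ₂).im * I := by
      have := Complex.sub_conj (ζ₁ * conj ζ₂)
      push_cast at this
      rw [← this]; simp
    rw [this]
    push_cast
    linear_combination (2 * (ζ₁ * conj ζ₂).im : ℂ) * I_sq
  -- Multiplying the flow's vector field by `|ζ₁ - ζ₂|²` clears its denominator and exhibits a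
  -- quadratic with conjugate outer coefficients and real middle one. The factor `-I` turns an
  -- imaginary part into a real part.
  have hQ : I * (ζ₁ - ζ₂) + ((2 * (ζ₁ * conj ζ₂).im : ℝ) : ℂ) * z + conj (I * (ζ₁ - ζ₂)) * z ^ 2 =
      -I * ((normSq (ζ₁ - ζ₂) : ℂ) * ((z - ζ₁) * (z - ζ₂) / (ζ₁ - ζ₂))) := by
    rw [hC, ← mul_conj]
    field_simp
    simp only [map_mul, map_sub, conj_I]
    linear_combination (I * ζ₂ - I * z) * c1 + (I * z - I * ζ₁) * c2
  rw [hQ]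
  have : (F' * (-I * ((normSq (ζ₁ - ζ₂) : ℂ) * ((z - ζ₁) * (z - ζ₂) / (ζ₁ - ζ₂))))).re =
      normSq (ζ₁ - ζ₂) * (F' * ((z - ζ₁) * (z - ζ₂) / (ζ₁ - ζ₂))).im := by
    rw [show F' * (-I * ((normSq (ζ₁ - ζ₂) : ℂ) * ((z - ζ₁) * (z - ζ₂) / (ζ₁ - ζ₂)))) =
      -I * ((normSq (ζ₁ - ζ₂) : ℂ) * (F' * ((z - ζ₁) * (z - ζ₂) / (ζ₁ - ζ₂)))) by ring]
    simp
  rw [this]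
  exact mul_nonneg (normSq_nonneg _) hn

end ClosedPair

/-! ### Balancing the direction to remove the linear term -/

namespace ClosedPair

variable {h g E : ℂ → ℂ}

/-- A constant height on the circle would be constant in the disk by the Poisson formula, making the
shear constant against its univalence. -/
theorem nonconst_of_sphere (P : ClosedPair h g E) {μ : ℂ} (hμ : ‖μ‖ = 1) (c : ℝ) :
    ∃ ζ : ℂ, ‖ζ‖ = 1 ∧ (μ * E ζ).im ≠ c := by
  by_contra! hc
  have hh := P.harmonicOn_im μ differentiableOn_id (mapsTo_id _)
  have hcst : InnerProductSpace.HarmonicOnNhd (fun _ : ℂ => c) (ball 0 1) :=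
    fun z _ => InnerProductSpace.harmonicAt_const c
  have key : ∀ z ∈ ball (0 : ℂ) 1, (μ * E z).im = c := by
    intro z hz
    have u1 := harmonic_nonneg_of_sphere (InnerProductSpace.HarmonicContOnCl.mk_ball
      (hh.sub hcst) ((P.continuousOn_im μ).sub continuousOn_const))
      (fun w hw => (sub_eq_zero.2 (hc w (mem_sphere_zero_iff_norm.1 hw))).ge) hz
    have u2 := harmonic_nonneg_of_sphere (InnerProductSpace.HarmonicContOnCl.mk_ball
      (hcst.sub hh) (continuousOn_const.sub (P.continuousOn_im μ)))
      (fun w hw => (sub_eq_zero.2 (hc w (mem_sphere_zero_iff_norm.1 hw)).symm).ge) hz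
    simp only [Pi.sub_apply, id] at u1 u2
    linarith
  have hd : DifferentiableOn ℂ (shear h g μ) (ball 0 1) := fun z hz =>
    (P.toConvexPair.hasDerivAt_shear μ hz).differentiableAt.differentiableWithinAt
  obtain ⟨d, hd⟩ := (hd.analyticOnNhd isOpen_ball).eq_const_of_im_eq_const (c₀ := c)
    (fun z hz => by rw [← P.im_eq_shear μ hz]; exact key z hz) isOpen_ball
    ⟨⟨0, mem_ball_self one_pos⟩, (convex_ball (0 : ℂ) 1).isPreconnected⟩
  have h0 : (0 : ℂ) ∈ ball (0 : ℂ) 1 := mem_ball_self one_pos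
  have h2 : ((1 / 2 : ℝ) : ℂ) ∈ ball (0 : ℂ) 1 := by
    rw [mem_ball_zero_iff, norm_real]; norm_num
  have := P.toConvexPair.injOn_shear hμ h0 h2 ((hd 0 h0).trans (hd _ h2).symm)
  norm_num at this

/-- The directions `μ` for which `Im (μ E)` has a minimum `ζ₁` and a maximum `ζ₂` on the circle
with `0 ≤ s Im (ζ₁ conj ζ₂)`. -/
def extremalDirections (E : ℂ → ℂ) (s : ℝ) : Set ℂ :=
  {μ | ‖μ‖ = 1 ∧ ∃ ζ₁ ζ₂ : ℂ, ‖ζ₁‖ = 1 ∧ ‖ζ₂‖ = 1 ∧ 0 ≤ s * (ζ₁ * conj ζ₂).im ∧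
    (∀ ζ : ℂ, ‖ζ‖ = 1 → (μ * E ζ₁).im ≤ (μ * E ζ).im) ∧
    (∀ ζ : ℂ, ‖ζ‖ = 1 → (μ * E ζ).im ≤ (μ * E ζ₂).im)}

theorem continuous_restrict_sphere (P : ClosedPair h g E) :
    Continuous fun ζ : sphere (0 : ℂ) 1 => E ζ :=
  continuousOn_iff_continuous_domRestrict.1 (P.continuousOn_ext.mono sphere_subset_closedBall)

/-- The set is the projection of a compact set of triples: a direction together with a minimum and a
maximum. -/
theorem isClosed_extremalDirections (P : ClosedPair h g E) (s : ℝ) :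
    IsClosed (extremalDirections E s) := by
  have hE := P.continuous_restrict_sphere
  let T : Set (sphere (0 : ℂ) 1 × sphere (0 : ℂ) 1 × sphere (0 : ℂ) 1) :=
    {p | 0 ≤ s * ((p.2.1 : ℂ) * conj (p.2.2 : ℂ)).im} ∩
    ⋂ ζ : sphere (0 : ℂ) 1, {p | ((p.1 : ℂ) * E p.2.1).im ≤ ((p.1 : ℂ) * E ζ).im} ∩
      {p | ((p.1 : ℂ) * E ζ).im ≤ ((p.1 : ℂ) * E p.2.2).im}
  have hT : IsClosed T := by
    refine IsClosed.inter (isClosed_le (by fun_prop) ?_) (isClosed_iInter fun ζ =>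
      IsClosed.inter (isClosed_le ?_ ?_) (isClosed_le ?_ ?_))
    · have : Continuous fun p : sphere (0 : ℂ) 1 × sphere (0 : ℂ) 1 × sphere (0 : ℂ) 1 =>
        ((p.2.1 : ℂ) * conj (p.2.2 : ℂ)) := by fun_prop
      exact continuous_const.mul (continuous_im.comp this)
    · exact continuous_im.comp ((by fun_prop : Continuous fun p : sphere (0 : ℂ) 1 ×
        sphere (0 : ℂ) 1 × sphere (0 : ℂ) 1 => (p.1 : ℂ)).mul (hE.comp (by fun_prop)))
    · fun_prop
    · fun_prop
    · exact continuous_im.comp ((by fun_prop : Continuous fun p : sphere (0 : ℂ) 1 ×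
        sphere (0 : ℂ) 1 × sphere (0 : ℂ) 1 => (p.1 : ℂ)).mul (hE.comp (by fun_prop)))
  have himg : extremalDirections E s = (fun p => (p.1 : ℂ)) '' T := by
    ext μ
    constructor
    · rintro ⟨hμ, ζ₁, ζ₂, h₁, h₂, hs, hmin, hmax⟩
      refine ⟨(⟨μ, by simpa using hμ⟩, ⟨ζ₁, by simpa using h₁⟩, ⟨ζ₂, by simpa using h₂⟩),
        ⟨hs, mem_iInter.2 fun ζ => ⟨hmin ζ ?_, hmax ζ ?_⟩⟩, rfl⟩ <;>
      exact mem_sphere_zero_iff_norm.1 ζ.2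
    · rintro ⟨⟨μ, ζ₁, ζ₂⟩, ⟨hs, hT⟩, rfl⟩
      refine ⟨mem_sphere_zero_iff_norm.1 μ.2, ζ₁, ζ₂, mem_sphere_zero_iff_norm.1 ζ₁.2,
        mem_sphere_zero_iff_norm.1 ζ₂.2, hs, fun ζ hζ => ?_, fun ζ hζ => ?_⟩
      · exact (mem_iInter.1 hT ⟨ζ, by simpa using hζ⟩).1
      · exact (mem_iInter.1 hT ⟨ζ, by simpa using hζ⟩).2
  rw [himg]
  exact (hT.isCompact.image (by fun_prop)).isClosed

theorem mem_extremalDirections_or (P : ClosedPair h g E) {μ : ℂ} (hμ : ‖μ‖ = 1) :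
    μ ∈ extremalDirections E 1 ∨ μ ∈ extremalDirections E (-1) := by
  have hc : ContinuousOn (fun z => (μ * E z).im) (sphere 0 1) :=
    (P.continuousOn_im μ).mono sphere_subset_closedBall
  have hne : (sphere (0 : ℂ) 1).Nonempty := ⟨1, by simp⟩
  obtain ⟨ζ₁, h₁, hmin⟩ := (isCompact_sphere (0 : ℂ) 1).exists_isMinOn hne hc
  obtain ⟨ζ₂, h₂, hmax⟩ := (isCompact_sphere (0 : ℂ) 1).exists_isMaxOn hne hc
  rw [mem_sphere_zero_iff_norm] at h₁ h₂
  rcases le_total 0 (ζ₁ * conj ζ₂).im with hs | hs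
  · exact .inl ⟨hμ, ζ₁, ζ₂, h₁, h₂, by simpa using hs, fun ζ hζ => hmin (by simpa using hζ),
      fun ζ hζ => hmax (by simpa using hζ)⟩
  · exact .inr ⟨hμ, ζ₁, ζ₂, h₁, h₂, by simpa using hs, fun ζ hζ => hmin (by simpa using hζ),
      fun ζ hζ => hmax (by simpa using hζ)⟩

theorem neg_mem_extremalDirections {s : ℝ} {μ : ℂ} (h : μ ∈ extremalDirections E s) :
    -μ ∈ extremalDirections E (-s) := by
  obtain ⟨hμ, ζ₁, ζ₂, h₁, h₂, hs, hmin, hmax⟩ := h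
  refine ⟨by rwa [norm_neg], ζ₂, ζ₁, h₂, h₁, ?_, fun ζ hζ => ?_, fun ζ hζ => ?_⟩
  · have : (ζ₂ * conj ζ₁).im = -(ζ₁ * conj ζ₂).im := by simp; ring
    rw [this, neg_mul_neg]; exact hs
  · rw [neg_mul, neg_mul, neg_im, neg_im]; exact neg_le_neg (hmax ζ hζ)
  · rw [neg_mul, neg_mul, neg_im, neg_im]; exact neg_le_neg (hmin ζ hζ)

/-- The two closed sets cover the circle and are exchanged by `μ ↦ -μ`, so both are nonempty and
connectedness makes them meet. -/
theorem exists_mem_extremalDirections (P : ClosedPair h g E) :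
    ∃ μ, μ ∈ extremalDirections E 1 ∧ μ ∈ extremalDirections E (-1) := by
  have hpre := isPreconnected_closed_iff.1
    (isPreconnected_sphere one_lt_rank_complex (0 : ℂ) 1) _ _
    (P.isClosed_extremalDirections 1) (P.isClosed_extremalDirections (-1))
    (fun μ hμ => P.mem_extremalDirections_or (mem_sphere_zero_iff_norm.1 hμ))
  have h1 : (1 : ℂ) ∈ sphere (0 : ℂ) 1 := by simp
  have h1' : (-1 : ℂ) ∈ sphere (0 : ℂ) 1 := by simp
  have : ∃ μ ∈ sphere (0 : ℂ) 1, -μ ∈ sphere (0 : ℂ) 1 ∧ μ ∈ extremalDirections E 1 := by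
    rcases P.mem_extremalDirections_or (μ := 1) (by simp) with h | h
    · exact ⟨1, h1, h1', h⟩
    · exact ⟨-1, h1', by simp, by simpa using neg_mem_extremalDirections h⟩
  obtain ⟨μ, hμ, hμ', hm⟩ := this
  obtain ⟨ν, -, hν⟩ := hpre ⟨μ, hμ, hm⟩ ⟨-μ, hμ', neg_mem_extremalDirections hm⟩
  exact ⟨ν, hν⟩

theorem exists_angles {ζ ξ : ℂ} (hζ : ‖ζ‖ = 1) (hξ : ‖ξ‖ = 1) (h : 0 < (ζ * conj ξ).im) :
    ∃ m α : ℝ, 0 < α ∧ α < Real.pi / 2 ∧ ζ = exp ((m + α : ℝ) * I) ∧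
      ξ = exp ((m - α : ℝ) * I) := by
  obtain ⟨b, -, rfl⟩ := exists_exp_eq hξ 0
  obtain ⟨a, ha, rfl⟩ := exists_exp_eq hζ b
  have e : exp (a * I) * conj (exp (b * I)) = exp ((a - b : ℝ) * I) := by
    rw [← Complex.exp_conj, ← Complex.exp_add]
    congr 1
    simp; ring
  rw [e, exp_ofReal_mul_I_im] at h
  have h1 : b < a := ha.1.lt_of_ne (by rintro rfl; simp at h)
  have h2 : a - b < Real.pi := by
    by_contra! hc
    have := Real.sin_nonneg_of_nonneg_of_le_pi (x := a - b - Real.pi) (by linarith)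
      (by linarith [ha.2])
    rw [Real.sin_sub_pi] at this
    linarith
  exact ⟨(a + b) / 2, (a - b) / 2, by linarith, by linarith, by congr 2; push_cast; ring,
    by congr 2; push_cast; ring⟩

/-- Vanishing would make the chords `ζ₁ - ζ₂` and `ξ₂ - ξ₁` point the same way, so the two pairs
would be symmetric about one direction `m`, with half-angles `α` and `β`. If these differ, the two
minima and two maxima alternate; if they agree, a minimum is also a maximum. -/
theorem combination_ne_zero (P : ClosedPair h g E) {μ ζ₁ ζ₂ ξ₁ ξ₂ : ℂ} (hμ : ‖μ‖ = 1)
    (h₁ : ‖ζ₁‖ = 1) (h₂ : ‖ζ₂‖ = 1)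
    (hmin : ∀ ζ : ℂ, ‖ζ‖ = 1 → (μ * E ζ₁).im ≤ (μ * E ζ).im)
    (hmax : ∀ ζ : ℂ, ‖ζ‖ = 1 → (μ * E ζ).im ≤ (μ * E ζ₂).im)
    (k₁ : ‖ξ₁‖ = 1) (k₂ : ‖ξ₂‖ = 1)
    (kmin : ∀ ζ : ℂ, ‖ζ‖ = 1 → (μ * E ξ₁).im ≤ (μ * E ζ).im)
    (kmax : ∀ ζ : ℂ, ‖ζ‖ = 1 → (μ * E ζ).im ≤ (μ * E ξ₂).im)
    (hC : 0 < (ζ₁ * conj ζ₂).im) (kC : 0 < (ξ₂ * conj ξ₁).im) {s t : ℝ} (hs : 0 < s)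
    (ht : 0 < t) : s * (ζ₁ - ζ₂) + t * (ξ₁ - ξ₂) ≠ 0 := by
  have hlt : (μ * E ζ₁).im < (μ * E ζ₂).im := by
    obtain ⟨ζ, hζ, hne⟩ := P.nonconst_of_sphere hμ (μ * E ζ₁).im
    exact ((hmin ζ hζ).lt_of_ne' hne).trans_le (hmax ζ hζ)
  have e1 : (μ * E ξ₁).im = (μ * E ζ₁).im := le_antisymm (kmin _ h₁) (hmin _ k₁)
  have e2 : (μ * E ξ₂).im = (μ * E ζ₂).im := le_antisymm (hmax _ k₂) (kmax _ h₂)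
  obtain ⟨c, hc1, hc2⟩ := exists_between hlt
  clear hmin hmax kmin kmax
  obtain ⟨m, α, hα, hα', rfl, rfl⟩ := exists_angles h₁ h₂ hC
  obtain ⟨m', β, hβ, hβ', rfl, rfl⟩ := exists_angles k₂ k₁ kC
  intro h0
  have hsα : 0 < Real.sin α := Real.sin_pos_of_pos_of_lt_pi hα (by linarith)
  have hsβ : 0 < Real.sin β := Real.sin_pos_of_pos_of_lt_pi hβ (by linarith)
  have d1 := exp_sub_exp_mul_I (m + α) (m - α)
  have d2 := exp_sub_exp_mul_I (m' + β) (m' - β)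
  rw [show (m + α - (m - α)) / 2 = α by ring, show (m + α + (m - α)) / 2 = m by ring] at d1
  rw [show (m' + β - (m' - β)) / 2 = β by ring, show (m' + β + (m' - β)) / 2 = m' by ring] at d2
  have h3 : ((s * Real.sin α : ℝ) : ℂ) * exp (m * I) = (t * Real.sin β : ℝ) * exp (m' * I) := by
    have hI : (2 * I : ℂ) ≠ 0 := by simp
    refine mul_left_cancel₀ hI ?_
    push_cast
    push_cast at d1 d2 h0
    linear_combination h0 - s * d1 + t * d2
  have h4 : s * Real.sin α = t * Real.sin β := by
    have := congrArg norm h3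
    rwa [norm_mul, norm_mul, norm_exp_ofReal_mul_I, norm_exp_ofReal_mul_I, mul_one, mul_one,
      norm_real, norm_real, Real.norm_of_nonneg (mul_pos hs hsα).le,
      Real.norm_of_nonneg (mul_pos ht hsβ).le] at this
  have h5 : exp (m * I) = exp (m' * I) := by
    rw [h4] at h3
    exact mul_left_cancel₀ (ofReal_ne_zero.2 (mul_pos ht hsβ).ne') h3
  have h6 : ∀ x : ℝ, exp ((m' + x : ℝ) * I) = exp ((m + x : ℝ) * I) := fun x => by
    push_cast
    rw [add_mul, add_mul, Complex.exp_add, Complex.exp_add, h5]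
  have h7 := h6 β
  have h8 := h6 (-β)
  rw [← sub_eq_add_neg, ← sub_eq_add_neg] at h8
  rw [h7] at e2
  rw [h8] at e1
  rcases lt_trichotomy β α with hlt' | rfl | hlt'
  · exact P.not_alternating (μ := μ) (c := c) (θ₁ := m - α) (θ₂ := m - β) (θ₃ := m + β)
      (θ₄ := m + α) (by linarith) (by linarith) (by linarith) (by linarith) hc2
      (by rwa [e1]) (by rwa [e2]) hc1
  · rw [e2] at hlt
    exact lt_irrefl _ hlt
  · refine P.not_alternating (μ := μ) (c := c) (θ₁ := m - α) (θ₂ := m + α) (θ₃ := m + β)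
      (θ₄ := m - β + 2 * Real.pi) (by linarith) (by linarith) (by linarith) (by linarith) hc2
      hc1 (by rwa [e2]) ?_
    rw [exp_add_two_pi_mul_I, e1]
    exact hc1

theorem exists_re_nonneg (P : ClosedPair h g E) : ∃ μ p : ℂ, ‖μ‖ = 1 ∧ ‖p‖ = 1 ∧
    ∀ z ∈ ball (0 : ℂ) 1,
      0 ≤ ((μ * deriv h z - conj μ * deriv g z) * (p + conj p * z ^ 2)).re := by
  obtain ⟨μ, ⟨hμ, ζ₁, ζ₂, h₁, h₂, hs, hmin, hmax⟩, -, ξ₁, ξ₂, k₁, k₂, ks, kmin, kmax⟩ :=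
    P.exists_mem_extremalDirections
  suffices H : ∃ p : ℂ, p ≠ 0 ∧ ∀ z ∈ ball (0 : ℂ) 1,
      0 ≤ ((μ * deriv h z - conj μ * deriv g z) * (p + conj p * z ^ 2)).re by
    obtain ⟨p, hp, H⟩ := H
    have hn : 0 < ‖p‖ := norm_pos_iff.2 hp
    refine ⟨μ, ((‖p‖⁻¹ : ℝ) : ℂ) * p, hμ, ?_, fun z hz => ?_⟩
    · rw [norm_mul, norm_real, norm_inv, norm_norm, inv_mul_cancel₀ hn.ne']
    · have : (μ * deriv h z - conj μ * deriv g z) * (((‖p‖⁻¹ : ℝ) : ℂ) * p +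
          conj (((‖p‖⁻¹ : ℝ) : ℂ) * p) * z ^ 2) = ((‖p‖⁻¹ : ℝ) : ℂ) *
          ((μ * deriv h z - conj μ * deriv g z) * (p + conj p * z ^ 2)) := by
        rw [map_mul, conj_ofReal]; ring
      rw [this, re_ofReal_mul]
      exact mul_nonneg (by positivity) (H z hz)
  obtain ⟨ζ, hζ, hne⟩ := P.nonconst_of_sphere hμ (μ * E ζ₁).im
  have hlt : (μ * E ζ₁).im < (μ * E ζ).im := (hmin ζ hζ).lt_of_ne' hne
  have hne1 : ζ₁ ≠ ζ₂ := by
    rintro rfl; exact absurd (hmax ζ hζ) (not_le.2 hlt)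
  have hne2 : ξ₁ ≠ ξ₂ := by
    rintro rfl
    exact absurd ((kmax ζ hζ).trans (kmin ζ₁ h₁)) (not_le.2 hlt)
  have r1 := fun z (hz : z ∈ ball (0 : ℂ) 1) => P.re_deriv_shear_nonneg h₁ h₂ hne1 hmin hmax hz
  have r2 := fun z (hz : z ∈ ball (0 : ℂ) 1) => P.re_deriv_shear_nonneg k₁ k₂ hne2 kmin kmax hz
  rw [one_mul] at hs
  rcases hs.eq_or_lt' with hs0 | hs0
  · refine ⟨I * (ζ₁ - ζ₂), mul_ne_zero I_ne_zero (sub_ne_zero.2 hne1), fun z hz => ?_⟩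
    simpa [hs0] using r1 z hz
  rcases ks.eq_or_lt' with ks0 | ks0
  · refine ⟨I * (ξ₁ - ξ₂), mul_ne_zero I_ne_zero (sub_ne_zero.2 hne2), fun z hz => ?_⟩
    have : (ξ₁ * conj ξ₂).im = 0 := by linarith
    simpa [this] using r2 z hz
  have hC : (ξ₂ * conj ξ₁).im = -1 * (ξ₁ * conj ξ₂).im := by simp; ring
  have := P.combination_ne_zero hμ h₁ h₂ hmin hmax k₁ k₂ kmin kmax hs0 (by rwa [hC]) ks0 hs0
  -- The weights are the absolute values of the opposite linear coefficients, halved, so these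
  -- coefficients cancel.
  refine ⟨I * (((-1 * (ξ₁ * conj ξ₂).im : ℝ) : ℂ) * (ζ₁ - ζ₂) +
    (ζ₁ * conj ζ₂).im * (ξ₁ - ξ₂)), mul_ne_zero I_ne_zero this, fun z hz => ?_⟩
  have e := add_nonneg (mul_nonneg ks0.le (r1 z hz)) (mul_nonneg hs0.le (r2 z hz))
  rw [← re_ofReal_mul, ← re_ofReal_mul, ← add_re] at e
  refine e.trans_eq (congrArg Complex.re ?_)
  simp only [map_mul, map_add, conj_ofReal, conj_I]
  push_cast
  ring

end ClosedPair

/-! ### Exhaustion of a convex harmonic map and passage to the limit -/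

theorem deriv_mul_deriv_of_leftInvOn {φ ψ : ℂ → ℂ} {U V : Set ℂ} (hU : IsOpen U) (hV : IsOpen V)
    (hφ : DifferentiableOn ℂ φ U) (hψ : DifferentiableOn ℂ ψ V) (hm : MapsTo φ U V)
    (h : ∀ z ∈ U, ψ (φ z) = z) {z : ℂ} (hz : z ∈ U) : deriv ψ (φ z) * deriv φ z = 1 := by
  have h1 := (hφ.differentiableAt (hU.mem_nhds hz)).hasDerivAt
  have h2 := (hψ.differentiableAt (hV.mem_nhds (hm hz))).hasDerivAt
  have h3 : HasDerivAt (fun z => ψ (φ z)) 1 z := by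
    refine (hasDerivAt_id z).congr_of_eventuallyEq ?_
    filter_upwards [hU.mem_nhds hz] with w hw using h w hw
  exact (h2.comp z h1).unique h3

theorem isSimplyConnected_of_convex {Ω U : Set ℂ} (hΩ : Convex ℝ Ω) (hne : Ω.Nonempty)
    {f k : ℂ → ℂ} (hf : ContinuousOn f U) (hk : ContinuousOn k Ω) (hfm : MapsTo f U Ω)
    (hkm : MapsTo k Ω U) (hkf : ∀ z ∈ U, k (f z) = z) (hfk : ∀ w ∈ Ω, f (k w) = w) :
    IsSimplyConnected U := by
  have : ContractibleSpace Ω := hΩ.contractibleSpace hne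
  let e : U ≃ₜ Ω :=
    { toFun := hfm.restrict f U Ω
      invFun := hkm.restrict k Ω U
      left_inv := fun z => Subtype.ext (hkf z z.2)
      right_inv := fun w => Subtype.ext (hfk w w.2)
      continuous_toFun := hf.mapsToRestrict hfm
      continuous_invFun := hk.mapsToRestrict hkm }
  exact e.toHomotopyEquiv.simplyConnectedSpace

namespace ConvexPair

variable {h g : ℂ → ℂ}

theorem deriv_comp {u σ : ℂ → ℂ} (hu : DifferentiableOn ℂ u (ball 0 1))
    (hσ : DifferentiableOn ℂ σ (ball 0 1)) (hm : MapsTo σ (ball 0 1) (ball 0 1)) {z : ℂ}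
    (hz : z ∈ ball (0 : ℂ) 1) : deriv (fun z => u (σ z)) z = deriv u (σ z) * deriv σ z :=
  ((hu.differentiableAt (isOpen_ball.mem_nhds (hm hz))).hasDerivAt.comp z
    (hσ.differentiableAt (isOpen_ball.mem_nhds hz)).hasDerivAt).deriv

theorem comp (P : ConvexPair h g) {σ : ℂ → ℂ} (hσ : DifferentiableOn ℂ σ (ball 0 1))
    (hm : MapsTo σ (ball 0 1) (ball 0 1)) (hi : InjOn σ (ball 0 1))
    (hd : ∀ z ∈ ball (0 : ℂ) 1, deriv σ z ≠ 0)
    (hc : Convex ℝ (hmap h g '' (σ '' ball 0 1))) :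
    ConvexPair (fun z => h (σ z)) (fun z => g (σ z)) where
  diff_h := P.diff_h.comp hσ hm
  diff_g := P.diff_g.comp hσ hm
  injOn := P.injOn.comp hi hm
  deriv_lt z hz := by
    rw [deriv_comp P.diff_h hσ hm hz, deriv_comp P.diff_g hσ hm hz, norm_mul, norm_mul]
    exact mul_lt_mul_of_pos_right (P.deriv_lt _ (hm hz)) (norm_pos_iff.2 (hd z hz))
  convex := by
    rw [image_image] at hc
    exact hc

/-- Exhaustion by convex harmonic maps which extend to the closed disk. -/
theorem exists_closedPair (P : ConvexPair h g) {r : ℝ} (hr : 0 < r) (hr1 : r < 1) :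
    ∃ φ E : ℂ → ℂ, DifferentiableOn ℂ φ (ball 0 1) ∧ MapsTo φ (ball 0 1) (ball 0 1) ∧ φ 0 = 0 ∧
      r ≤ ‖deriv φ 0‖ ∧ ClosedPair (fun z => h (φ z)) (fun z => g (φ z)) E := by
  set Ω := hmap h g '' ball 0 1 with hΩ
  have hrb : closedBall (0 : ℂ) r ⊆ ball 0 1 := closedBall_subset_ball hr1
  set K := convexHull ℝ (hmap h g '' closedBall 0 r) with hK
  have hKi : IsCompact (hmap h g '' closedBall 0 r) :=
    (isCompact_closedBall (0 : ℂ) r).image_of_continuousOn (P.continuousOn.mono hrb)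
  have hKb : Bornology.IsBounded K := isBounded_convexHull.2 hKi.isBounded
  obtain ⟨δ, hδ, hδΩ⟩ : ∃ δ, 0 < δ ∧ cthickening δ K ⊆ hmap h g '' ball 0 1 := by
    obtain ⟨η, hη, hηΩ⟩ := hKi.exists_thickening_subset_open P.isOpen_image (image_mono hrb)
    refine ⟨η / 2, half_pos hη,
      (cthickening_subset_thickening' hη (half_lt_self hη) K).trans ?_⟩
    -- The sum of a convex hull and a ball is the convex hull of the sum, so it stays in the convex
    -- range as soon as the thickened compact image does.
    rw [← add_ball_zero, hK, ← (convex_ball (0 : ℂ) η).convexHull_eq, ← convexHull_add,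
      add_ball_zero]
    exact convexHull_min hηΩ P.convex
  set Ω' := thickening δ K with hΩ'
  have hΩ'c : Convex ℝ Ω' := (convex_convexHull ℝ _).thickening δ
  have hΩ'o : IsOpen Ω' := isOpen_thickening
  have hΩ'b : Bornology.IsBounded Ω' := hKb.thickening
  have hct : Ω' ⊆ cthickening δ K := thickening_subset_cthickening δ K
  have hsub : Ω' ⊆ Ω := hct.trans hδΩ
  have hKΩ' : K ⊆ Ω' := self_subset_thickening hδ K
  set U := ball (0 : ℂ) 1 ∩ hmap h g ⁻¹' Ω' with hU
  have hUo : IsOpen U := P.continuousOn.isOpen_inter_preimage isOpen_ball hΩ'o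
  have hUb : U ⊆ ball 0 1 := inter_subset_left
  have hrU : closedBall 0 r ⊆ U := fun z hz =>
    ⟨hrb hz, hKΩ' (subset_convexHull ℝ _ (mem_image_of_mem _ hz))⟩
  have h0U : (0 : ℂ) ∈ U := hrU (mem_closedBall_self hr.le)
  have hinvm : MapsTo (inv h g) Ω' U := fun w hw =>
    ⟨inv_mem (hsub hw), by rw [mem_preimage, hmap_inv (hsub hw)]; exact hw⟩
  have hUs : IsSimplyConnected U := isSimplyConnected_of_convex hΩ'c ⟨_, h0U.2⟩
    (P.continuousOn.mono hUb) (P.continuousOn_inv.mono hsub) (fun z hz => hz.2) hinvm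
    (fun z hz => P.inv_hmap hz.1) (fun w hw => hmap_inv (hsub hw))
  obtain ⟨φ, ψ, hφd, hψd, hφm, hψm, hψφ, hφψ, hφ0⟩ := exists_riemann_map hUo hUs hUb h0U
  have hφb : MapsTo φ (ball 0 1) (ball 0 1) := hφm.mono_right hUb
  have hφi : InjOn φ (ball 0 1) := fun z hz w hw hzw => by
    rw [← hψφ z hz, ← hψφ w hw, hzw]
  have hdd : ∀ z ∈ ball (0 : ℂ) 1, deriv ψ (φ z) * deriv φ z = 1 := fun z hz =>
    deriv_mul_deriv_of_leftInvOn isOpen_ball hUo hφd hψd hφm hψφ hz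
  have hφU : φ '' ball 0 1 = U :=
    Subset.antisymm hφm.image_subset fun w hw => ⟨ψ w, hψm hw, hφψ w hw⟩
  have hfU : hmap h g '' U = Ω' := by
    refine Subset.antisymm (image_subset_iff.2 fun z hz => hz.2) fun w hw => ?_
    exact ⟨inv h g w, hinvm hw, hmap_inv (hsub hw)⟩
  have Q : ConvexPair (fun z => h (φ z)) (fun z => g (φ z)) :=
    P.comp hφd hφb hφi (fun z hz => right_ne_zero_of_mul_eq_one (hdd z hz))
      (by rw [hφU, hfU]; exact hΩ'c)
  have h0 : (0 : ℂ) ∈ ball (0 : ℂ) 1 := mem_ball_self one_pos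
  have hψ0 : ψ 0 = 0 := by rw [← hφ0, hψφ 0 h0, hφ0]
  -- The domain `U` contains the disk of radius `r`, so the Schwarz lemma bounds the derivative of
  -- the inverse `ψ` at `0` by `1 / r`.
  have hder : r ≤ ‖deriv φ 0‖ := by
    have h1 := norm_deriv_le_div_of_mapsTo_ball (f := ψ) (c := 0) (R₁ := r) (R₂ := 1)
      (hψd.mono (ball_subset_closedBall.trans hrU))
      (fun z hz => by
        rw [hψ0]; exact ball_subset_closedBall (hψm (hrU (ball_subset_closedBall hz)))) hr
    have h2 := hdd 0 h0
    rw [hφ0] at h2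
    have h3 : ‖deriv ψ 0‖ * ‖deriv φ 0‖ = 1 := by rw [← norm_mul, h2, norm_one]
    rw [le_div_iff₀ hr] at h1
    nlinarith [norm_nonneg (deriv φ 0), norm_nonneg (deriv ψ 0)]
  set f₁ := hmap (fun z => h (φ z)) (fun z => g (φ z)) with hf₁
  have hf₁e : ∀ z, f₁ z = hmap h g (φ z) := fun z => rfl
  set C := inv h g '' cthickening δ K with hC
  have hCc : IsCompact C :=
    (isCompact_of_isClosed_isBounded isClosed_cthickening
      hKb.cthickening).image_of_continuousOn (P.continuousOn_inv.mono hδΩ)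
  have hCb : C ⊆ ball 0 1 := image_subset_iff.2 fun w hw => inv_mem (hδΩ hw)
  have hUC : U ⊆ C := fun z hz => ⟨hmap h g z, hct hz.2, P.inv_hmap hz.1⟩
  -- The harmonic map is uniformly continuous on the compact set `C`, which contains `U`. Small
  -- crosscut images under `φ` therefore remain small after composition with it.
  have huc := hCc.uniformContinuousOn_of_continuous (P.continuousOn.mono hCb)
  have hlim : ∀ ζ ∈ closedBall (0 : ℂ) 1, ∃ y, Tendsto f₁ (𝓝[ball 0 1] ζ) (𝓝 y) := by
    intro ζ hζ
    rcases (mem_closedBall_zero_iff.1 hζ).lt_or_eq with hlt | heq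
    · exact ⟨_, Q.continuousOn ζ (mem_ball_zero_iff.2 hlt)⟩
    refine exists_tendsto_of_small_crosscut (k := fun w => ψ (inv h g w)) hΩ'c hΩ'o hΩ'b
      (hψd.continuousOn.comp (P.continuousOn_inv.mono hsub) hinvm) (fun z hz => (hφm hz).2)
      (fun w hw => hψm (hinvm hw)) (fun z hz => ?_) (fun w hw => ?_) heq fun ε hε => ?_
    · exact (congrArg ψ (P.inv_hmap (hφb hz))).trans (hψφ z hz)
    · exact (congrArg (hmap h g) (hφψ _ (hinvm hw))).trans (hmap_inv (hsub hw))
    · obtain ⟨η, hη, hηε⟩ := Metric.uniformContinuousOn_iff.1 huc ε hε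
      obtain ⟨ρ, hρ, hcut⟩ := exists_small_crosscut hφd hφi hφb heq (half_pos hη) one_pos
      refine ⟨ρ, hρ, fun z hz w hw hzr hwr => ?_⟩
      rw [← dist_eq_norm]
      refine (hηε _ (hUC (hφm hz)) _ (hUC (hφm hw)) ?_).le
      rw [dist_eq_norm]
      exact (hcut z hz w hw hzr hwr).trans_lt (half_lt_self hη)
  refine ⟨φ, extendFrom (ball 0 1) f₁, hφd, hφb, hφ0, hder, Q, ?_, fun z hz => ?_⟩
  · exact continuousOn_extendFrom (by rw [closure_ball _ one_ne_zero]) hlim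
  · exact extendFrom_eq (subset_closure hz) (Q.continuousOn z hz)

/-- The maps `φ n` fix `0` and satisfy `‖deriv (φ n) 0‖ ≥ 1 - 1 / (n + 2)`. A limit therefore has
derivative of modulus one at `0` and is a rotation by the Schwarz lemma. The directions converge
along the same ultrafilter, and the rotation is absorbed into `p`. -/
theorem exists_re_nonneg (P : ConvexPair h g) : ∃ μ p : ℂ, ‖μ‖ = 1 ∧ ‖p‖ = 1 ∧
    ∀ z ∈ ball (0 : ℂ) 1,
      0 ≤ ((μ * deriv h z - conj μ * deriv g z) * (p + conj p * z ^ 2)).re := by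
  have hex : ∀ n : ℕ, ∃ φ : ℂ → ℂ, ∃ μ p : ℂ, DifferentiableOn ℂ φ (ball 0 1) ∧
      MapsTo φ (ball 0 1) (ball 0 1) ∧ φ 0 = 0 ∧ 1 - 1 / ((n : ℝ) + 2) ≤ ‖deriv φ 0‖ ∧ ‖μ‖ = 1 ∧
      ‖p‖ = 1 ∧ ∀ z ∈ ball (0 : ℂ) 1, 0 ≤ ((μ * deriv h (φ z) - conj μ * deriv g (φ z)) *
        deriv φ z * (p + conj p * z ^ 2)).re := fun n => by
    have hn : (0 : ℝ) < n + 2 := by positivity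
    obtain ⟨φ, E, hφd, hφm, hφ0, hr, Q⟩ := P.exists_closedPair (r := 1 - 1 / ((n : ℝ) + 2))
      (by rw [sub_pos, div_lt_one hn]; linarith [(Nat.cast_nonneg n : (0 : ℝ) ≤ n)])
      (by linarith [div_pos one_pos hn])
    obtain ⟨μ, p, hμ, hp, H⟩ := Q.exists_re_nonneg
    refine ⟨φ, μ, p, hφd, hφm, hφ0, hr, hμ, hp, fun z hz => ?_⟩
    have := H z hz
    rw [deriv_comp P.diff_h hφd hφm hz, deriv_comp P.diff_g hφd hφm hz] at this
    refine this.trans_eq (congrArg Complex.re ?_)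
    ring
  choose φ μ p hφd hφm hφ0 hr hμ hp H using hex
  let l : Ultrafilter ℕ := hyperfilter ℕ
  have hl : (l : Filter ℕ) ≤ atTop := by
    rw [← Nat.cofinite_eq_atTop]; exact hyperfilter_le_cofinite
  obtain ⟨Φ, hΦ, hΦm⟩ := exists_tendstoLocallyUniformlyOn l isOpen_ball hφd
    (fun n => (hφm n).mono_right ball_subset_closedBall)
  have hΦd : DifferentiableOn ℂ Φ (ball 0 1) :=
    hΦ.differentiableOn (Eventually.of_forall hφd) isOpen_ball
  have hΦ' := hΦ.deriv (Eventually.of_forall hφd) isOpen_ball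
  have h0 : (0 : ℂ) ∈ ball (0 : ℂ) 1 := mem_ball_self one_pos
  have hΦ0 : Φ 0 = 0 := by
    have := hΦ.tendsto_at h0
    simp only [hφ0] at this
    exact (tendsto_nhds_unique this tendsto_const_nhds)
  have hge : 1 ≤ ‖deriv Φ 0‖ := by
    have h1 := (hΦ'.tendsto_at h0).norm
    have h2 : Tendsto (fun n : ℕ => 1 - 1 / ((n : ℝ) + 2)) l (𝓝 (1 - 0)) := by
      refine (tendsto_const_nhds.sub (tendsto_const_nhds.div_atTop ?_)).mono_left hl
      exact tendsto_atTop_add_const_right _ _ tendsto_natCast_atTop_atTop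
    rw [sub_zero] at h2
    exact le_of_tendsto_of_tendsto' h2 h1 hr
  have hΦm' : MapsTo Φ (ball 0 1) (closedBall (Φ 0) 1) := by rwa [hΦ0]
  have hc1 : ‖deriv Φ 0‖ = 1 := le_antisymm (by
    simpa using norm_deriv_le_div_of_mapsTo_ball hΦd hΦm' one_pos) hge
  have haff := affine_of_mapsTo_ball_of_norm_dslope_eq_div hΦd hΦm' h0
    (by rw [dslope_same, hc1, div_one])
  rw [dslope_same] at haff
  set c := deriv Φ 0
  have hΦc : ∀ z ∈ ball (0 : ℂ) 1, Φ z = c * z := fun z hz => by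
    rw [haff hz, hΦ0]; simp [mul_comm]
  have hΦ'c : ∀ z ∈ ball (0 : ℂ) 1, deriv Φ z = c := fun z hz => by
    have : HasDerivAt Φ (c * 1) z := ((hasDerivAt_id z).const_mul c).congr_of_eventuallyEq
      (by filter_upwards [isOpen_ball.mem_nhds hz] with w hw using hΦc w hw)
    rw [this.deriv, mul_one]
  have hsph := isCompact_sphere (0 : ℂ) 1
  obtain ⟨ν, hν, hμν⟩ := hsph.ultrafilter_le_nhds (l.map μ) (by
    rw [le_principal_iff, Ultrafilter.mem_coe, Ultrafilter.mem_map]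
    exact univ_mem' fun n => mem_sphere_zero_iff_norm.2 (hμ n))
  obtain ⟨q, hq, hpq⟩ := hsph.ultrafilter_le_nhds (l.map p) (by
    rw [le_principal_iff, Ultrafilter.mem_coe, Ultrafilter.mem_map]
    exact univ_mem' fun n => mem_sphere_zero_iff_norm.2 (hp n))
  have hμν' : Tendsto μ l (𝓝 ν) := hμν
  have hpq' : Tendsto p l (𝓝 q) := hpq
  rw [mem_sphere_zero_iff_norm] at hν hq
  have hcc : conj c * c = 1 := by
    rw [mul_comm, mul_conj, normSq_eq_norm_sq, hc1]; simp
  refine ⟨ν, c * q, hν, by rw [norm_mul, hc1, hq, one_mul], fun u hu => ?_⟩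
  have hz : conj c * u ∈ ball (0 : ℂ) 1 := by
    rw [mem_ball_zero_iff, norm_mul, RCLike.norm_conj, hc1, one_mul]
    exact mem_ball_zero_iff.1 hu
  have hzu : Φ (conj c * u) = u := by
    rw [hΦc _ hz, ← mul_assoc, mul_comm c, hcc, one_mul]
  have t1 : Tendsto (fun n => φ n (conj c * u)) l (𝓝 u) := by
    have := hΦ.tendsto_at hz
    rwa [hzu] at this
  have hcont : ∀ v : ℂ → ℂ, DifferentiableOn ℂ v (ball 0 1) →
      Tendsto (fun n => deriv v (φ n (conj c * u))) l (𝓝 (deriv v u)) := fun v hv =>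
    ((hv.deriv isOpen_ball).continuousOn.continuousAt (isOpen_ball.mem_nhds hu)).tendsto.comp t1
  have t2 := hΦ'.tendsto_at hz
  rw [hΦ'c _ hz] at t2
  have hconj : ∀ {x : ℕ → ℂ} {y : ℂ}, Tendsto x l (𝓝 y) →
      Tendsto (fun n => conj (x n)) l (𝓝 (conj y)) := fun hx =>
    (continuous_conj.tendsto _).comp hx
  have t3 := (((hμν'.mul (hcont h P.diff_h)).sub
    ((hconj hμν').mul (hcont g P.diff_g))).mul t2).mul
    (hpq'.add ((hconj hpq').mul (tendsto_const_nhds (x := (conj c * u) ^ 2))))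
  have t4 := ge_of_tendsto' ((continuous_re.tendsto _).comp t3) fun n => H n _ hz
  refine t4.trans_eq (congrArg Complex.re ?_)
  rw [map_mul]
  linear_combination (ν * deriv h u - conj ν * deriv g u) * conj q * conj c * u ^ 2 * hcc

theorem comp_mob (P : ConvexPair h g) {a : ℂ} (ha : ‖a‖ < 1) :
    ConvexPair (fun z => h (mob a z)) (fun z => g (mob a z)) := by
  have hd : ∀ z ∈ ball (0 : ℂ) 1, HasDerivAt (mob a) ((1 - ‖a‖ ^ 2) / (1 - conj a * z) ^ 2) z :=
    fun z hz => hasDerivAt_mob ha (mem_ball_zero_iff.1 hz)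
  refine P.comp (fun z hz => (hd z hz).differentiableAt.differentiableWithinAt) (mapsTo_mob ha)
    (injOn_mob ha) (fun z hz => ?_) (by rw [image_mob ha]; exact P.convex)
  rw [(hd z hz).deriv]
  refine div_ne_zero ?_ (pow_ne_zero 2
    (one_sub_conj_mul_ne_zero ha (mem_ball_zero_iff.1 hz).le))
  have : (1 - ‖a‖ ^ 2 : ℝ) ≠ 0 := by nlinarith [norm_nonneg a]
  exact_mod_cast this

/-- Every interior point `a` of the disk yields a direction of positivity. -/
theorem exists_re_nonneg_at (P : ConvexPair h g) {a : ℂ} (ha : ‖a‖ < 1) :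
    ∃ μ p : ℂ, ‖μ‖ = 1 ∧ ‖p‖ = 1 ∧ ∀ u ∈ ball (0 : ℂ) 1,
      0 ≤ ((μ * deriv h u - conj μ * deriv g u) *
        (p * (1 - conj a * u) ^ 2 + conj p * (u - a) ^ 2)).re := by
  have ha' : ‖-a‖ < 1 := by rwa [norm_neg]
  obtain ⟨μ, p, hμ, hp, H⟩ := (P.comp_mob ha').exists_re_nonneg
  refine ⟨μ, p, hμ, hp, fun u hu => ?_⟩
  have hu1 := mem_ball_zero_iff.1 hu
  have hz := mapsTo_mob ha hu
  have hz1 := mem_ball_zero_iff.1 hz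
  have hd : DifferentiableOn ℂ (mob (-a)) (ball 0 1) := fun z hz =>
    (hasDerivAt_mob ha' (mem_ball_zero_iff.1 hz)).differentiableAt.differentiableWithinAt
  have := H _ hz
  rw [deriv_comp P.diff_h hd (mapsTo_mob ha') hz, deriv_comp P.diff_g hd (mapsTo_mob ha') hz,
    mob_neg_mob ha hu1, (hasDerivAt_mob ha' hz1).deriv] at this
  have hpos : (0 : ℝ) < 1 - ‖a‖ ^ 2 := by nlinarith [norm_nonneg a]
  have hne := one_sub_conj_mul_ne_zero ha hu1.le
  have hne' := one_sub_conj_mul_ne_zero ha' hz1.le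
  have e2 : mob a u * (1 - conj a * u) = u - a := by rw [mob, div_mul_cancel₀ _ hne]
  have e1 : (1 - conj (-a) * mob a u) * (1 - conj a * u) = ((1 - ‖a‖ ^ 2 : ℝ) : ℂ) := by
    have : conj a * a = ((‖a‖ ^ 2 : ℝ) : ℂ) := by
      rw [mul_comm, mul_conj, normSq_eq_norm_sq]
    push_cast at this ⊢
    rw [map_neg]
    linear_combination conj a * e2 - this
  rw [← mul_nonneg_iff_of_pos_left hpos, ← re_ofReal_mul] at this
  refine this.trans_eq (congrArg Complex.re ?_)
  rw [norm_neg]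
  -- Up to the positive factor `1 - ‖a‖²`, the derivative of the automorphism is `(1 - conj a u)²`,
  -- which clears the denominator of `mob a u ^ 2`.
  have hN : ((1 - ‖a‖ ^ 2 : ℝ) : ℂ) * (((1 : ℂ) - ‖a‖ ^ 2) / (1 - conj (-a) * mob a u) ^ 2) =
      (1 - conj a * u) ^ 2 := by
    have : ((1 : ℂ) - ‖a‖ ^ 2) = ((1 - ‖a‖ ^ 2 : ℝ) : ℂ) := by push_cast; ring
    rw [this, ← e1]
    field_simp
  linear_combination (μ * deriv h u - conj μ * deriv g u) * (p + conj p * mob a u ^ 2) * hN +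
    (μ * deriv h u - conj μ * deriv g u) * conj p * (mob a u * (1 - conj a * u) + (u - a)) * e2

end ConvexPair

/-! ### Functions with nonnegative real part and rigidity in the Schwarz lemma -/

theorem norm_sub_le_norm_add_conj {q b : ℂ} (hq : 0 ≤ q.re) (hb : 0 ≤ b.re) :
    ‖q - b‖ ≤ ‖q + conj b‖ := by
  refine le_of_sq_le_sq ?_ (norm_nonneg _)
  rw [← normSq_eq_norm_sq, ← normSq_eq_norm_sq, normSq_apply, normSq_apply]
  simp
  nlinarith [mul_nonneg hq hb]

/-- The Schwarz-Pick inequality for a function with nonnegative real part. -/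
theorem norm_sub_le_of_re_nonneg {q : ℂ → ℂ} (hq : DifferentiableOn ℂ q (ball 0 1))
    (hre : ∀ z ∈ ball (0 : ℂ) 1, 0 ≤ (q z).re) {z : ℂ} (hz : z ∈ ball (0 : ℂ) 1) :
    ‖q z - q 0‖ ≤ ‖z‖ * ‖q z + conj (q 0)‖ := by
  have h0 : (0 : ℂ) ∈ ball (0 : ℂ) 1 := mem_ball_self one_pos
  -- The real part is only nonnegative, so `q + conj (q 0)` may vanish; adding `ε` keeps the Cayley
  -- transform defined.
  refine le_of_forall_pos_le_add fun ε hε => ?_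
  have hne : ∀ u ∈ ball (0 : ℂ) 1, q u + conj (q 0) + ε ≠ 0 := fun u hu h => by
    have := congrArg Complex.re h
    simp at this
    linarith [hre u hu, hre 0 h0]
  have hW : ‖(q z - q 0) / (q z + conj (q 0) + ε)‖ ≤ ‖z‖ := by
    refine norm_le_norm_of_mapsTo_ball (R := 1)
      (f := fun u => (q u - q 0) / (q u + conj (q 0) + ε)) ?_ (fun u hu => ?_) (by simp)
      (mem_ball_zero_iff.1 hz)
    · exact (hq.sub_const _).div ((hq.add_const _).add_const _) hne
    · rw [mem_closedBall_zero_iff, norm_div, div_le_one (norm_pos_iff.2 (hne u hu))]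
      have e1 : q u - q 0 = (q u + (ε / 2 : ℝ)) - (q 0 + (ε / 2 : ℝ)) := by ring
      have e2 : q u + conj (q 0) + ε = (q u + (ε / 2 : ℝ)) + conj (q 0 + (ε / 2 : ℝ)) := by
        rw [map_add, conj_ofReal]; push_cast; ring
      rw [e1, e2]
      refine norm_sub_le_norm_add_conj ?_ ?_
      · rw [add_re, ofReal_re]; linarith [hre u hu]
      · rw [add_re, ofReal_re]; linarith [hre 0 h0]
  rw [norm_div, div_le_iff₀ (norm_pos_iff.2 (hne z hz))] at hW
  have h1 : ‖q z + conj (q 0) + ε‖ ≤ ‖q z + conj (q 0)‖ + ε := by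
    refine (norm_add_le _ _).trans_eq ?_
    rw [norm_real, Real.norm_of_nonneg hε.le]
  have h2 := mem_ball_zero_iff.1 hz
  nlinarith [norm_nonneg z, mul_le_mul_of_nonneg_left h1 (norm_nonneg z)]

/-- The hypothesis at `z` says that the Cayley transform `(q - b) / (q + b)` takes the value `l z`
there, which is equality in the Schwarz lemma. -/
theorem eq_mobius_of_re_nonneg {q : ℂ → ℂ} (hq : DifferentiableOn ℂ q (ball 0 1))
    (hre : ∀ z ∈ ball (0 : ℂ) 1, 0 ≤ (q z).re) {b : ℝ} (hb : 0 < b) (hq0 : q 0 = b) {z l : ℂ}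
    (hz : z ∈ ball (0 : ℂ) 1) (hz0 : z ≠ 0) (hl : ‖l‖ = 1)
    (h : q z * (1 - l * z) = b * (1 + l * z)) {u : ℂ} (hu : u ∈ ball (0 : ℂ) 1) :
    q u * (1 - l * u) = b * (1 + l * u) := by
  have hne : ∀ u ∈ ball (0 : ℂ) 1, q u + b ≠ 0 := fun u hu h => by
    have := congrArg Complex.re h
    simp at this
    linarith [hre u hu]
  set W : ℂ → ℂ := fun u => (q u - b) / (q u + b) with hW
  have hW0 : W 0 = 0 := by simp [hW, hq0]
  have hWz : W z = z * l := by
    rw [hW, div_eq_iff (hne z hz)]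
    linear_combination h
  have haff := affine_of_mapsTo_ball_of_norm_dslope_eq_div (f := W) (c := 0) (R₁ := 1) (R₂ := 1)
    (z₀ := z) ((hq.sub_const _).div (hq.add_const _) hne) (fun u hu => by
      rw [hW0, mem_closedBall_zero_iff, norm_div, div_le_one (norm_pos_iff.2 (hne u hu))]
      simpa using norm_sub_le_norm_add_conj (hre u hu) (b := b) (by simpa using hb.le)) hz
    (by rw [dslope_of_ne _ hz0, slope_def_field, hWz, hW0, sub_zero, sub_zero,
      mul_div_cancel_left₀ _ hz0, hl, div_one])
  have hWu := haff hu
  rw [dslope_of_ne _ hz0, slope_def_field, hWz, hW0, sub_zero, sub_zero,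
      mul_div_cancel_left₀ _ hz0, hW] at hWu
  simp only [zero_add, sub_zero, smul_eq_mul] at hWu
  rw [div_eq_iff (hne u hu)] at hWu
  linear_combination hWu

theorem eq_mul_of_mapsTo_closedBall {w : ℂ → ℂ} {k : ℝ} (hw : DifferentiableOn ℂ w (ball 0 1))
    (hm : MapsTo w (ball 0 1) (closedBall 0 k)) (h0 : w 0 = 0) {z c : ℂ}
    (hz : z ∈ ball (0 : ℂ) 1) (hz0 : z ≠ 0) (hc : ‖c‖ = k) (h : w z = z * c) {u : ℂ}
    (hu : u ∈ ball (0 : ℂ) 1) : w u = u * c := by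
  have haff := affine_of_mapsTo_ball_of_norm_dslope_eq_div (f := w) (c := 0) (R₁ := 1) (R₂ := k)
    (z₀ := z) hw (by rwa [h0]) hz
    (by rw [dslope_of_ne _ hz0, slope_def_field, h, h0, sub_zero, sub_zero,
      mul_div_cancel_left₀ _ hz0, hc, div_one])
  have hwu := haff hu
  rw [dslope_of_ne _ hz0, slope_def_field, h, h0, sub_zero, sub_zero,
      mul_div_cancel_left₀ _ hz0] at hwu
  simpa using hwu

/-- The circle of radius `1 - y` about `1` is tangent at `y` to the disk of radius `|y|` about `0`,
for either sign of `y`. -/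
theorem eq_ofReal_of_norm_one_sub {v : ℂ} {y : ℝ} (hy : y < 1) (hv : ‖v‖ ≤ |y|)
    (h : ‖1 - v‖ = 1 - y) : v = y := by
  have h1 : ‖v‖ ^ 2 ≤ y ^ 2 := by rw [← sq_abs y]; gcongr
  have h2 : ‖1 - v‖ ^ 2 = (1 - y) ^ 2 := by rw [h]
  rw [← normSq_eq_norm_sq, normSq_apply] at h1 h2
  simp at h2
  set d := y ^ 2 - (v.re * v.re + v.im * v.im) with hd
  have hd0 : 0 ≤ d := by linarith
  have ha : v.re = y - d / 2 := by rw [hd]; linarith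
  have hb : v.im * v.im = d * (y - 1 - d / 4) := by
    have : v.im * v.im = y ^ 2 - d - v.re * v.re := by rw [hd]; ring
    rw [this, ha]; ring
  have hd1 : d = 0 := by
    by_contra hne
    have : 0 < d := hd0.lt_of_ne' hne
    nlinarith [mul_self_nonneg v.im, mul_pos this (show 0 < 1 - y + d / 4 by linarith)]
  rw [hd1, zero_mul, mul_self_eq_zero] at hb
  exact Complex.ext (by simp [ha, hd1]) (by simp [hb])

/-- The norm equation turns the chain from `|‖q‖ - ‖b‖|` through `‖q - b‖` and `|x| ‖q + conj b‖` to
`|x| (‖q‖ + ‖b‖)` into equalities. Thus `q` lies on the rays of both `b` and `conj b`, and `b` is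
real. -/
theorem real_of_norm_mul_eq {q b : ℂ} {x : ℝ} (hx1 : -1 < x) (hx2 : x < 1) (hx0 : x ≠ 0)
    (hb : b ≠ 0) (hbr : 0 ≤ b.re) (h : ‖q - b‖ ≤ |x| * ‖q + conj b‖) (hn : ‖q‖ * (1 - x) = ‖b‖ * (1 + x)) :
    0 < b.re ∧ b = (b.re : ℂ) ∧ q * (1 - x) = b * (1 + x) := by
  have hb0 : 0 < ‖b‖ := norm_pos_iff.2 hb
  have hx : 0 < 1 - x := by linarith
  have hq0 : 0 < ‖q‖ := by
    have : 0 < ‖q‖ * (1 - x) := by rw [hn]; exact mul_pos hb0 (by linarith)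
    exact pos_of_mul_pos_left this hx.le
  have h1 : ‖q‖ - ‖b‖ = x * (‖q‖ + ‖b‖) := by linarith
  have h2 : |‖q‖ - ‖b‖| = |x| * (‖q‖ + ‖b‖) := by
    rw [h1, abs_mul, abs_of_pos (by positivity : 0 < ‖q‖ + ‖b‖)]
  have h3 : ‖q + conj b‖ ≤ ‖q‖ + ‖b‖ := by
    simpa using norm_add_le q (conj b)
  have h4 : |‖q‖ - ‖b‖| ≤ ‖q - b‖ := abs_norm_sub_norm_le q b
  have s1 : SameRay ℝ q b := sameRay_iff_norm_sub.2
    (le_antisymm (h.trans (by rw [h2]; gcongr)) h4)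
  have e1 := sameRay_iff_norm_smul_eq.1 s1
  simp only [real_smul] at e1
  have e3 : q * (1 - x) = b * (1 + x) := by
    have hn' : (‖q‖ : ℂ) * (1 - x) = ‖b‖ * (1 + x) := by exact_mod_cast hn
    have hbc : (‖b‖ : ℂ) ≠ 0 := ofReal_ne_zero.2 hb0.ne'
    refine mul_left_cancel₀ hbc ?_
    linear_combination (-(1 - x : ℂ)) * e1 + b * hn'
  have h5 : ‖q‖ + ‖b‖ ≤ ‖q + conj b‖ := by
    rw [h2] at h4
    exact le_of_mul_le_mul_left (h4.trans h) (abs_pos.2 hx0)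
  have s2 : SameRay ℝ q (conj b) := sameRay_iff_norm_add.2
    (le_antisymm (norm_add_le _ _) (by simpa using h5))
  have e2 := sameRay_iff_norm_smul_eq.1 s2
  simp only [real_smul, RCLike.norm_conj] at e2
  have hbb : conj b = b := mul_left_cancel₀ (ofReal_ne_zero.2 hq0.ne') (e2.trans e1.symm)
  have hbre : b = (b.re : ℂ) := (conj_eq_iff_re.1 hbb).symm
  refine ⟨hbr.lt_of_ne' fun h0 => hb ?_, hbre, e3⟩
  rw [hbre, h0, ofReal_zero]

/-! ### The normalized class and the distortion theorem -/

/-- Convex harmonic maps with the normalization `h(0) = 0`, `h'(0) = 1`, `g'(0) = 0` and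
`|g'| ≤ k |h'|`. -/
structure ConvexClass (k : ℝ) (h g : ℂ → ℂ) : Prop extends ConvexPair h g where
  k_lt : k < 1
  h_zero : h 0 = 0
  deriv_h_zero : deriv h 0 = 1
  deriv_g_zero : deriv g 0 = 0
  deriv_le : ∀ z ∈ ball (0 : ℂ) 1, ‖deriv g z‖ ≤ k * ‖deriv h z‖

namespace ConvexClass

variable {k : ℝ} {h g : ℂ → ℂ}

theorem k_nonneg (T : ConvexClass k h g) : 0 ≤ k := by
  simpa [T.deriv_h_zero, T.deriv_g_zero] using T.deriv_le 0 (mem_ball_self one_pos)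

theorem differentiableOn_dilatation (T : ConvexClass k h g) :
    DifferentiableOn ℂ (dilatation h g) (ball 0 1) :=
  (T.diff_g.deriv isOpen_ball).div (T.diff_h.deriv isOpen_ball)
    fun _ hz => T.toConvexPair.deriv_h_ne_zero hz

theorem mapsTo_dilatation (T : ConvexClass k h g) :
    MapsTo (dilatation h g) (ball 0 1) (closedBall 0 k) := fun z hz => by
  rw [mem_closedBall_zero_iff, dilatation, norm_div,
    div_le_iff₀ (norm_pos_iff.2 (T.toConvexPair.deriv_h_ne_zero hz))]
  exact T.deriv_le z hz

theorem dilatation_zero (T : ConvexClass k h g) : dilatation h g 0 = 0 := by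
  rw [dilatation, T.deriv_g_zero, zero_div]

theorem norm_dilatation_le (T : ConvexClass k h g) {z : ℂ} (hz : z ∈ ball (0 : ℂ) 1) :
    ‖dilatation h g z‖ ≤ k * ‖z‖ := by
  have := dist_le_div_mul_dist_of_mapsTo_ball (R₁ := 1) (R₂ := k) (c := 0)
    T.differentiableOn_dilatation (by rw [T.dilatation_zero]; exact T.mapsTo_dilatation) hz
  simpa [T.dilatation_zero] using this

theorem shear_deriv (T : ConvexClass k h g) (μ : ℂ) {z : ℂ} (hz : z ∈ ball (0 : ℂ) 1) :
    μ * deriv h z - conj μ * deriv g z = deriv h z * (μ - conj μ * dilatation h g z) := by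
  have := T.toConvexPair.deriv_h_ne_zero hz
  rw [dilatation]
  field_simp

/-- At every point the shear times a suitable quadratic polynomial has nonnegative real part. -/
theorem exists_quadratic (T : ConvexClass k h g) {z : ℂ} (hz : z ∈ ball (0 : ℂ) 1) :
    ∃ μ c α β : ℂ, ‖μ‖ = 1 ∧ c ≠ 0 ∧ 1 + α * z + β * z ^ 2 = 1 - ‖z‖ ^ 2 ∧
      ∀ u ∈ ball (0 : ℂ) 1, 0 ≤ ((μ * deriv h u - conj μ * deriv g u) *
        (c * (1 + α * u + β * u ^ 2))).re := by
  have hr := mem_ball_zero_iff.1 hz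
  set s : ℝ := Real.sqrt (1 - ‖z‖ ^ 2) with hs
  have hs2 : s ^ 2 = 1 - ‖z‖ ^ 2 := Real.sq_sqrt (by nlinarith [norm_nonneg z])
  have hs0 : 0 ≤ s := Real.sqrt_nonneg _
  have hs1 : (1 + s : ℂ) ≠ 0 := by
    have : (1 + s : ℝ) ≠ 0 := by positivity
    exact_mod_cast this
  -- The hyperbolic midpoint of `0` and `z`. It satisfies `z - a = s a` and `1 - conj a z = s`, so
  -- the quadratic at `z` is `s² = 1 - ‖z‖²` times its value `c` at `0`.
  set a : ℂ := z / (1 + s) with ha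
  have ha1 : ‖a‖ < 1 := by
    have : ‖(1 + s : ℂ)‖ = 1 + s := by
      rw [← ofReal_one, ← ofReal_add, norm_real, Real.norm_of_nonneg (by positivity)]
    rw [ha, norm_div, this, div_lt_one (by positivity)]
    linarith
  obtain ⟨μ, p, hμ, hp, H⟩ := T.toConvexPair.exists_re_nonneg_at ha1
  have hc : p + conj p * a ^ 2 ≠ 0 := fun h0 => by
    have h1 : p = -(conj p * a ^ 2) := eq_neg_of_add_eq_zero_left h0
    have h2 := congrArg norm h1
    rw [norm_neg, norm_mul, norm_pow, RCLike.norm_conj, hp, one_mul] at h2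
    nlinarith [norm_nonneg a]
  set c := p + conj p * a ^ 2 with hcdef
  have hN : ∀ u, c * (1 + -2 * (p * conj a + conj p * a) / c * u +
      (p * conj a ^ 2 + conj p) / c * u ^ 2) =
      p * (1 - conj a * u) ^ 2 + conj p * (u - a) ^ 2 := fun u => by
    field_simp
    rw [hcdef]
    ring
  refine ⟨μ, c, -2 * (p * conj a + conj p * a) / c, (p * conj a ^ 2 + conj p) / c, hμ, hc, ?_,
    fun u hu => by rw [hN]; exact H u hu⟩
  refine mul_left_cancel₀ hc ?_
  rw [hN]
  have hs2c : (s : ℂ) ^ 2 = 1 - ‖z‖ ^ 2 := by exact_mod_cast hs2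
  have hzz : conj z * z = ‖z‖ ^ 2 := by
    rw [mul_comm, mul_conj, normSq_eq_norm_sq]; push_cast; ring
  have e0 : a * (1 + s) = z := div_mul_cancel₀ _ hs1
  have e1 : 1 - conj a * z = s := by
    have : conj a * (1 + s) = conj z := by
      rw [← e0, map_mul, map_add, map_one, conj_ofReal]
    refine mul_left_cancel₀ hs1 ?_
    linear_combination -z * this - hzz - hs2c
  have e2 : z - a = s * a := by linear_combination -e0
  rw [e1, e2, hcdef]
  linear_combination (p + conj p * a ^ 2) * hs2c

/-- The function with nonnegative real part behind the distortion theorem. -/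
theorem exists_caratheodory (T : ConvexClass k h g) {z : ℂ} (hz : z ∈ ball (0 : ℂ) 1) :
    ∃ (μ c α β : ℂ) (q : ℂ → ℂ), ‖μ‖ = 1 ∧ c ≠ 0 ∧ 1 + α * z + β * z ^ 2 = 1 - ‖z‖ ^ 2 ∧
      (∀ u ∈ ball (0 : ℂ) 1, q u = deriv h u * (μ - conj μ * dilatation h g u) *
        (c * (1 + α * u + β * u ^ 2))) ∧ q 0 = μ * c ∧
      DifferentiableOn ℂ q (ball 0 1) ∧ ∀ u ∈ ball (0 : ℂ) 1, 0 ≤ (q u).re := by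
  obtain ⟨μ, c, α, β, hμ, hc, hN, H⟩ := T.exists_quadratic hz
  refine ⟨μ, c, α, β, fun u => (μ * deriv h u - conj μ * deriv g u) *
    (c * (1 + α * u + β * u ^ 2)), hμ, hc, hN, fun u hu => congrArg (· * _) (T.shear_deriv μ hu), ?_, ?_, H⟩
  · simp [T.deriv_h_zero, T.deriv_g_zero]
  · exact (((T.diff_h.deriv isOpen_ball).const_mul μ).sub
      ((T.diff_g.deriv isOpen_ball).const_mul _)).mul (by fun_prop)

theorem norm_mul_sub_conj_mul {μ c α β w d z : ℂ} (hz : ‖z‖ < 1)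
    (hN : 1 + α * z + β * z ^ 2 = 1 - ‖z‖ ^ 2) :
    ‖d * (μ - conj μ * w) * (c * (1 + α * z + β * z ^ 2))‖ =
      ‖d‖ * ‖μ - conj μ * w‖ * (‖c‖ * (1 - ‖z‖ ^ 2)) := by
  have : (1 - ‖z‖ ^ 2 : ℂ) = ((1 - ‖z‖ ^ 2 : ℝ) : ℂ) := by push_cast; ring
  rw [hN, this, norm_mul, norm_mul, norm_mul, norm_real, Real.norm_of_nonneg]
  nlinarith [norm_nonneg z]

theorem norm_sub_conj_mul_le {μ w : ℂ} {x : ℝ} (hμ : ‖μ‖ = 1) (hw : ‖w‖ ≤ x) :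
    1 - x ≤ ‖μ - conj μ * w‖ ∧ ‖μ - conj μ * w‖ ≤ 1 + x := by
  have h1 : ‖conj μ * w‖ ≤ x := by rwa [norm_mul, RCLike.norm_conj, hμ, one_mul]
  constructor
  · linarith [norm_sub_norm_le μ (conj μ * w)]
  · linarith [norm_sub_le μ (conj μ * w)]

/-- Schwarz–Pick bounds `‖q z‖ / ‖q 0‖`, which equals `‖h' z‖ ‖μ - conj μ ω‖ (1 - ‖z‖²)`; the middle
factor lies between `1 - k ‖z‖` and `1 + k ‖z‖`. -/
theorem le_and_le_norm_deriv (T : ConvexClass k h g) {z : ℂ} (hz : z ∈ ball (0 : ℂ) 1) :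
    ‖deriv h z‖ * ((1 - ‖z‖) ^ 2 * (1 - k * ‖z‖)) ≤ 1 ∧
      1 ≤ ‖deriv h z‖ * ((1 + ‖z‖) ^ 2 * (1 + k * ‖z‖)) := by
  obtain ⟨μ, c, α, β, q, hμ, hc, hN, hq, hq0, hqd, hre⟩ := T.exists_caratheodory hz
  have hr := mem_ball_zero_iff.1 hz
  have h1 := norm_sub_le_of_re_nonneg hqd hre hz
  have hqz := norm_mul_sub_conj_mul (μ := μ) (c := c) (w := dilatation h g z) (d := deriv h z) hr hN
  rw [← hq z hz] at hqz
  have hb : ‖q 0‖ = ‖c‖ := by rw [hq0, norm_mul, hμ, one_mul]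
  obtain ⟨hw1, hw2⟩ := norm_sub_conj_mul_le hμ (T.norm_dilatation_le hz)
  set m := ‖μ - conj μ * dilatation h g z‖
  set r := ‖z‖
  set d := ‖deriv h z‖
  have hc0 : 0 < ‖c‖ := norm_pos_iff.2 hc
  have hr0 : 0 ≤ r := norm_nonneg z
  have hd0 : 0 ≤ d := norm_nonneg _
  have h2 : ‖q z + conj (q 0)‖ ≤ ‖q z‖ + ‖c‖ := by
    rw [← hb]; simpa using norm_add_le (q z) (conj (q 0))
  have h3 : ‖q z - q 0‖ ≤ r * (‖q z‖ + ‖c‖) := h1.trans (by gcongr)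
  have h4 := norm_sub_norm_le (q z) (q 0)
  have h5 := norm_sub_norm_le (q 0) (q z)
  rw [norm_sub_rev] at h5
  rw [hb] at h4 h5
  rw [hqz] at h3 h4 h5
  constructor
  · have e1 : ‖c‖ * ((1 + r) * (d * m * (1 - r) ^ 2)) ≤ ‖c‖ * ((1 + r) * 1) := by nlinarith
    have e2 := le_of_mul_le_mul_left (le_of_mul_le_mul_left e1 hc0) (by positivity)
    calc d * ((1 - r) ^ 2 * (1 - k * r)) ≤ d * ((1 - r) ^ 2 * m) := by gcongr
      _ = d * m * (1 - r) ^ 2 := by ring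
      _ ≤ 1 := e2
  · have e1 : ‖c‖ * ((1 - r) * 1) ≤ ‖c‖ * ((1 - r) * (d * m * (1 + r) ^ 2)) := by nlinarith
    have e2 := le_of_mul_le_mul_left (le_of_mul_le_mul_left e1 hc0) (by linarith)
    calc 1 ≤ d * m * (1 + r) ^ 2 := e2
      _ = d * ((1 + r) ^ 2 * m) := by ring
      _ ≤ d * ((1 + r) ^ 2 * (1 + k * r)) := by gcongr

/-- Equality at one point in the distortion theorem determines the derivative; the upper bound
corresponds to `x = ‖z‖`, the lower one to `x = -‖z‖`. -/
theorem deriv_eq_of_norm_eq (T : ConvexClass k h g) {z l : ℂ} {x : ℝ} (hz : z ∈ ball (0 : ℂ) 1)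
    (hz0 : z ≠ 0) (hl : ‖l‖ = 1) (hlz : l * z = x)
    (he : ‖deriv h z‖ * ((1 - x) ^ 2 * (1 - k * x)) = 1) {u : ℂ} (hu : u ∈ ball (0 : ℂ) 1) :
    deriv h u * ((1 - l * u) ^ 2 * (1 - k * (l * u))) = 1 := by
  obtain ⟨μ, c, α, β, q, hμ, hc, hN, hq, hq0, hqd, hre⟩ := T.exists_caratheodory hz
  have hr := mem_ball_zero_iff.1 hz
  have hk0 := T.k_nonneg
  have hk1 := T.k_lt
  have hxr : ‖z‖ = |x| := by
    have := congrArg norm hlz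
    rwa [norm_mul, hl, one_mul, norm_real, Real.norm_eq_abs] at this
  have hxr2 : ‖z‖ ^ 2 = x ^ 2 := by rw [hxr, sq_abs]
  have hx0 : x ≠ 0 := fun h0 => hz0 (by rw [← norm_eq_zero, hxr, h0, abs_zero])
  rw [hxr] at hr
  obtain ⟨hx1, hx2⟩ := abs_lt.1 hr
  have h1 := norm_sub_le_of_re_nonneg hqd hre hz
  have hqz := norm_mul_sub_conj_mul (μ := μ) (c := c) (w := dilatation h g z) (d := deriv h z)
    (mem_ball_zero_iff.1 hz) hN
  rw [← hq z hz] at hqz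
  have hb : ‖q 0‖ = ‖c‖ := by rw [hq0, norm_mul, hμ, one_mul]
  have hw := T.norm_dilatation_le hz
  obtain ⟨hw1, hw2⟩ := norm_sub_conj_mul_le hμ hw
  set m := ‖μ - conj μ * dilatation h g z‖ with hm
  rw [hxr] at hw hw1 hw2 h1
  rw [hxr2] at hqz
  set d := ‖deriv h z‖
  have hc0 : 0 < ‖c‖ := norm_pos_iff.2 hc
  have hd0 : 0 ≤ d := norm_nonneg _
  have h2 : ‖q z + conj (q 0)‖ ≤ ‖q z‖ + ‖c‖ := by
    rw [← hb]; simpa using norm_add_le (q z) (conj (q 0))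
  have h3 : ‖q z - q 0‖ ≤ |x| * (‖q z‖ + ‖c‖) := h1.trans (by gcongr)
  have h4 := norm_sub_norm_le (q z) (q 0)
  have h5 := norm_sub_norm_le (q 0) (q z)
  rw [norm_sub_rev] at h5
  rw [hb] at h4 h5
  rw [hqz] at h3 h4 h5
  have hkx : k * x < 1 := by nlinarith [abs_nonneg x, le_abs_self x]
  have hd1 : 0 < d := hd0.lt_of_ne' fun h0 => by rw [h0, zero_mul] at he; exact zero_ne_one he
  -- Equality in the product bound forces equality in each factor; the sign of `x` selects the upper
  -- or the lower chain.
  have hmx : m = 1 - k * x ∧ d * m * (1 - x) ^ 2 = 1 := by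
    rcases le_or_gt 0 x with hx | hx
    · rw [abs_of_nonneg hx] at *
      have e1 : ‖c‖ * ((1 + x) * (d * m * (1 - x) ^ 2)) ≤ ‖c‖ * ((1 + x) * 1) := by nlinarith
      have e2 := le_of_mul_le_mul_left (le_of_mul_le_mul_left e1 hc0) (by positivity)
      have e3 : m * (d * (1 - x) ^ 2) ≤ (1 - k * x) * (d * (1 - x) ^ 2) := by nlinarith
      have e4 := le_antisymm (le_of_mul_le_mul_right e3 (by
        have : 0 < 1 - x := by linarith
        positivity)) hw1
      refine ⟨e4, ?_⟩
      rw [e4]; linarith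
    · rw [abs_of_neg hx] at *
      have e1 : ‖c‖ * ((1 + x) * 1) ≤ ‖c‖ * ((1 + x) * (d * m * (1 - x) ^ 2)) := by nlinarith
      have e2 := le_of_mul_le_mul_left (le_of_mul_le_mul_left e1 hc0) (by linarith)
      have e3 : (1 - k * x) * (d * (1 - x) ^ 2) ≤ m * (d * (1 - x) ^ 2) := by nlinarith
      have e4 := le_antisymm (by linarith) (le_of_mul_le_mul_right e3 (by
        have : 0 < 1 - x := by linarith
        positivity))
      refine ⟨e4, ?_⟩
      rw [e4]; linarith
  obtain ⟨hmx, hdm⟩ := hmx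
  have hμμ : conj μ * μ = 1 := by
    rw [mul_comm, mul_conj, normSq_eq_norm_sq, hμ]; simp
  -- the dilatation
  have hωz : conj μ ^ 2 * dilatation h g z = ((k * x : ℝ) : ℂ) := by
    refine eq_ofReal_of_norm_one_sub hkx ?_ ?_
    · rw [norm_mul, norm_pow, RCLike.norm_conj, hμ, one_pow, one_mul, abs_mul, abs_of_nonneg hk0]
      exact hw
    · rw [← hmx, hm]
      have : μ - conj μ * dilatation h g z = μ * (1 - conj μ ^ 2 * dilatation h g z) := by
        linear_combination conj μ * dilatation h g z * hμμ
      rw [this, norm_mul, hμ, one_mul]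
  have hω : ∀ u ∈ ball (0 : ℂ) 1, dilatation h g u = u * (k * μ ^ 2 * l) := fun u hu => by
    refine eq_mul_of_mapsTo_closedBall T.differentiableOn_dilatation T.mapsTo_dilatation
      T.dilatation_zero hz hz0 ?_ ?_ hu
    · rw [norm_mul, norm_mul, norm_pow, hμ, hl, norm_real, Real.norm_of_nonneg hk0]; ring
    · push_cast at hωz
      linear_combination μ ^ 2 * hωz - dilatation h g z * (conj μ * μ + 1) * hμμ - k * μ ^ 2 * hlz
  have hqb : ‖q z‖ * (1 - x) = ‖q 0‖ * (1 + x) := by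
    rw [hqz, hb]
    linear_combination ‖c‖ * (1 + x) * hdm
  have hqne : q 0 ≠ 0 := by rw [← norm_pos_iff, hb]; exact hc0
  obtain ⟨hb0, hbr, hqx⟩ := real_of_norm_mul_eq hx1 hx2 hx0 hqne
    (hre 0 (mem_ball_self one_pos)) h1 hqb
  have hmob : ∀ u ∈ ball (0 : ℂ) 1, q u * (1 - l * u) = q 0 * (1 + l * u) := fun u hu => by
    rw [hbr]
    refine eq_mobius_of_re_nonneg hqd hre hb0 hbr hz hz0 hl ?_ hu
    rw [hlz, ← hbr]
    exact hqx
  have hμ0 : μ ≠ 0 := by rw [← norm_ne_zero_iff, hμ]; exact one_ne_zero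
  have key : ∀ u ∈ ball (0 : ℂ) 1, deriv h u * (1 - k * (l * u)) * (1 + α * u + β * u ^ 2) *
      (1 - l * u) = 1 + l * u := fun u hu => by
    have e := hmob u hu
    rw [hq u hu, hq0, hω u hu] at e
    refine mul_left_cancel₀ (mul_ne_zero hμ0 hc) ?_
    linear_combination e + deriv h u * u * k * l * μ * c * (1 + α * u + β * u ^ 2) *
      (1 - l * u) * hμμ
  have hll : conj l * l = 1 := by
    rw [mul_comm, mul_conj, normSq_eq_norm_sq, hl]; simp
  -- the quadratic polynomial vanishes at the point opposite to the pole
  have hroot : 1 - α * conj l + β * conj l ^ 2 = 0 := by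
    have hlim : Tendsto (fun t : ℝ => ‖1 + α * (-t * conj l) + β * (-t * conj l) ^ 2‖ -
        (1 - t) * (1 + t)) (𝓝[<] 1) (𝓝 (‖1 + α * (-(1 : ℝ) * conj l) +
          β * (-(1 : ℝ) * conj l) ^ 2‖ - (1 - 1) * (1 + 1))) := by
      refine Tendsto.mono_left (Continuous.tendsto ?_ _) nhdsWithin_le_nhds
      fun_prop
    have hle := le_of_tendsto hlim (b := 0) (by
      filter_upwards [Ioo_mem_nhdsLT (zero_lt_one' ℝ)] with t ht
      have htu : (-t * conj l : ℂ) ∈ ball (0 : ℂ) 1 := by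
        rw [mem_ball_zero_iff, norm_mul, RCLike.norm_conj, hl, mul_one, norm_neg, norm_real,
          Real.norm_of_nonneg ht.1.le]
        exact ht.2
      have hnt : ‖(-t * conj l : ℂ)‖ = t := by
        rw [norm_mul, RCLike.norm_conj, hl, mul_one, norm_neg, norm_real,
          Real.norm_of_nonneg ht.1.le]
      have k1 := key _ htu
      have hlt : l * (-t * conj l) = -t := by linear_combination -t * hll
      rw [hlt] at k1
      have k2 := congrArg norm k1
      have n1 : ‖(1 - k * -t : ℂ)‖ = 1 + k * t := by
        rw [show (1 - k * -t : ℂ) = ((1 + k * t : ℝ) : ℂ) by push_cast; ring, norm_real,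
          Real.norm_of_nonneg (by nlinarith [ht.1])]
      have n2 : ‖(1 - -t : ℂ)‖ = 1 + t := by
        rw [show (1 - -t : ℂ) = ((1 + t : ℝ) : ℂ) by push_cast; ring, norm_real,
          Real.norm_of_nonneg (by linarith [ht.1])]
      have n3 : ‖(1 + -t : ℂ)‖ = 1 - t := by
        rw [show (1 + -t : ℂ) = ((1 - t : ℝ) : ℂ) by push_cast; ring, norm_real,
          Real.norm_of_nonneg (by linarith [ht.2])]
      rw [norm_mul, norm_mul, norm_mul, n1, n2, n3] at k2
      have k3 := (T.le_and_le_norm_deriv htu).2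
      rw [hnt] at k3
      set n := ‖1 + α * (-t * conj l) + β * (-t * conj l) ^ 2‖
      have hn0 : 0 ≤ n := norm_nonneg _
      have k4 := mul_le_mul_of_nonneg_left k3 hn0
      have k5 : n * (‖deriv h (-t * conj l)‖ * ((1 + t) ^ 2 * (1 + k * t))) =
        (1 - t) * (1 + t) := by linear_combination (1 + t) * k2
      linarith)
    have h0 : ‖1 + α * (-(1 : ℝ) * conj l) + β * (-(1 : ℝ) * conj l) ^ 2‖ = 0 :=
      le_antisymm (by linarith) (norm_nonneg _)
    rw [norm_eq_zero] at h0
    push_cast at h0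
    linear_combination h0
  have hzx : z = x * conj l := by linear_combination -z * hll + conj l * hlz
  have hxc : (x : ℂ) ≠ 0 := ofReal_ne_zero.2 hx0
  -- The value `1 - x²` at `z = x conj l` and the zero at `-conj l` are two linear conditions that
  -- determine the quadratic as `1 - l² u²`.
  have hα : α = 0 := by
    have hl0 : conj l ≠ 0 := left_ne_zero_of_mul_eq_one hll
    have hN' : 1 + α * z + β * z ^ 2 = 1 - x ^ 2 := by
      rw [hN]; exact_mod_cast congrArg (fun y : ℝ => (1 - y : ℂ)) hxr2
    rw [hzx] at hN'
    have h6 : (x * conj l * (1 + x)) * α = 0 := by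
      linear_combination hN' - (x : ℂ) ^ 2 * hroot
    have h7 : (1 + x : ℂ) ≠ 0 := by
      have : (1 + x : ℝ) ≠ 0 := by linarith
      exact_mod_cast this
    exact (mul_eq_zero.1 h6).resolve_left (mul_ne_zero (mul_ne_zero hxc hl0) h7)
  have hβ : β = -l ^ 2 := by
    rw [hα] at hroot
    linear_combination l ^ 2 * hroot - β * (conj l * l + 1) * hll
  have hlu : 1 + l * u ≠ 0 := fun h0 => by
    have : ‖l * u‖ = 1 := by
      rw [show l * u = -1 by linear_combination h0, norm_neg, norm_one]
    rw [norm_mul, hl, one_mul] at this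
    exact (mem_ball_zero_iff.1 hu).ne this
  have := key u hu
  rw [hα, hβ] at this
  refine mul_left_cancel₀ hlu ?_
  linear_combination this

end ConvexClass

/-! ### Derivatives of the extremal functions and of the growth bounds -/

section extremal

variable {k : ℝ}

theorem one_sub_ne_zero_of_mem_ball {z : ℂ} (hz : z ∈ ball (0 : ℂ) 1) : 1 - z ≠ 0 := fun h => by
  rw [sub_eq_zero] at h
  rw [← h, mem_ball_zero_iff, norm_one] at hz
  exact lt_irrefl _ hz

theorem ofReal_mul_mem_ball (hk0 : 0 ≤ k) (hk1 : k < 1) {z : ℂ} (hz : z ∈ ball (0 : ℂ) 1) :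
    k * z ∈ ball (0 : ℂ) 1 := by
  rw [mem_ball_zero_iff] at hz ⊢
  rw [norm_mul, norm_real, Real.norm_of_nonneg hk0]
  nlinarith [norm_nonneg z]

theorem div_mem_slitPlane (hk0 : 0 ≤ k) (hk1 : k < 1) {z : ℂ} (hz : z ∈ ball (0 : ℂ) 1) :
    (1 - z) / (1 - k * z) ∈ slitPlane := by
  have h1 := one_sub_ne_zero_of_mem_ball (ofReal_mul_mem_ball hk0 hk1 hz)
  left
  have hx : z.re < 1 := (re_le_norm z).trans_lt (mem_ball_zero_iff.1 hz)
  have : ((1 - z) / (1 - k * z)).re =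
      ((1 - z.re) * (1 - k * z.re) + k * z.im ^ 2) / normSq (1 - k * z) := by
    rw [div_re]
    simp
    ring
  rw [this]
  refine div_pos ?_ (normSq_pos.2 h1)
  have : 0 < (1 - z.re) * (1 - k * z.re) := mul_pos (by linarith) (by nlinarith)
  positivity

theorem hasDerivAt_log_div (hk0 : 0 ≤ k) (hk1 : k < 1) {z : ℂ} (hz : z ∈ ball (0 : ℂ) 1) :
    HasDerivAt (fun z : ℂ => log ((1 - z) / (1 - k * z)))
      ((k - 1) / ((1 - z) * (1 - k * z))) z := by
  have h1 := one_sub_ne_zero_of_mem_ball (ofReal_mul_mem_ball hk0 hk1 hz)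
  have h2 := one_sub_ne_zero_of_mem_ball hz
  have hd : HasDerivAt (fun z : ℂ => (1 - z) / (1 - k * z))
      ((-1 * (1 - k * z) - (1 - z) * -(k * 1)) / (1 - k * z) ^ 2) z :=
    ((hasDerivAt_id z).const_sub 1).div (((hasDerivAt_id z).const_mul (k : ℂ)).const_sub 1) h1
  refine (hd.clog (div_mem_slitPlane hk0 hk1 hz)).congr_deriv ?_
  field_simp
  ring

theorem hasDerivAt_div_one_sub {z : ℂ} (hz : z ∈ ball (0 : ℂ) 1) :
    HasDerivAt (fun z : ℂ => z / (1 - z)) (1 / (1 - z) ^ 2) z := by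
  have h2 := one_sub_ne_zero_of_mem_ball hz
  refine ((hasDerivAt_id z).div ((hasDerivAt_id z).const_sub 1) h2).congr_deriv ?_
  simp

theorem one_sub_ofReal_ne_zero (hk1 : k < 1) : (1 - k : ℂ) ≠ 0 := by
  have : (1 - k : ℝ) ≠ 0 := by linarith
  exact_mod_cast this

theorem hasDerivAt_Hk (hk0 : 0 ≤ k) (hk1 : k < 1) {z : ℂ} (hz : z ∈ ball (0 : ℂ) 1) :
    HasDerivAt (Hk k) (1 / ((1 - z) ^ 2 * (1 - k * z))) z := by
  have h1 := one_sub_ne_zero_of_mem_ball (ofReal_mul_mem_ball hk0 hk1 hz)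
  have h2 := one_sub_ne_zero_of_mem_ball hz
  have h3 := one_sub_ofReal_ne_zero hk1
  have hd := ((hasDerivAt_div_one_sub hz).const_mul (1 / (1 - k : ℂ))).add
    ((hasDerivAt_log_div hk0 hk1 hz).const_mul (k / (1 - k) ^ 2 : ℂ))
  have he : Hk k = (fun z : ℂ => 1 / (1 - k : ℂ) * (z / (1 - z)) +
      k / (1 - k) ^ 2 * log ((1 - z) / (1 - k * z))) := by
    funext z
    rw [Hk, div_mul_div_comm, one_mul]
  rw [he]
  refine hd.congr_deriv ?_
  field_simp
  ring

theorem Hk_add_Gk (hk1 : k < 1) (z : ℂ) : Hk k z + Gk k z = z / (1 - z) := by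
  have h3 := one_sub_ofReal_ne_zero hk1
  rw [Hk, Gk]
  have : z / (1 - z) = z * (1 - k) / ((1 - k) * (1 - z)) := by
    rw [mul_comm z, mul_div_mul_left _ _ h3]
  rw [this, mul_sub, sub_div, mul_one]
  ring

theorem hasDerivAt_Gk (hk0 : 0 ≤ k) (hk1 : k < 1) {z : ℂ} (hz : z ∈ ball (0 : ℂ) 1) :
    HasDerivAt (Gk k) (-k * z / ((1 - z) ^ 2 * (1 - k * z))) z := by
  have h1 := one_sub_ne_zero_of_mem_ball (ofReal_mul_mem_ball hk0 hk1 hz)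
  have h2 := one_sub_ne_zero_of_mem_ball hz
  have he : Gk k = fun z => z / (1 - z) - Hk k z := by
    funext z
    rw [← Hk_add_Gk hk1]; ring
  rw [he]
  refine ((hasDerivAt_div_one_sub hz).sub (hasDerivAt_Hk hk0 hk1 hz)).congr_deriv ?_
  have h1' : 1 - z * k ≠ 0 := by rwa [mul_comm]
  field_simp
  ring

theorem Hk_zero (k : ℝ) : Hk k 0 = 0 := by simp [Hk]

theorem Gk_zero (k : ℝ) : Gk k 0 = 0 := by simp [Gk]

theorem Hk_ofReal (hk0 : 0 ≤ k) (hk1 : k < 1) {r : ℝ} (hr1 : r < 1) :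
    Hk k r = A k r := by
  have : 0 ≤ (1 - r) / (1 - k * r) := div_nonneg (by linarith) (by nlinarith)
  rw [Hk, A]
  push_cast [ofReal_log this]
  rfl

/-- This lets upper and lower bounds be treated together, as values of `A` at a signed radius. -/
theorem A_neg (k r : ℝ) : A k (-r) = -B k r := by
  have : (1 - -r) / (1 - k * -r) = ((1 + k * r) / (1 + r))⁻¹ := by rw [inv_div]; congr 1 <;> ring
  rw [A, B, this, Real.log_inv]
  ring

theorem hasDerivAt_A (hk0 : 0 ≤ k) (hk1 : k < 1) {r : ℝ} (hr0 : -1 < r) (hr1 : r < 1) :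
    HasDerivAt (A k) (1 / ((1 - r) ^ 2 * (1 - k * r))) r := by
  have hr : (r : ℂ) ∈ ball (0 : ℂ) 1 := by
    rw [mem_ball_zero_iff, norm_real, Real.norm_eq_abs, abs_lt]
    exact ⟨hr0, hr1⟩
  have hd := (hasDerivAt_Hk hk0 hk1 hr).real_of_complex
  have e : (1 / ((1 - r) ^ 2 * (1 - k * r)) : ℂ) = ((1 / ((1 - r) ^ 2 * (1 - k * r)) : ℝ) : ℂ) := by
    push_cast; rfl
  rw [e, ofReal_re] at hd
  refine hd.congr_of_eventuallyEq ?_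
  filter_upwards [Ioo_mem_nhds hr0 hr1] with x hx
  rw [Hk_ofReal hk0 hk1 hx.2, ofReal_re]

theorem B_eq (k : ℝ) : B k = fun r => -A k (-r) := by
  funext r
  rw [A_neg, neg_neg]

theorem hasDerivAt_B (hk0 : 0 ≤ k) (hk1 : k < 1) {r : ℝ} (hr0 : -1 < r) (hr1 : r < 1) :
    HasDerivAt (B k) (1 / ((1 + r) ^ 2 * (1 + k * r))) r := by
  rw [B_eq]
  refine ((hasDerivAt_A hk0 hk1 (r := -r) (by linarith) (by linarith)).scomp r
    (hasDerivAt_neg r)).neg.congr_deriv ?_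
  simp

theorem B_zero (k : ℝ) : B k 0 = 0 := by simp [B]

theorem A_zero (k : ℝ) : A k 0 = 0 := by simp [A]

theorem continuousOn_B (hk0 : 0 ≤ k) (hk1 : k < 1) : ContinuousOn (B k) (Ico 0 1) :=
  fun _ hr => (hasDerivAt_B hk0 hk1 (by linarith [hr.1]) hr.2).continuousAt.continuousWithinAt

end extremal

/-! ### Growth theorem: the upper bound -/

theorem le_and_deriv_eq_zero {u u' : ℝ → ℝ} (hc : ContinuousOn u (Icc 0 1))
    (hd : ∀ t ∈ Ioo (0 : ℝ) 1, HasDerivAt u (u' t) t) (h0 : ∀ t ∈ Ioo (0 : ℝ) 1, 0 ≤ u' t) :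
    u 0 ≤ u 1 ∧ (u 1 ≤ u 0 → ∀ t ∈ Ioo (0 : ℝ) 1, u' t = 0 ∧ u t = u 0) := by
  have hm : MonotoneOn u (Icc 0 1) := by
    refine monotoneOn_of_deriv_nonneg (convex_Icc 0 1) hc ?_ ?_
    · rw [interior_Icc]
      exact fun t ht => (hd t ht).differentiableAt.differentiableWithinAt
    · rw [interior_Icc]
      exact fun t ht => by rw [(hd t ht).deriv]; exact h0 t ht
  have m0 : (0 : ℝ) ∈ Icc (0 : ℝ) 1 := ⟨le_rfl, zero_le_one⟩
  have m1 : (1 : ℝ) ∈ Icc (0 : ℝ) 1 := ⟨zero_le_one, le_rfl⟩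
  refine ⟨hm m0 m1 zero_le_one, fun h10 t ht => ?_⟩
  have hconst : ∀ s ∈ Ioo (0 : ℝ) 1, u s = u 0 := fun s hs =>
    le_antisymm ((hm (Ioo_subset_Icc_self hs) m1 hs.2.le).trans h10)
      (hm m0 (Ioo_subset_Icc_self hs) hs.1.le)
  refine ⟨(hd t ht).unique ((hasDerivAt_const t (u 0)).congr_of_eventuallyEq ?_), hconst t ht⟩
  filter_upwards [isOpen_Ioo.mem_nhds ht] with s hs using hconst s hs

theorem B_nonneg {k : ℝ} (hk0 : 0 ≤ k) (hk1 : k < 1) {r : ℝ} (hr0 : 0 ≤ r) (hr1 : r < 1) :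
    0 ≤ B k r := by
  have hm : MonotoneOn (B k) (Ico 0 1) := by
    refine monotoneOn_of_deriv_nonneg (convex_Ico 0 1) (continuousOn_B hk0 hk1) ?_ ?_
    · rw [interior_Ico]
      exact fun t ht => (hasDerivAt_B hk0 hk1 (by linarith [ht.1]) ht.2).differentiableAt.differentiableWithinAt
    · rw [interior_Ico]
      intro t ht
      rw [(hasDerivAt_B hk0 hk1 (by linarith [ht.1]) ht.2).deriv]
      have := ht.1
      positivity
  rw [← B_zero k]
  exact hm ⟨le_rfl, one_pos⟩ ⟨hr0, hr1⟩ hr0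

theorem hasDerivAt_norm {γ : ℝ → ℂ} {γ' : ℂ} {t : ℝ} (hγ : HasDerivAt γ γ' t) (h0 : γ t ≠ 0) :
    HasDerivAt (fun t => ‖γ t‖) ((conj (γ t) * γ').re / ‖γ t‖) t := by
  have h1 := hγ.norm_sq.sqrt (by simpa using h0)
  simp only [Real.sqrt_sq (norm_nonneg _)] at h1
  refine h1.congr_deriv ?_
  have : ‖γ t‖ ≠ 0 := norm_ne_zero_iff.2 h0
  rw [Complex.inner]
  field_simp

section rotation

variable {k : ℝ} {h g : ℂ → ℂ} {l : ℂ}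

theorem mul_mem_ball (hl : ‖l‖ = 1) {z : ℂ} (hz : z ∈ ball (0 : ℂ) 1) : l * z ∈ ball (0 : ℂ) 1 := by
  rw [mem_ball_zero_iff] at hz ⊢
  rwa [norm_mul, hl, one_mul]

theorem conj_mul_self_of_norm (hl : ‖l‖ = 1) : conj l * l = 1 := by
  rw [mul_comm, mul_conj, normSq_eq_norm_sq, hl]; simp

theorem hasDerivAt_rotation_Hk (hk0 : 0 ≤ k) (hk1 : k < 1) (hl : ‖l‖ = 1) {z : ℂ}
    (hz : z ∈ ball (0 : ℂ) 1) :
    HasDerivAt (rotation l (Hk k)) (1 / ((1 - l * z) ^ 2 * (1 - k * (l * z)))) z := by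
  have hd := ((hasDerivAt_Hk hk0 hk1 (mul_mem_ball hl hz)).comp z
    ((hasDerivAt_id z).const_mul l)).const_mul (conj l)
  refine hd.congr_deriv ?_
  linear_combination (1 / ((1 - l * z) ^ 2 * (1 - k * (l * z)))) * conj_mul_self_of_norm hl

namespace ConvexClass

theorem eqOn_rotation (T : ConvexClass k h g) (hl : ‖l‖ = 1)
    (hd : ∀ u ∈ ball (0 : ℂ) 1, deriv h u * ((1 - l * u) ^ 2 * (1 - k * (l * u))) = 1) :
    EqOn h (rotation l (Hk k)) (ball 0 1) := by
  have hR := fun u (hu : u ∈ ball (0 : ℂ) 1) => hasDerivAt_rotation_Hk T.k_nonneg T.k_lt hl hu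
  refine isOpen_ball.eqOn_of_deriv_eq (convex_ball (0 : ℂ) 1).isPreconnected T.diff_h
    (fun u hu => (hR u hu).differentiableAt.differentiableWithinAt) (fun u hu => ?_)
    (mem_ball_self one_pos) ?_
  · rw [(hR u hu).deriv, eq_div_iff (right_ne_zero_of_mul_eq_one (hd u hu))]
    exact hd u hu
  · rw [T.h_zero, rotation, mul_zero, Hk_zero, mul_zero]

theorem norm_eq_of_eqOn (T : ConvexClass k h g) (hl : ‖l‖ = 1)
    (he : EqOn h (rotation l (Hk k)) (ball 0 1)) {z : ℂ} (hz : z ∈ ball (0 : ℂ) 1) {x : ℝ}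
    (hlz : l * z = x) : h z = conj l * A k x ∧
      ‖deriv h z‖ = 1 / ((1 - x) ^ 2 * (1 - k * x)) := by
  have hx : |x| < 1 := by
    rw [← Real.norm_eq_abs, ← norm_real, ← hlz, norm_mul, hl, one_mul]
    exact mem_ball_zero_iff.1 hz
  obtain ⟨hx1, hx2⟩ := abs_lt.1 hx
  constructor
  · rw [he hz, rotation, hlz, Hk_ofReal T.k_nonneg T.k_lt hx2]
  · have hd : HasDerivAt h _ z := (hasDerivAt_rotation_Hk T.k_nonneg T.k_lt hl hz).congr_of_eventuallyEq
      (by filter_upwards [isOpen_ball.mem_nhds hz] with w hw using he hw)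
    rw [hd.deriv, hlz]
    have e : (1 / ((1 - x) ^ 2 * (1 - k * x)) : ℂ) =
        ((1 / ((1 - x) ^ 2 * (1 - k * x)) : ℝ) : ℂ) := by push_cast; rfl
    have : 0 < 1 - k * x := by nlinarith [T.k_nonneg, T.k_lt]
    rw [e, norm_real, Real.norm_of_nonneg (by positivity)]

theorem eqOn_of_norm_deriv_eq (T : ConvexClass k h g) {z : ℂ} {x : ℝ} (hz : z ∈ ball (0 : ℂ) 1)
    (hz0 : z ≠ 0) (hl : ‖l‖ = 1) (hlz : l * z = x)
    (he : ‖deriv h z‖ * ((1 - x) ^ 2 * (1 - k * x)) = 1) :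
    EqOn h (rotation l (Hk k)) (ball 0 1) :=
  T.eqOn_rotation hl fun _ hu => T.deriv_eq_of_norm_eq hz hz0 hl hlz he hu

/-- The distortion bound is integrated along the radius, after rotating `h z` to the positive axis
by `e`. Equality at the end makes the difference `u` constant, so the distortion bound is attained
at an interior point of the radius. -/
theorem le_A (T : ConvexClass k h g) {z : ℂ} (hz : z ∈ ball (0 : ℂ) 1) :
    ‖h z‖ ≤ A k ‖z‖ ∧ (A k ‖z‖ ≤ ‖h z‖ → z ≠ 0 →
      EqOn h (rotation (conj z / ‖z‖) (Hk k)) (ball 0 1)) := by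
  have hk0 := T.k_nonneg
  have hk1 := T.k_lt
  have hr := mem_ball_zero_iff.1 hz
  set r := ‖z‖ with hrdef
  have hr0 : 0 ≤ r := norm_nonneg z
  obtain ⟨e, hen, he⟩ : ∃ e : ℂ, ‖e‖ = 1 ∧ (h z * e) = ‖h z‖ := by
    by_cases h0 : h z = 0
    · exact ⟨1, by simp, by simp [h0]⟩
    · have : (‖h z‖ : ℂ) ≠ 0 := ofReal_ne_zero.2 (norm_ne_zero_iff.2 h0)
      refine ⟨conj (h z) / ‖h z‖, by simp [h0], ?_⟩
      rw [mul_div_assoc', mul_conj, normSq_eq_norm_sq, div_eq_iff this]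
      push_cast; ring
  have htr : ∀ t ∈ Icc (0 : ℝ) 1, 0 ≤ t * r ∧ t * r < 1 := fun t ht =>
    ⟨mul_nonneg ht.1 hr0, by nlinarith [ht.1, ht.2]⟩
  have hnt : ∀ t ∈ Icc (0 : ℝ) 1, ‖(t * z : ℂ)‖ = t * r := fun t ht => by
    rw [norm_mul, norm_real, Real.norm_of_nonneg ht.1]
  have htz : ∀ t ∈ Icc (0 : ℝ) 1, (t * z : ℂ) ∈ ball (0 : ℂ) 1 := fun t ht => by
    rw [mem_ball_zero_iff, hnt t ht]; exact (htr t ht).2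
  set u : ℝ → ℝ := fun t => A k (t * r) - (h (t * z) * e).re with hu
  set u' : ℝ → ℝ := fun t => 1 / ((1 - t * r) ^ 2 * (1 - k * (t * r))) * r -
    (deriv h (t * z) * z * e).re with hu'
  have hd : ∀ t ∈ Icc (0 : ℝ) 1, HasDerivAt u (u' t) t := fun t ht => by
    have h1 := (hasDerivAt_A hk0 hk1 (r := t * r) (by linarith [(htr t ht).1]) (htr t ht).2).comp t
      ((hasDerivAt_id t).mul_const r)
    have h2 : HasDerivAt (fun t : ℝ => (t * z : ℂ)) (1 * z) t :=
      ((hasDerivAt_id t).ofReal_comp).mul_const z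
    have h3 := ((T.diff_h.differentiableAt (isOpen_ball.mem_nhds (htz t ht))).hasDerivAt.comp t
      h2).mul_const e
    have h4 := reCLM.hasFDerivAt.comp_hasDerivAt t h3
    refine (h1.sub h4).congr_deriv ?_
    simp only [hu', reCLM_apply, one_mul]
  have hbd : ∀ t ∈ Icc (0 : ℝ) 1, (deriv h (t * z) * z * e).re ≤ ‖deriv h (t * z)‖ * r :=
    fun t ht => (re_le_norm _).trans_eq (by rw [norm_mul, norm_mul, hen, mul_one])
  have hpos : ∀ t ∈ Icc (0 : ℝ) 1, 0 < (1 - t * r) ^ 2 * (1 - k * (t * r)) := fun t ht => by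
    have h1 : 0 < 1 - t * r := by linarith [(htr t ht).2]
    have h2 : 0 < 1 - k * (t * r) := by nlinarith [(htr t ht).1, (htr t ht).2]
    positivity
  have h0 : ∀ t ∈ Ioo (0 : ℝ) 1, 0 ≤ u' t := fun t ht => by
    have ht' := Ioo_subset_Icc_self ht
    have h1 := (T.le_and_le_norm_deriv (htz t ht')).1
    rw [hnt t ht', ← le_div_iff₀ (hpos t ht')] at h1
    have := mul_le_mul_of_nonneg_right h1 hr0
    simp only [hu']
    linarith [hbd t ht']
  obtain ⟨hle, heq⟩ := le_and_deriv_eq_zero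
    (fun t ht => (hd t ht).continuousAt.continuousWithinAt)
    (fun t ht => hd t (Ioo_subset_Icc_self ht)) h0
  have hu0 : u 0 = 0 := by simp [hu, A_zero, T.h_zero]
  have hu1 : u 1 = A k r - ‖h z‖ := by simp only [hu, ofReal_one, one_mul, he, ofReal_re]
  rw [hu0, hu1] at hle heq
  refine ⟨by linarith, fun hA hz0 => ?_⟩
  -- Any interior parameter would do; `z / 2` gives the same rotation as `z`.
  have ht : (1 / 2 : ℝ) ∈ Ioo (0 : ℝ) 1 := by norm_num
  have ht' := Ioo_subset_Icc_self ht
  obtain ⟨hu2, -⟩ := heq (by linarith) _ ht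
  have hr1 : 0 < r := norm_pos_iff.2 hz0
  have hrc : (r : ℂ) ≠ 0 := ofReal_ne_zero.2 hr1.ne'
  refine T.eqOn_of_norm_deriv_eq (z := ((1 / 2 : ℝ) : ℂ) * z) (x := 1 / 2 * r) (htz _ ht')
    (mul_ne_zero (by norm_num) hz0) ?_ ?_ ?_
  · rw [norm_div, RCLike.norm_conj, norm_real, norm_norm, div_self hr1.ne']
  · have hzz : conj z * z = r * r := by
      rw [mul_comm, mul_conj, normSq_eq_norm_sq, sq]; push_cast; rfl
    push_cast
    field_simp
    linear_combination hzz
  · have h1 := (T.le_and_le_norm_deriv (htz _ ht')).1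
    rw [hnt _ ht'] at h1
    refine le_antisymm h1 ?_
    have h2 := hbd _ ht'
    simp only [hu'] at hu2
    have h3 : 1 / ((1 - 1 / 2 * r) ^ 2 * (1 - k * (1 / 2 * r))) * r ≤
      ‖deriv h (((1 / 2 : ℝ) : ℂ) * z)‖ * r := by linarith
    have h4 := le_of_mul_le_mul_right h3 hr1
    rwa [div_le_iff₀ (hpos _ ht')] at h4

end ConvexClass

end rotation

/-! ### Growth theorem: the lower bound -/

theorem isOpen_image_of_deriv_ne_zero {h : ℂ → ℂ} {U : Set ℂ} (hU : IsOpen U)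
    (hd : DifferentiableOn ℂ h U) (h0 : ∀ z ∈ U, deriv h z ≠ 0) : IsOpen (h '' U) := by
  rw [isOpen_iff_mem_nhds]
  rintro _ ⟨z, hz, rfl⟩
  rw [← (hasStrictDerivAt_of_differentiableOn hU hd hz).map_nhds_eq (h0 z hz)]
  exact image_mem_map (hU.mem_nhds hz)

theorem hasDerivAt_invFunOn {h : ℂ → ℂ} {U : Set ℂ} (hU : IsOpen U)
    (hd : DifferentiableOn ℂ h U) (hi : InjOn h U) {z : ℂ} (hz : z ∈ U) (h0 : deriv h z ≠ 0) :
    HasDerivAt (Function.invFunOn h U) (deriv h z)⁻¹ (h z) := by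
  have hs := hasStrictDerivAt_of_differentiableOn hU hd hz
  refine (hs.to_localInverse h0).hasDerivAt.congr_of_eventuallyEq ?_
  have hloc : ∀ᶠ y in 𝓝 (h z), h (hs.localInverse h _ z h0 y) = y :=
    (hs.hasStrictFDerivAt_equiv h0).eventually_right_inverse
  have hc : ContinuousAt (hs.localInverse h _ z h0) (h z) :=
    (hs.to_localInverse h0).hasDerivAt.continuousAt
  have hz' : hs.localInverse h _ z h0 (h z) = z :=
    (hs.hasStrictFDerivAt_equiv h0).localInverse_apply_image
  have hmem : ∀ᶠ y in 𝓝 (h z), hs.localInverse h _ z h0 y ∈ U :=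
    hc.eventually (by rw [hz']; exact hU.mem_nhds hz)
  filter_upwards [hloc, hmem] with y hy hyU
  have hex : ∃ x ∈ U, h x = y := ⟨_, hyU, hy⟩
  exact hi (Function.invFunOn_mem hex) hyU ((Function.invFunOn_eq hex).trans hy.symm)

namespace ConvexClass

variable {k : ℝ} {h g : ℂ → ℂ}

/-- A disk lies in the image of a smaller disk if its radius is the minimal modulus on the circle. -/
theorem ball_subset_image (T : ConvexClass k h g) {r m : ℝ} (hr0 : 0 < r) (hr1 : r < 1)
    (hm : 0 < m) (hmin : ∀ ζ : ℂ, ‖ζ‖ = r → m ≤ ‖h ζ‖) : ball 0 m ⊆ h '' ball 0 r := by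
  have hcb : closedBall (0 : ℂ) r ⊆ ball 0 1 := closedBall_subset_ball hr1
  have hb : ball (0 : ℂ) r ⊆ ball 0 1 := ball_subset_closedBall.trans hcb
  have ho : IsOpen (h '' ball 0 r) := isOpen_image_of_deriv_ne_zero isOpen_ball
    (T.diff_h.mono hb) fun z hz => T.toConvexPair.deriv_h_ne_zero (hb hz)
  have hcl : IsClosed (h '' closedBall 0 r) := ((isCompact_closedBall (0 : ℂ) r).image_of_continuousOn
    (T.diff_h.continuousOn.mono hcb)).isClosed
  -- The ball of radius `m` misses the image of the circle, so it is covered by the disjoint open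
  -- sets `h '' ball 0 r` and the complement of `h '' closedBall 0 r`. It meets the first at `0`.
  refine IsPreconnected.subset_left_of_subset_union ho hcl.isOpen_compl ?_ ?_ ?_
    (convex_ball (0 : ℂ) m).isPreconnected
  · exact disjoint_compl_right.mono_left (image_mono ball_subset_closedBall)
  · intro w hw
    by_cases hwc : w ∈ h '' closedBall 0 r
    · left
      obtain ⟨ζ, hζ, rfl⟩ := hwc
      refine ⟨ζ, mem_ball_zero_iff.2 ((mem_closedBall_zero_iff.1 hζ).lt_of_ne fun he => ?_), rfl⟩
      exact absurd (hmin ζ he) (not_le.2 (mem_ball_zero_iff.1 hw))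
    · exact Or.inr hwc
  · exact ⟨0, mem_ball_self hm, 0, mem_ball_self hr0, T.h_zero⟩

/-- Minimality puts the segment from `0` to `h z` in the image of `h`. Its lift `γ` has speed `m /
‖h'‖`, and the growth rate of `‖γ‖` is at most this speed, so the lower distortion bound makes `t m
- B k ‖γ t‖` nondecreasing. -/
theorem B_le_of_isMin (T : ConvexClass k h g) {z : ℂ} (hz : z ∈ ball (0 : ℂ) 1) (hz0 : z ≠ 0)
    (hmin : ∀ ζ : ℂ, ‖ζ‖ = ‖z‖ → ‖h z‖ ≤ ‖h ζ‖) :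
    B k ‖z‖ ≤ ‖h z‖ ∧ (‖h z‖ ≤ B k ‖z‖ →
      EqOn h (rotation (-(conj z / ‖z‖)) (Hk k)) (ball 0 1)) := by
  have hk0 := T.k_nonneg
  have hk1 := T.k_lt
  have h0 : (0 : ℂ) ∈ ball (0 : ℂ) 1 := mem_ball_self one_pos
  have hr1 := mem_ball_zero_iff.1 hz
  have hr0 : 0 < ‖z‖ := norm_pos_iff.2 hz0
  have hi := T.toConvexPair.injOn_h
  have hw0 : h z ≠ 0 := fun he => hz0 (hi hz h0 (by rw [he, T.h_zero]))
  set r := ‖z‖ with hrdef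
  set m := ‖h z‖ with hmdef
  have hm : 0 < m := norm_pos_iff.2 hw0
  set ψ := Function.invFunOn h (ball 0 1) with hψ
  have hψh : ∀ ζ ∈ ball (0 : ℂ) 1, ψ (h ζ) = ζ := fun ζ hζ => hi.leftInvOn_invFunOn hζ
  have hex : ∀ t ∈ Icc (0 : ℝ) 1, ∃ ζ ∈ ball (0 : ℂ) 1, h ζ = t * h z := fun t ht => by
    rcases ht.2.eq_or_lt with rfl | hlt
    · exact ⟨z, hz, by simp⟩
    · have : (t * h z : ℂ) ∈ ball (0 : ℂ) m := by
        rw [mem_ball_zero_iff, norm_mul, norm_real, Real.norm_of_nonneg ht.1]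
        nlinarith
      obtain ⟨ζ, hζ, he⟩ := T.ball_subset_image hr0 hr1 hm hmin this
      exact ⟨ζ, ball_subset_ball hr1.le hζ, he⟩
  set γ : ℝ → ℂ := fun t => ψ (t * h z) with hγ
  have hγm : ∀ t ∈ Icc (0 : ℝ) 1, γ t ∈ ball (0 : ℂ) 1 := fun t ht =>
    Function.invFunOn_mem (hex t ht)
  have hγh : ∀ t ∈ Icc (0 : ℝ) 1, h (γ t) = t * h z := fun t ht =>
    Function.invFunOn_eq (hex t ht)
  have hγd : ∀ t ∈ Icc (0 : ℝ) 1, HasDerivAt γ ((deriv h (γ t))⁻¹ * h z) t := fun t ht => by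
    have h1 := hasDerivAt_invFunOn isOpen_ball T.diff_h hi (hγm t ht)
      (T.toConvexPair.deriv_h_ne_zero (hγm t ht))
    rw [hγh t ht] at h1
    have h2 : HasDerivAt (fun t : ℝ => (t * h z : ℂ)) (1 * h z) t :=
      ((hasDerivAt_id t).ofReal_comp).mul_const (h z)
    rw [one_mul] at h2
    exact h1.comp t h2
  have hγ0 : ∀ t ∈ Ioo (0 : ℝ) 1, γ t ≠ 0 := fun t ht he => by
    have := hγh t (Ioo_subset_Icc_self ht)
    rw [he, T.h_zero] at this
    exact mul_ne_zero (ofReal_ne_zero.2 ht.1.ne') hw0 this.symm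
  set u : ℝ → ℝ := fun t => t * m - B k ‖γ t‖ with hu
  set u' : ℝ → ℝ := fun t => m - 1 / ((1 + ‖γ t‖) ^ 2 * (1 + k * ‖γ t‖)) *
    ((conj (γ t) * ((deriv h (γ t))⁻¹ * h z)).re / ‖γ t‖) with hu'
  have hd : ∀ t ∈ Ioo (0 : ℝ) 1, HasDerivAt u (u' t) t := fun t ht => by
    have ht' := Ioo_subset_Icc_self ht
    have h1 := hasDerivAt_norm (hγd t ht') (hγ0 t ht)
    have h2 := (hasDerivAt_B hk0 hk1 (r := ‖γ t‖) (by linarith [norm_nonneg (γ t)])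
      (mem_ball_zero_iff.1 (hγm t ht'))).comp t h1
    have h3 := ((hasDerivAt_id t).mul_const m).sub h2
    rw [one_mul] at h3
    exact h3
  have hcont : ContinuousOn u (Icc 0 1) := by
    refine (continuousOn_id.mul continuousOn_const).sub ((continuousOn_B hk0 hk1).comp
      (fun t ht => (hγd t ht).continuousAt.norm.continuousWithinAt) fun t ht => ?_)
    exact ⟨norm_nonneg _, mem_ball_zero_iff.1 (hγm t ht)⟩
  have hbd : ∀ t ∈ Ioo (0 : ℝ) 1,
      (conj (γ t) * ((deriv h (γ t))⁻¹ * h z)).re / ‖γ t‖ ≤ m / ‖deriv h (γ t)‖ := fun t ht => by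
    rw [div_le_iff₀ (norm_pos_iff.2 (hγ0 t ht))]
    refine (re_le_norm _).trans_eq ?_
    rw [norm_mul, norm_mul, norm_inv, RCLike.norm_conj]
    ring
  have hpos : ∀ t, 0 < (1 + ‖γ t‖) ^ 2 * (1 + k * ‖γ t‖) := fun t => by positivity
  have hdpos : ∀ t ∈ Icc (0 : ℝ) 1, 0 < ‖deriv h (γ t)‖ := fun t ht =>
    norm_pos_iff.2 (T.toConvexPair.deriv_h_ne_zero (hγm t ht))
  have hu'0 : ∀ t ∈ Ioo (0 : ℝ) 1, m * (1 - 1 / (‖deriv h (γ t)‖ *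
      ((1 + ‖γ t‖) ^ 2 * (1 + k * ‖γ t‖)))) ≤ u' t := fun t ht => by
    have h1 := mul_le_mul_of_nonneg_left (hbd t ht) (one_div_pos.2 (hpos t)).le
    simp only [hu']
    refine le_trans (le_of_eq ?_) (sub_le_sub_left h1 m)
    have := (hdpos t (Ioo_subset_Icc_self ht)).ne'
    have := (hpos t).ne'
    field_simp
  obtain ⟨hle, heq⟩ := le_and_deriv_eq_zero hcont hd fun t ht => by
    refine le_trans (mul_nonneg hm.le ?_) (hu'0 t ht)
    have h1 := (T.le_and_le_norm_deriv (hγm t (Ioo_subset_Icc_self ht))).2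
    rw [sub_nonneg, div_le_one (by linarith)]
    exact h1
  have hγ00 : γ 0 = 0 := by
    have : ψ (h 0) = 0 := hψh 0 h0
    rw [T.h_zero] at this
    simp [hγ, this]
  have hγ1 : γ 1 = z := by simp [hγ, hψh z hz]
  have hu0 : u 0 = 0 := by simp [hu, hγ00, B_zero]
  have hu1 : u 1 = m - B k r := by simp [hu, hγ1, hrdef]
  rw [hu0, hu1] at hle heq
  refine ⟨by linarith, fun hB => ?_⟩
  have hBm : B k r = m := by linarith
  have ht : (1 / 2 : ℝ) ∈ Ioo (0 : ℝ) 1 := by norm_num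
  have ht' := Ioo_subset_Icc_self ht
  obtain ⟨hz1, hz2⟩ := heq (by linarith) _ ht
  have hmem := hγm _ ht'
  have hhζ := hγh _ ht'
  have hne := hγ0 _ ht
  have hdn := hu'0 _ ht
  have hd0 := hdpos _ ht'
  have hp := hpos (1 / 2)
  rw [hz1] at hdn
  have hu2 : 1 / 2 * m = B k ‖γ (1 / 2)‖ := by
    simp only [hu] at hz2; linarith
  set ζ := γ (1 / 2) with hζ
  set ρ := ‖ζ‖ with hρ
  have hρ0 : 0 < ρ := norm_pos_iff.2 hne
  have hρc : (ρ : ℂ) ≠ 0 := ofReal_ne_zero.2 hρ0.ne'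
  set l : ℂ := -(conj ζ / ρ) with hl
  have hl1 : ‖l‖ = 1 := by
    rw [hl, norm_neg, norm_div, RCLike.norm_conj, norm_real, norm_norm, div_self hρ0.ne']
  have hζζ : conj ζ * ζ = ρ * ρ := by
    rw [mul_comm, mul_conj, normSq_eq_norm_sq, sq]; push_cast; rfl
  have hlζ : l * ζ = ((-ρ : ℝ) : ℂ) := by
    rw [hl]; push_cast; field_simp; linear_combination -hζζ
  have heqn : ‖deriv h ζ‖ * ((1 - -ρ) ^ 2 * (1 - k * -ρ)) = 1 := by
    rw [sub_neg_eq_add, mul_neg, sub_neg_eq_add]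
    refine le_antisymm ?_ (T.le_and_le_norm_deriv hmem).2
    have h1 : 1 - 1 / (‖deriv h ζ‖ * ((1 + ρ) ^ 2 * (1 + k * ρ))) ≤ 0 :=
      nonpos_of_mul_nonpos_right hdn hm
    rwa [sub_nonpos, one_le_div (by positivity)] at h1
  have hE := T.eqOn_of_norm_deriv_eq hmem hne hl1 hlζ heqn
  have hv := (T.norm_eq_of_eqOn hl1 hE hmem hlζ).1
  rw [A_neg, ← hu2, hhζ] at hv
  have hll := conj_mul_self_of_norm hl1
  have hzr : (-(r * conj l) : ℂ) ∈ ball (0 : ℂ) 1 := by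
    rw [mem_ball_zero_iff, norm_neg, norm_mul, RCLike.norm_conj, hl1, mul_one, norm_real,
      Real.norm_of_nonneg hr0.le]
    exact hr1
  have hv2 := (T.norm_eq_of_eqOn hl1 hE (x := -r) hzr (by
    push_cast; linear_combination (-r : ℂ) * hll)).1
  rw [A_neg, hBm] at hv2
  -- Equality was transferred to `ζ = γ (1/2)`, so the rotation is so far determined by `ζ`. The
  -- values of `h` at `z` and at `-r conj l` coincide, and univalence puts `z` on the same ray as
  -- `ζ`.
  have hzeq : z = -(r * conj l) := hi hz hzr (by
    rw [hv2]
    push_cast at hv ⊢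
    linear_combination 2 * hv)
  have hlz : -(conj z / r) = l := by
    have hrc : (r : ℂ) ≠ 0 := ofReal_ne_zero.2 hr0.ne'
    rw [hzeq]
    simp only [map_neg, map_mul, conj_ofReal, conj_conj]
    field_simp
  rw [hlz]
  exact hE

theorem B_le (T : ConvexClass k h g) {z : ℂ} (hz : z ∈ ball (0 : ℂ) 1) :
    B k ‖z‖ ≤ ‖h z‖ ∧ (‖h z‖ ≤ B k ‖z‖ → z ≠ 0 →
      EqOn h (rotation (-(conj z / ‖z‖)) (Hk k)) (ball 0 1)) := by
  rcases eq_or_ne z 0 with rfl | hz0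
  · simp [B_zero]
  have hsub : sphere (0 : ℂ) ‖z‖ ⊆ ball 0 1 := fun ζ hζ => by
    rw [mem_ball_zero_iff, mem_sphere_zero_iff_norm.1 hζ]; exact mem_ball_zero_iff.1 hz
  obtain ⟨z₁, hz₁, hmin⟩ := (isCompact_sphere (0 : ℂ) ‖z‖).exists_isMinOn ⟨z, by simp⟩
    (T.diff_h.continuousOn.mono hsub).norm
  have hn := mem_sphere_zero_iff_norm.1 hz₁
  have hmin' : ∀ ζ : ℂ, ‖ζ‖ = ‖z‖ → ‖h z₁‖ ≤ ‖h ζ‖ := fun ζ hζ => hmin (by simpa using hζ)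
  have h1 := (T.B_le_of_isMin (hsub hz₁) (by
    rw [← norm_ne_zero_iff, hn]; exact norm_ne_zero_iff.2 hz0)
    (fun ζ hζ => hmin' ζ (hζ.trans hn))).1
  rw [hn] at h1
  refine ⟨h1.trans (hmin' z rfl), fun hB _ => ?_⟩
  -- Equality at `z` makes `‖h z‖` no larger than the minimum on the circle, so `z` is itself a
  -- minimum point.
  exact (T.B_le_of_isMin hz hz0 fun ζ hζ => (hB.trans h1).trans (hmin' ζ hζ)).2 hB

end ConvexClass

/-! ### Membership of the extremal maps in the class -/

theorem arg_eq_arctan {v : ℂ} (hv : 0 < v.re) : arg v = Real.arctan (v.im / v.re) := by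
  have h := abs_lt.1 (abs_arg_lt_pi_div_two_iff.2 (Or.inl hv))
  rw [← tan_arg, Real.arctan_tan h.1 h.2]

theorem neg_half_lt_re_div_one_sub {z : ℂ} (hz : z ∈ ball (0 : ℂ) 1) :
    -(1 / 2) < (z / (1 - z)).re := by
  have h1 := normSq_pos.2 (one_sub_ne_zero_of_mem_ball hz)
  have h2 : z.re * z.re + z.im * z.im < 1 := by
    rw [← normSq_apply, normSq_eq_norm_sq]
    nlinarith [mem_ball_zero_iff.1 hz, norm_nonneg z]
  have : (z / (1 - z)).re = (z.re * (1 - z.re) - z.im * z.im) / normSq (1 - z) := by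
    rw [div_re]; simp; ring
  rw [this, lt_div_iff₀ h1, normSq_apply]
  simp
  nlinarith

theorem exists_div_one_sub_eq {w : ℂ} (hw : -(1 / 2) < w.re) :
    ∃ z ∈ ball (0 : ℂ) 1, z / (1 - z) = w := by
  have h1 : 1 + w ≠ 0 := fun h => by
    have := congrArg Complex.re h
    simp at this
    linarith
  refine ⟨w / (1 + w), ?_, ?_⟩
  · rw [mem_ball_zero_iff, norm_div, div_lt_one (norm_pos_iff.2 h1)]
    refine lt_of_pow_lt_pow_left₀ 2 (norm_nonneg _) ?_
    rw [← normSq_eq_norm_sq, ← normSq_eq_norm_sq, normSq_apply, normSq_apply]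
    simp
    nlinarith
  · have : 1 - w / (1 + w) = 1 / (1 + w) := by field_simp; ring
    rw [this]
    field_simp

section vert

variable {k : ℝ}

/-- The imaginary part of the half-plane map in terms of `z / (1 - z) = x + i y`. -/
def vert (k x y : ℝ) : ℝ :=
  (1 + k) / (1 - k) * y - 2 * k / (1 - k) ^ 2 * Real.arctan ((1 - k) * y / (1 + (1 - k) * x))

theorem Lk_re (hk1 : k < 1) (z : ℂ) : (Lk k z).re = (z / (1 - z)).re := by
  rw [← Hk_add_Gk hk1, Lk, add_re, add_re, conj_re]

/-- With `w = z / (1 - z)` the logarithm is minus that of `1 + (1 - k) w`, which lies in the right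
half-plane, where the argument is an arctangent. -/
theorem Lk_im (hk0 : 0 ≤ k) (hk1 : k < 1) {z : ℂ} (hz : z ∈ ball (0 : ℂ) 1) :
    (Lk k z).im = vert k (z / (1 - z)).re (z / (1 - z)).im := by
  have h1 := one_sub_ne_zero_of_mem_ball (ofReal_mul_mem_ball hk0 hk1 hz)
  have h2 := one_sub_ne_zero_of_mem_ball hz
  have h3 := one_sub_ofReal_ne_zero hk1
  have hre := neg_half_lt_re_div_one_sub hz
  have e1 : Hk k z - Gk k z = (((1 + k) / (1 - k) : ℝ) : ℂ) * (z / (1 - z)) +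
      ((2 * k / (1 - k) ^ 2 : ℝ) : ℂ) * log ((1 - z) / (1 - k * z)) := by
    rw [Hk, Gk]
    push_cast
    field_simp
    ring
  have e2 : (1 - z) / (1 - k * z) = (1 + ((1 - k : ℝ) : ℂ) * (z / (1 - z)))⁻¹ := by
    have : 1 + ((1 - k : ℝ) : ℂ) * (z / (1 - z)) = (1 - k * z) / (1 - z) := by
      push_cast
      field_simp
      ring
    rw [this, inv_div]
  have hv : (1 + ((1 - k : ℝ) : ℂ) * (z / (1 - z))).re = 1 + (1 - k) * (z / (1 - z)).re := by
    rw [add_re, re_ofReal_mul, one_re]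
  have hv' : (1 + ((1 - k : ℝ) : ℂ) * (z / (1 - z))).im = (1 - k) * (z / (1 - z)).im := by
    rw [add_im, im_ofReal_mul, one_im, zero_add]
  have hvpos : 0 < (1 + ((1 - k : ℝ) : ℂ) * (z / (1 - z))).re := by
    rw [hv]; nlinarith
  have e3 : (log ((1 - z) / (1 - k * z))).im =
      -Real.arctan ((1 - k) * (z / (1 - z)).im / (1 + (1 - k) * (z / (1 - z)).re)) := by
    have hne : arg (1 + ((1 - k : ℝ) : ℂ) * (z / (1 - z))) ≠ Real.pi := fun he =>
      lt_asymm hvpos (arg_eq_pi_iff.1 he).1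
    rw [e2, log_inv _ hne, neg_im, log_im, arg_eq_arctan hvpos, hv, hv']
  have : (Lk k z).im = (Hk k z - Gk k z).im := by rw [Lk, add_im, conj_im, sub_im]; ring
  rw [this, e1, add_im, im_ofReal_mul, im_ofReal_mul, e3, vert]
  ring

theorem hasDerivAt_vert (k x y : ℝ) : HasDerivAt (vert k x) ((1 + k) / (1 - k) * 1 -
    2 * k / (1 - k) ^ 2 * (1 / (1 + ((1 - k) * y / (1 + (1 - k) * x)) ^ 2) *
      ((1 - k) * 1 / (1 + (1 - k) * x)))) y :=
  ((hasDerivAt_id y).const_mul _).sub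
    ((((hasDerivAt_id y).const_mul (1 - k)).div_const _).arctan.const_mul _)

/-- As `1 + (1 - k) x > (1 + k) / 2`, positivity of the derivative reduces to `4 k ≤ (1 + k)²`. -/
theorem strictMono_vert (hk0 : 0 ≤ k) (hk1 : k < 1) {x : ℝ} (hx : -(1 / 2) < x) :
    StrictMono (vert k x) := by
  refine strictMono_of_hasDerivAt_pos (hasDerivAt_vert k x) fun y => ?_
  have hc : 0 < 1 - k := by linarith
  have hd : (1 + k) / 2 < 1 + (1 - k) * x := by nlinarith
  set d := 1 + (1 - k) * x
  have hd0 : 0 < d := by linarith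
  set s := (1 - k) * y / d
  have h1 : 1 / (1 + s ^ 2) ≤ 1 := by
    rw [div_le_one (by positivity)]; nlinarith [sq_nonneg s]
  have h2 : 2 * k / (1 - k) ^ 2 * (1 / (1 + s ^ 2) * ((1 - k) * 1 / d)) ≤
      2 * k / (1 - k) ^ 2 * (1 * ((1 - k) * 1 / d)) := by gcongr
  have h3 : 2 * k / (1 - k) ^ 2 * (1 * ((1 - k) * 1 / d)) = 2 * k / ((1 - k) * d) := by
    field_simp
  have h4 : 2 * k / ((1 - k) * d) < (1 + k) / (1 - k) := by
    rw [div_lt_div_iff₀ (by positivity) hc]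
    nlinarith [sq_nonneg (1 - k), mul_pos hc (by linarith : 0 < 1 + k)]
  linarith

theorem surjective_vert (hk0 : 0 ≤ k) (hk1 : k < 1) (x : ℝ) : Function.Surjective (vert k x) := by
  have hc : 0 < 1 - k := by linarith
  have ha : 0 < (1 + k) / (1 - k) := by positivity
  have hb : 0 ≤ 2 * k / (1 - k) ^ 2 := by positivity
  have hcont : Continuous (vert k x) :=
    continuous_iff_continuousAt.2 fun y => (hasDerivAt_vert k x y).continuousAt
  refine hcont.surjective ?_ ?_
  · refine tendsto_atTop_mono (fun y => ?_) (tendsto_atTop_add_const_right _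
      (-(2 * k / (1 - k) ^ 2 * (Real.pi / 2))) (tendsto_id.const_mul_atTop ha))
    have := mul_le_mul_of_nonneg_left
      (Real.arctan_lt_pi_div_two ((1 - k) * y / (1 + (1 - k) * x))).le hb
    simp only [vert, id]
    linarith
  · refine tendsto_atBot_mono (fun y => ?_) (tendsto_atBot_add_const_right _
      (2 * k / (1 - k) ^ 2 * (Real.pi / 2)) (tendsto_id.const_mul_atBot ha))
    have := mul_le_mul_of_nonneg_left
      (Real.neg_pi_div_two_lt_arctan ((1 - k) * y / (1 + (1 - k) * x))).le hb
    simp only [vert, id]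
    linarith

theorem injOn_Lk (hk0 : 0 ≤ k) (hk1 : k < 1) : InjOn (Lk k) (ball 0 1) := by
  intro z hz z' hz' he
  have h1 := congrArg Complex.re he
  have h2 := congrArg Complex.im he
  rw [Lk_re hk1, Lk_re hk1] at h1
  rw [Lk_im hk0 hk1 hz, Lk_im hk0 hk1 hz', h1] at h2
  have h3 := Complex.ext h1 ((strictMono_vert hk0 hk1 (neg_half_lt_re_div_one_sub hz')).injective h2)
  rw [div_eq_div_iff (one_sub_ne_zero_of_mem_ball hz) (one_sub_ne_zero_of_mem_ball hz')] at h3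
  linear_combination h3

theorem image_Lk (hk0 : 0 ≤ k) (hk1 : k < 1) : Lk k '' ball 0 1 = {w | -(1 / 2) < w.re} := by
  ext w
  constructor
  · rintro ⟨z, hz, rfl⟩
    rw [mem_ofPred_eq, Lk_re hk1]
    exact neg_half_lt_re_div_one_sub hz
  · intro hw
    obtain ⟨y, hy⟩ := surjective_vert hk0 hk1 w.re w.im
    obtain ⟨z, hz, he⟩ := exists_div_one_sub_eq (w := ⟨w.re, y⟩) hw
    refine ⟨z, hz, Complex.ext ?_ ?_⟩
    · rw [Lk_re hk1, he]
    · rw [Lk_im hk0 hk1 hz, he]; exact hy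

end vert

theorem rotation_image {l : ℂ} (hl : ‖l‖ = 1) (F : ℂ → ℂ) :
    rotation l F '' ball 0 1 = (fun w => conj l * w) '' (F '' ball 0 1) := by
  have : F '' ball 0 1 = (fun z => F (l * z)) '' ball 0 1 := by
    refine Subset.antisymm ?_ ?_
    · rintro _ ⟨z, hz, rfl⟩
      refine ⟨conj l * z, mul_mem_ball (by rwa [RCLike.norm_conj]) hz, ?_⟩
      show F (l * (conj l * z)) = F z
      rw [← mul_assoc, mul_comm l, conj_mul_self_of_norm hl, one_mul]
    · rintro _ ⟨z, hz, rfl⟩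
      exact ⟨l * z, mul_mem_ball hl hz, rfl⟩
  rw [this, image_image]
  rfl

/-- The rotated co-analytic part is `l * Gk k (l * z)` because its conjugate carries the factor
`conj l`. The dilatation is `-k l³ z`, of modulus `k ‖z‖`, and the range is a rotated half-plane. -/
theorem classCH0K_rotation_Lk {k K : ℝ} (hk0 : 0 ≤ k) (hk1 : k < 1) (hK : K = (1 + k) / (1 - k))
    {l : ℂ} (hl : ‖l‖ = 1) : ClassCH0K K (rotation l (Lk k)) (rotation l (Hk k))
      (fun z => l * Gk k (l * z)) := by
  have h0 : (0 : ℂ) ∈ ball (0 : ℂ) 1 := mem_ball_self one_pos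
  have hl0 : conj l ≠ 0 := left_ne_zero_of_mul_eq_one (conj_mul_self_of_norm hl)
  have hl0' : l ≠ 0 := right_ne_zero_of_mul_eq_one (conj_mul_self_of_norm hl)
  have hH := fun z (hz : z ∈ ball (0 : ℂ) 1) => hasDerivAt_rotation_Hk hk0 hk1 hl hz
  have hG : ∀ z ∈ ball (0 : ℂ) 1, HasDerivAt (fun z => l * Gk k (l * z))
      (-k * (l * z) * l ^ 2 * deriv (rotation l (Hk k)) z) z := fun z hz => by
    refine (((hasDerivAt_Gk hk0 hk1 (mul_mem_ball hl hz)).comp z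
      ((hasDerivAt_id z).const_mul l)).const_mul l).congr_deriv ?_
    rw [(hH z hz).deriv]
    ring
  have hne : ∀ z ∈ ball (0 : ℂ) 1, deriv (rotation l (Hk k)) z ≠ 0 := fun z hz => by
    have hz' := mul_mem_ball hl hz
    rw [(hH z hz).deriv]
    exact one_div_ne_zero (mul_ne_zero (pow_ne_zero 2 (one_sub_ne_zero_of_mem_ball hz'))
      (one_sub_ne_zero_of_mem_ball (ofReal_mul_mem_ball hk0 hk1 hz')))
  have hnG : ∀ z ∈ ball (0 : ℂ) 1, ‖deriv (fun z => l * Gk k (l * z)) z‖ =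
      k * ‖z‖ * ‖deriv (rotation l (Hk k)) z‖ := fun z hz => by
    rw [(hG z hz).deriv]
    simp [hl, abs_of_nonneg hk0]
  have hSH : ClassSH (rotation l (Lk k)) (rotation l (Hk k)) (fun z => l * Gk k (l * z)) :=
    { analytic_h := fun z hz => (hH z hz).differentiableAt.differentiableWithinAt
      analytic_g := fun z hz => (hG z hz).differentiableAt.differentiableWithinAt
      rep := fun z _ => by simp only [rotation, Lk, map_mul]; ring
      h_zero := by simp [rotation, Hk_zero]
      g_zero := by simp [Gk_zero]
      deriv_h_zero := by rw [(hH 0 h0).deriv]; simp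
      univalent := fun z hz w hw he => by
        have := injOn_Lk hk0 hk1 (mul_mem_ball hl hz) (mul_mem_ball hl hw) (mul_left_cancel₀ hl0 he)
        exact mul_left_cancel₀ hl0' this
      sense_preserving := fun z hz => by
        rw [jacobian, hnG z hz]
        have h1 := norm_pos_iff.2 (hne z hz)
        have h2 : k * ‖z‖ < 1 := by nlinarith [norm_nonneg z, mem_ball_zero_iff.1 hz]
        have h3 : 0 ≤ k * ‖z‖ := by positivity
        have h4 : k * ‖z‖ * ‖deriv (rotation l (Hk k)) z‖ < ‖deriv (rotation l (Hk k)) z‖ := by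
          nlinarith
        rw [sub_pos]
        gcongr }
  refine ⟨{ hSH with quasiregular := ⟨k, hk0, hk1, hK, fun z hz => ?_⟩ },
    { hSH with convex_range := ?_, deriv_g_zero := ?_ }⟩
  · rw [dilatation, norm_div, hnG z hz, mul_div_cancel_right₀ _ (norm_ne_zero_iff.2 (hne z hz))]
    nlinarith [norm_nonneg z, mem_ball_zero_iff.1 hz]
  · rw [disk, rotation_image hl, image_Lk hk0 hk1]
    refine Convex.linear_image ?_ (LinearMap.mulLeft ℝ (conj l))
    exact (convex_Ioi (-(1 / 2) : ℝ)).linear_preimage reLm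
  · rw [(hG 0 h0).deriv]; simp

/-! ### Reduction of the stated class and conclusion -/

theorem ClassCH0K.convexClass {k K : ℝ} {f h g : ℂ → ℂ} (hk1 : k < 1)
    (hK : K = (1 + k) / (1 - k)) (hC : ClassCH0K K f h g) : ConvexClass k h g := by
  obtain ⟨⟨hSH, k', hk0', hk1', hK', hdil⟩, hC0⟩ := hC
  -- The map `k ↦ (1 + k) / (1 - k)` is injective, so the existential dilatation bound is the given
  -- `k`.
  have hkk : k' = k := by
    rw [hK, div_eq_div_iff (by linarith) (by linarith)] at hK'
    linarith
  rw [hkk] at hdil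
  have hEq : EqOn f (hmap h g) (ball 0 1) := hSH.rep
  have hlt : ∀ z ∈ ball (0 : ℂ) 1, ‖deriv g z‖ < ‖deriv h z‖ := fun z hz =>
    lt_of_pow_lt_pow_left₀ 2 (norm_nonneg _) (sub_pos.1 (hSH.sense_preserving z hz))
  exact
    { diff_h := hSH.analytic_h
      diff_g := hSH.analytic_g
      injOn := hSH.univalent.congr hEq
      deriv_lt := hlt
      convex := by rw [← hEq.image_eq]; exact hC0.convex_range
      k_lt := hk1
      h_zero := hSH.h_zero
      deriv_h_zero := hSH.deriv_h_zero
      deriv_g_zero := hC0.deriv_g_zero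
      deriv_le := fun z hz => by
        have := hdil z hz
        rwa [dilatation, norm_div, div_le_iff₀ ((norm_nonneg _).trans_lt (hlt z hz))] at this }

end ConvexHarmonic

end

theorem theorem1 (k K : ℝ) (hk0 : 0 ≤ k) (hk1 : k < 1) (hK : K = (1 + k) / (1 - k)) :
    (∀ f h g : ℂ → ℂ, ConvexHarmonic.ClassCH0K K f h g → ∀ z ∈ ConvexHarmonic.disk,
      -- growth
      (ConvexHarmonic.B k ‖z‖ ≤ ‖h z‖ ∧ ‖h z‖ ≤ ConvexHarmonic.A k ‖z‖) ∧
      -- distortion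
      (1 / ((1 + ‖z‖) ^ 2 * (1 + k * ‖z‖)) ≤ ‖deriv h z‖ ∧
        ‖deriv h z‖ ≤ 1 / ((1 - ‖z‖) ^ 2 * (1 - k * ‖z‖))) ∧
      -- equality in the upper bounds, then in the lower bounds
      (z ≠ 0 →
        (‖h z‖ = ConvexHarmonic.A k ‖z‖ ↔
          Set.EqOn h (ConvexHarmonic.rotation (starRingEnd ℂ z / ‖z‖) (ConvexHarmonic.Hk k))
            ConvexHarmonic.disk) ∧
        (‖deriv h z‖ = 1 / ((1 - ‖z‖) ^ 2 * (1 - k * ‖z‖)) ↔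
          Set.EqOn h (ConvexHarmonic.rotation (starRingEnd ℂ z / ‖z‖) (ConvexHarmonic.Hk k))
            ConvexHarmonic.disk) ∧
        (‖h z‖ = ConvexHarmonic.B k ‖z‖ ↔
          Set.EqOn h (ConvexHarmonic.rotation (-(starRingEnd ℂ z / ‖z‖)) (ConvexHarmonic.Hk k))
            ConvexHarmonic.disk) ∧
        (‖deriv h z‖ = 1 / ((1 + ‖z‖) ^ 2 * (1 + k * ‖z‖)) ↔
          Set.EqOn h (ConvexHarmonic.rotation (-(starRingEnd ℂ z / ‖z‖)) (ConvexHarmonic.Hk k))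
            ConvexHarmonic.disk))) ∧
    -- the extremal functions belong to the class, so the bounds are attained
    (∀ lam : ℂ, ‖lam‖ = 1 →
      ConvexHarmonic.ClassCH0K K
        (ConvexHarmonic.rotation lam (ConvexHarmonic.Lk k))
        (ConvexHarmonic.rotation lam (ConvexHarmonic.Hk k))
        (fun z => lam * ConvexHarmonic.Gk k (lam * z))) := by
  refine ⟨fun f h g hC z hz => ?_, fun lam hlam =>
    ConvexHarmonic.classCH0K_rotation_Lk hk0 hk1 hK hlam⟩
  have T := ConvexHarmonic.ClassCH0K.convexClass hk1 hK hC
  have hr1 : ‖z‖ < 1 := mem_ball_zero_iff.1 hz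
  obtain ⟨hA, hA'⟩ := T.le_A hz
  obtain ⟨hB, hB'⟩ := T.B_le hz
  obtain ⟨hu, hl⟩ := T.le_and_le_norm_deriv hz
  have hpu : 0 < (1 - ‖z‖) ^ 2 * (1 - k * ‖z‖) := by
    have h1 : 0 < 1 - ‖z‖ := by linarith
    have h2 : 0 < 1 - k * ‖z‖ := by nlinarith [norm_nonneg z]
    positivity
  have hpl : 0 < (1 + ‖z‖) ^ 2 * (1 + k * ‖z‖) := by positivity
  refine ⟨⟨hB, hA⟩, ⟨by rwa [div_le_iff₀ hpl], by rwa [le_div_iff₀ hpu]⟩, fun hz0 => ?_⟩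
  have hr0 : 0 < ‖z‖ := norm_pos_iff.2 hz0
  have hrc : (‖z‖ : ℂ) ≠ 0 := Complex.ofReal_ne_zero.2 hr0.ne'
  have hlam : ‖starRingEnd ℂ z / ‖z‖‖ = 1 := by
    rw [norm_div, RCLike.norm_conj, Complex.norm_real, norm_norm, div_self hr0.ne']
  have hlam' : ‖-(starRingEnd ℂ z / ‖z‖)‖ = 1 := by rwa [norm_neg]
  have hlz : starRingEnd ℂ z / ‖z‖ * z = (‖z‖ : ℝ) := by
    rw [div_mul_eq_mul_div, div_eq_iff hrc, mul_comm, Complex.mul_conj,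
      Complex.normSq_eq_norm_sq, sq, Complex.ofReal_mul]
  have hlz' : -(starRingEnd ℂ z / ‖z‖) * z = ((-‖z‖ : ℝ) : ℂ) := by
    rw [neg_mul, hlz, Complex.ofReal_neg]
  refine ⟨⟨fun he => hA' he.ge hz0, fun he => ?_⟩,
    ⟨fun he => T.eqOn_of_norm_deriv_eq hz hz0 hlam hlz ?_, fun he => ?_⟩,
    ⟨fun he => hB' he.le hz0, fun he => ?_⟩,
    ⟨fun he => T.eqOn_of_norm_deriv_eq hz hz0 hlam' hlz' ?_, fun he => ?_⟩⟩
  · rw [(T.norm_eq_of_eqOn hlam he hz hlz).1, norm_mul, RCLike.norm_conj, hlam, one_mul,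
      Complex.norm_real, Real.norm_of_nonneg ((norm_nonneg _).trans hA)]
  · rw [he, one_div_mul_cancel hpu.ne']
  · exact (T.norm_eq_of_eqOn hlam he hz hlz).2
  · rw [(T.norm_eq_of_eqOn hlam' he hz hlz').1, ConvexHarmonic.A_neg, norm_mul, RCLike.norm_conj,
      hlam', one_mul, Complex.norm_real, norm_neg,
      Real.norm_of_nonneg (ConvexHarmonic.B_nonneg hk0 hk1 hr0.le hr1)]
  · rw [he, sub_neg_eq_add, mul_neg, sub_neg_eq_add, one_div_mul_cancel hpl.ne']
  · rw [(T.norm_eq_of_eqOn hlam' he hz hlz').2, sub_neg_eq_add, mul_neg, sub_neg_eq_add]
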